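/- Let $d\ge 2$ and $\epsilon\in[0,1]$, and let $(\tau_\epsilon(x))_{x\in\mathbb Z^d}$ be independent Bernoulli random variables with parameter $1-\epsilon$ (so a vertex has passage time $0$ with probability $\epsilon$ and $1$ otherwise). For a nearest-neighbour path $\pi=(x_0,\dots,x_n)$ in $\mathbb Z^d$ put $\tau_\epsilon(\pi)=\sum_{i=0}^{n-1}\tau_\epsilon(x_i)$, and let $T_\epsilon(x,y)$ be the infimum of $\tau_\epsilon(\pi)$ over all paths $\pi$ from $x$ to $y$. For $z\in\mathbb R^d\setminus\{0\}$ the time constant $$\mu_\epsilon(z)=\lim_{n\to\infty}\frac1n\,\mathbb E\big[T_\epsilon(0,\lfloor nz\rfloor)\big]$$ exists, where $\lfloor nz\rfloor$ is the coordinatewise integer part. Let $d_1(z)=\#\{i: z_i\ne0\}$, $d_2(z)=d-d_1(z)$ and $\gamma(z)=\prod_{i:z_i\neq0}|z_i|^{1/d_1(z)}$. For $d_1\ge1$, $d_2\ge0$ let $\xi$ be a Poisson point process on $\mathbb R^{d_1}\times\mathbb Z^{d_2}$ whose intensity is the product of Lebesgue measure and counting measure. Write $x\prec y$ (resp. $x\preceq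 y$) if $x_i<y_i$ (resp. $x_i\le y_i$) for all $i\le d_1$, with no condition on the last $d_2$ coordinates. For $z\in(0,\infty)^{d_1}\times\{0\}^{d_2}$ let $$S^{\mathcal C}_0(z)=\sup\Big\{k-\sum_{i=1}^{k+1}\big\|\mathrm{Proj}(w(i))-\mathrm{Proj}(w(i-1))\big\|_1\Big\},$$ where the supremum is over all $k\ge0$ and all $w(1),\dots,w(k)\in\xi$ with $0\preceq w(1)\prec\dots\prec w(k)\prec z$, with $w(0)=0$, $w(k+1)=z$, and where $\mathrm{Proj}$ is the projection onto $\mathbb Z^{d_2}$. Let $\mathbf 1_{d_1}=(1,\dots,1,0,\dots,0)\in\mathbb R^{d_1}\times\mathbb Z^{d_2}$, with $d_1$ ones. Theorem. For all $d_1\ge1$ and $d_2\ge0$ the limit $$C(d_1,d_2)=\sigma^{\mathcal C}_0(\mathbf 1_{d_1})=\lim_{\lambda\to\infty}\frac1\lambda\,\mathbb E\big[S^{\mathcal C}_0(\lambda\mathbf 1_{d_1})\big]$$ exists and is positive and finite, and for all $d\ge2$ and all $z\in\mathbb R^d\setminus\{0\}$, $$\mu_\epsilon(z)=\|z\|_1-C(d_1(z),d_2(z))\,\gamma(z)\,\epsilon^{1/d_1(z)}+o\big(\epsilon^{1/d_1(z)}\big)\quad\text{as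 }\epsilon\to0.$$ -/

import Mathlib

open MeasureTheory ProbabilityTheory Filter Topology Asymptotics

noncomputable section

/-! ### Bernoulli site first-passage percolation on `ℤ^d` -/

/-- The usual nearest-neighbour graph on `ℤ^d`. Two integer points are at Euclidean distance one
if and only if they are at `ℓ¹` distance one. -/
def latticeGraph (d : ℕ) : SimpleGraph (Fin d → ℤ) where
  Adj x y := ∑ i, |x i - y i| = 1
  symm := ⟨fun x y h => by simpa only [abs_sub_comm] using h⟩
  loopless := ⟨fun x h => by simp at h⟩

/-- Travel time of a path `(x_0, …, x_n)`: the sum of `τ (x_i)` over `0 ≤ i ≤ n - 1`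
(the last vertex is not counted). -/
def travelTime {d : ℕ} (τ : (Fin d → ℤ) → ℕ) {x y : Fin d → ℤ}
    (p : (latticeGraph d).Walk x y) : ℕ :=
  (p.support.dropLast.map τ).sum

/-- The time between `x` and `y`: the infimum of the travel times over all paths
from `x` to `y`. -/
def passageTime {d : ℕ} (τ : (Fin d → ℤ) → ℕ) (x y : Fin d → ℤ) : ℕ :=
  ⨅ p : (latticeGraph d).Walk x y, travelTime τ p

/-- The law of a family `(τ x)` of independent Bernoulli random variables with parameter `1 - ε`,
indexed by the sites `x` of `ℤ^d`. -/
def siteMeasure (d : ℕ) (ε : unitInterval) : Measure ((Fin d → ℤ) → ℕ) :=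
  Measure.infinitePi fun _ => bernoulliMeasure 1 0 (unitInterval.symm ε)

/-- `E [T_ε(0, ⌊n z⌋)] / n`, with `⌊n z⌋` the coordinatewise integer part. -/
def meanPassageTime (d : ℕ) (ε : unitInterval) (z : Fin d → ℝ) (n : ℕ) : ℝ :=
  (∫ τ, (passageTime τ 0 (fun i => ⌊(n : ℝ) * z i⌋) : ℝ) ∂(siteMeasure d ε)) / n

/-- The time constant `μ_ε(z)`, the limit of `E [T_ε(0, ⌊n z⌋)] / n`. -/
def timeConstant (d : ℕ) (ε : unitInterval) (z : Fin d → ℝ) : ℝ :=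
  limUnder atTop (meanPassageTime d ε z)

/-! ### Dependence on the direction -/

/-- The number of nonzero coordinates of `z`. -/
def numNonzero {d : ℕ} (z : Fin d → ℝ) : ℕ :=
  (Finset.univ.filter fun i => z i ≠ 0).card

/-- The number of zero coordinates of `z`. -/
def numZero {d : ℕ} (z : Fin d → ℝ) : ℕ :=
  (Finset.univ.filter fun i => z i = 0).card

/-- The geometric mean of the absolute values of the nonzero coordinates of `z`. -/
def geomMean {d : ℕ} (z : Fin d → ℝ) : ℝ :=
  ∏ i ∈ Finset.univ.filter (fun i => z i ≠ 0), |z i| ^ (1 / (numNonzero z : ℝ))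

/-! ### The semi-continuous oriented Poisson model on `ℝ^{d₁} × ℤ^{d₂}` -/

/-- The space `ℝ^{d₁} × ℤ^{d₂}`. -/
abbrev SemiSpace (d₁ d₂ : ℕ) : Type := (Fin d₁ → ℝ) × (Fin d₂ → ℤ)

/-- The product of Lebesgue measure on `ℝ^{d₁}` and counting measure on `ℤ^{d₂}`. -/
def semiIntensity (d₁ d₂ : ℕ) : Measure (SemiSpace d₁ d₂) :=
  (volume : Measure (Fin d₁ → ℝ)).prod Measure.count

/-- The random set `ξ` is a (simple) Poisson point process with intensity measure `ν`: the numbers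
of points in measurable sets are random variables, Poisson with parameter `ν B` when `ν B` is
finite, and independent for pairwise disjoint sets. -/
structure IsPoissonPointProcess {Ω E : Type*} [MeasurableSpace Ω] [MeasurableSpace E]
    (ξ : Ω → Set E) (ν : Measure E) (P : Measure Ω) : Prop where
  measurable_count : ∀ B : Set E, MeasurableSet B → Measurable fun ω => (ξ ω ∩ B).encard
  map_count : ∀ B : Set E, MeasurableSet B → ν B ≠ ⊤ →
    P.map (fun ω => (ξ ω ∩ B).encard)
      = (poissonMeasure (ν B).toNNReal).map (fun n : ℕ => (n : ℕ∞))
  indep_count : ∀ (m : ℕ) (B : Fin m → Set E), (∀ i, MeasurableSet (B i)) →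
    (∀ i j, i ≠ j → Disjoint (B i) (B j)) →
    iIndepFun (fun i ω => (ξ ω ∩ B i).encard) P

/-- `w 1, …, w k` are points of `ξ` such that `0 ⪯ w 1 ≺ ⋯ ≺ w k ≺ (x, 0)`, where `⪯` and `≺` are
the large and the strict inequality for all the coordinates in `ℝ^{d₁}` (with no requirement on
the coordinates in `ℤ^{d₂}`); by convention `w 0 = 0` and `w (k + 1) = (x, 0)`. -/
structure IsMonotoneSeq {d₁ d₂ : ℕ} (ξ : Set (SemiSpace d₁ d₂)) (x : Fin d₁ → ℝ)
    (k : ℕ) (w : ℕ → SemiSpace d₁ d₂) : Prop where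
  left : w 0 = 0
  right : w (k + 1) = (x, 0)
  mem : ∀ i, 1 ≤ i → i ≤ k → w i ∈ ξ
  first_le : ∀ j, (w 0).1 j ≤ (w 1).1 j
  lt_next : ∀ i, 1 ≤ i → i ≤ k → ∀ j, (w i).1 j < (w (i + 1)).1 j

/-- The total vertical displacement `∑_{i=1}^{k+1} ‖w(i)_vert - w(i-1)_vert‖₁`. -/
def verticalDisplacement {d₁ d₂ : ℕ} (k : ℕ) (w : ℕ → SemiSpace d₁ d₂) : ℤ :=
  ∑ i ∈ Finset.range (k + 1), ∑ j, |(w (i + 1)).2 j - (w i).2 j|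

/-- The score of `(x, 0)`: the supremum of `k - V(w)` over all monotone sequences `w` of `k ≥ 0`
points of `ξ` between `0` and `(x, 0)`. For `x ≥ 0` the empty sequence contributes `0`, so that
truncating `k - V(w)` at `0` does not change the supremum. -/
def score {d₁ d₂ : ℕ} (ξ : Set (SemiSpace d₁ d₂)) (x : Fin d₁ → ℝ) : ENNReal :=
  ⨆ (k : ℕ) (w : ℕ → SemiSpace d₁ d₂) (_ : IsMonotoneSeq ξ x k w),
    ENNReal.ofReal ((k : ℝ) - (verticalDisplacement k w : ℝ))

/-- The mean directional score in the direction `(x, 0)` is `c`: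
`E [S(t x)] / t → c` as the real number `t` tends to infinity. -/
def HasDirectionalScore {Ω : Type*} [MeasurableSpace Ω] {d₁ d₂ : ℕ} (P : Measure Ω)
    (ξ : Ω → Set (SemiSpace d₁ d₂)) (x : Fin d₁ → ℝ) (c : ENNReal) : Prop :=
  Tendsto (fun t : ℝ => (∫⁻ ω, score (ξ ω) (t • x) ∂P) / ENNReal.ofReal t) atTop (𝓝 c)

end

noncomputable section

/-! ### Passage times on the lattice -/

/-! The configuration of zeros is read off a Poisson process. Cut `ℝ^{d₁} × ℤ^{d₂}` into boxes with
sides `h a` and declare a site to be a zero when its box is hit. If `∏ h a = -log (1 - ε)`, this is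
exactly the Bernoulli environment (`map_config`). With `h a` proportional to `1 / |z_a|`
(`Frame.mesh`), the point `⌊n z⌋` lands near `κ n 𝟏`, where `κ = meshSize * geomMean z ∼ γ(z)
ε^{1/d₁}`. The anisotropy of `z` thus disappears into `κ`, and what has to be shown is that
`normalizedGain`, which is `(‖z‖₁ - μ_ε(z)) / κ`, converges to the growth rate of the mean score.

Gain bounded below by score: every point of a monotone sequence gives one free step and every
vertical move costs its length. Once the mesh is finer than the gaps of a given sequence, its points
lie in strictly increasing boxes, so the score is at most the liminf of the gains
(`Frame.score_le_liminf_gain`). Fatou's lemma carries this to expectations, and subadditivity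
(`meanGain_le`) bounds the mean gain at a finite scale by its asymptotic slope, up to the constant
`2 * d`.

Gain bounded above by score: list the zeros on a loop-free geodesic. A greedy selection keeps a
strictly increasing chain, and a potential argument (`length_sub_length_greedy_le`) charges the
discarded zeros to short steps and backward displacement (`Frame.exists_list_of_gain`). An
exponentially weighted first moment over all sequences of distinct occupied boxes
(`lintegral_occupiedWeight_le`) bounds the expected loss at macroscopic time `t` by `(A t + D) / θ`.
Here `A` does not depend on `θ`, so the loss per unit time is as small as desired
(`exists_upper_bound`).

The two bounds tie a function of `t` alone to a function of `ε` alone. Compactness then makes both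
converge to one limit (`exists_tendsto_of_comparison`), with no separate subadditivity argument for
the score. Since one side ignores `z` and the other ignores the chosen Poisson process, the limit
depends only on `d₁` and `d₂` (`exists_constant`). It is positive because disjoint boxes along the
diagonal already give linear growth (`le_lintegral_score`). -/

/-- The `ℓ¹` norm on `ℤ^d`, as a natural number. -/
def l1 {ι : Type*} [Fintype ι] (x : ι → ℤ) : ℕ := ∑ i, (x i).natAbs

lemma l1_cast {ι : Type*} [Fintype ι] (x : ι → ℤ) : ((l1 x : ℕ) : ℤ) = ∑ i, |x i| := by
  simp [l1]

lemma l1_zero {ι : Type*} [Fintype ι] : l1 (0 : ι → ℤ) = 0 := by simp [l1]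

lemma l1_eq_zero {ι : Type*} [Fintype ι] {x : ι → ℤ} (h : l1 x = 0) : x = 0 := by
  funext i
  simpa using (Finset.sum_eq_zero_iff.1 h) i (Finset.mem_univ i)

lemma l1_add_le {ι : Type*} [Fintype ι] (x y : ι → ℤ) : l1 (x + y) ≤ l1 x + l1 y := by
  rw [l1, l1, l1, ← Finset.sum_add_distrib]
  exact Finset.sum_le_sum fun i _ => Int.natAbs_add_le _ _

lemma adj_iff_l1 {d : ℕ} {x y : Fin d → ℤ} : (latticeGraph d).Adj x y ↔ l1 (y - x) = 1 := by
  have : (latticeGraph d).Adj x y ↔ ∑ i, |x i - y i| = 1 := Iff.rfl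
  rw [this, ← Nat.cast_inj (R := ℤ), l1_cast]
  simp [abs_sub_comm]

lemma exists_walk_length {d : ℕ} (x y : Fin d → ℤ) :
    ∃ p : (latticeGraph d).Walk x y, p.length = l1 (y - x) := by
  induction h : l1 (y - x) generalizing x with
  | zero =>
    have := l1_eq_zero h
    obtain rfl : y = x := sub_eq_zero.1 this
    exact ⟨.nil, rfl⟩
  | succ n ih =>
    have hne : ∃ i, (y - x) i ≠ 0 := by
      by_contra! hc
      have : y - x = 0 := funext hc
      rw [this, l1_zero] at h
      omega
    obtain ⟨i, hi⟩ := hne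
    let e : Fin d → ℤ := Pi.single i (y i - x i).sign
    have he : l1 e = 1 := by
      rw [l1, Finset.sum_eq_single i]
      · simpa [e] using Int.natAbs_sign_of_ne_zero hi
      · intro j _ hj; simp [e, hj]
      · simp
    have hs : l1 (y - (x + e)) + 1 = l1 (y - x) := by
      rw [l1, l1, ← Finset.add_sum_erase _ _ (Finset.mem_univ i),
        ← Finset.add_sum_erase _ _ (Finset.mem_univ i)]
      have h1 : ∑ j ∈ Finset.univ.erase i, ((y - (x + e)) j).natAbs
          = ∑ j ∈ Finset.univ.erase i, ((y - x) j).natAbs := by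
        refine Finset.sum_congr rfl fun j hj => ?_
        simp [e, Finset.ne_of_mem_erase hj]
      have h2 : ((y - (x + e)) i).natAbs + 1 = ((y - x) i).natAbs := by
        simp only [Pi.sub_apply, Pi.add_apply, e, Pi.single_eq_same] at hi ⊢
        rcases lt_trichotomy (y i - x i) 0 with h | h | h
        · rw [Int.sign_eq_neg_one_of_neg h]; omega
        · exact absurd h hi
        · rw [Int.sign_eq_one_of_pos h]; omega
      omega
    obtain ⟨p, hp⟩ := ih (x + e) (by omega)
    refine ⟨.cons (adj_iff_l1.2 (by simpa using he)) p, by simp [hp]⟩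

instance {d : ℕ} (x y : Fin d → ℤ) : Nonempty ((latticeGraph d).Walk x y) :=
  ⟨(exists_walk_length x y).choose⟩

instance {d : ℕ} (x y : Fin d → ℤ) : Countable ((latticeGraph d).Walk x y) :=
  Function.Injective.countable (f := fun p => p.support)
    fun _ _ h => SimpleGraph.Walk.ext_support h

lemma travelTime_nil {d : ℕ} (τ : (Fin d → ℤ) → ℕ) (x : Fin d → ℤ) :
    travelTime τ (.nil : (latticeGraph d).Walk x x) = 0 := by simp [travelTime]

lemma travelTime_cons {d : ℕ} (τ : (Fin d → ℤ) → ℕ) {x y z : Fin d → ℤ}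
    (h : (latticeGraph d).Adj x y) (p : (latticeGraph d).Walk y z) :
    travelTime τ (.cons h p) = τ x + travelTime τ p := by
  simp [travelTime, List.dropLast_cons_of_ne_nil]

lemma travelTime_append {d : ℕ} (τ : (Fin d → ℤ) → ℕ) {x y z : Fin d → ℤ}
    (p : (latticeGraph d).Walk x y) (q : (latticeGraph d).Walk y z) :
    travelTime τ (p.append q) = travelTime τ p + travelTime τ q := by
  rw [travelTime, SimpleGraph.Walk.support_append_eq_support_dropLast_append,
    List.dropLast_append_of_ne_nil (by simp)]
  simp [travelTime]

lemma passageTime_le_travelTime {d : ℕ} (τ : (Fin d → ℤ) → ℕ) {x y : Fin d → ℤ}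
    (p : (latticeGraph d).Walk x y) : passageTime τ x y ≤ travelTime τ p :=
  ciInf_le (OrderBot.bddBelow _) p

lemma exists_travelTime_eq {d : ℕ} (τ : (Fin d → ℤ) → ℕ) (x y : Fin d → ℤ) :
    ∃ p : (latticeGraph d).Walk x y, travelTime τ p = passageTime τ x y :=
  Nat.sInf_mem (Set.range_nonempty _)

lemma passageTime_triangle {d : ℕ} (τ : (Fin d → ℤ) → ℕ) (x y z : Fin d → ℤ) :
    passageTime τ x z ≤ passageTime τ x y + passageTime τ y z := by
  obtain ⟨p, hp⟩ := exists_travelTime_eq τ x y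
  obtain ⟨q, hq⟩ := exists_travelTime_eq τ y z
  rw [← hp, ← hq, ← travelTime_append]
  exact passageTime_le_travelTime _ _

lemma travelTime_le_length {d : ℕ} {τ : (Fin d → ℤ) → ℕ} (hτ : ∀ x, τ x ≤ 1) {x y : Fin d → ℤ}
    (p : (latticeGraph d).Walk x y) : travelTime τ p ≤ p.length := by
  induction p with
  | nil => simp [travelTime_nil]
  | @cons u v w h p ih =>
    rw [travelTime_cons, SimpleGraph.Walk.length_cons]
    linarith [hτ u]

lemma passageTime_le_l1 {d : ℕ} {τ : (Fin d → ℤ) → ℕ} (hτ : ∀ x, τ x ≤ 1) (x y : Fin d → ℤ) :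
    passageTime τ x y ≤ l1 (y - x) := by
  obtain ⟨p, hp⟩ := exists_walk_length x y
  exact hp ▸ (passageTime_le_travelTime τ p).trans (travelTime_le_length hτ p)

/-- The starting vertex is counted, so a shortest path leaving a zero gets its first step for free.
This needs `x ≠ y`: the trivial path counts no vertex and saves nothing. -/
lemma passageTime_add_one_le {d : ℕ} {τ : (Fin d → ℤ) → ℕ} (hτ : ∀ x, τ x ≤ 1)
    {x y : Fin d → ℤ} (hx : τ x = 0) (hxy : x ≠ y) :
    passageTime τ x y + 1 ≤ l1 (y - x) := by
  obtain ⟨p, hp⟩ := exists_walk_length x y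
  rw [← hp]
  refine (Nat.add_le_add_right (passageTime_le_travelTime τ p) 1).trans ?_
  cases p with
  | nil => exact absurd rfl hxy
  | cons h p =>
    rw [travelTime_cons, SimpleGraph.Walk.length_cons, hx, zero_add]
    exact Nat.add_le_add_right (travelTime_le_length hτ p) 1

lemma passageTime_shift {d : ℕ} (τ : (Fin d → ℤ) → ℕ) (v x y : Fin d → ℤ) :
    passageTime τ (x + v) (y + v) = passageTime (fun w => τ (w + v)) x y := by
  have key : ∀ (τ : (Fin d → ℤ) → ℕ) (v x y : Fin d → ℤ),
      passageTime τ (x + v) (y + v) ≤ passageTime (fun w => τ (w + v)) x y := by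
    intro τ v x y
    obtain ⟨p, hp⟩ := exists_travelTime_eq (fun w => τ (w + v)) x y
    rw [← hp]
    let F : latticeGraph d →g latticeGraph d :=
      ⟨fun w => w + v, fun {a b} h => by rw [adj_iff_l1] at h ⊢; simpa using h⟩
    refine (passageTime_le_travelTime τ (p.map F)).trans_eq ?_
    simp only [travelTime, SimpleGraph.Walk.support_map, ← List.map_dropLast, List.map_map]
    rfl
  refine le_antisymm (key τ v x y) ?_
  have := key (fun w => τ (w + v)) (-v) (x + v) (y + v)
  simpa using this

lemma measurable_passageTime {d : ℕ} (x y : Fin d → ℤ) :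
    Measurable fun τ : (Fin d → ℤ) → ℕ => passageTime τ x y := by
  have ht : ∀ p : (latticeGraph d).Walk x y, Measurable fun τ => travelTime τ p := by
    intro p
    have : ∀ l : List (Fin d → ℤ), Measurable fun τ : (Fin d → ℤ) → ℕ => (l.map τ).sum := by
      intro l
      induction l with
      | nil => simp
      | cons a l ih =>
        simp only [List.map_cons, List.sum_cons]
        exact (measurable_pi_apply a).add ih
    exact this _
  refine measurable_of_Iic fun n => ?_
  have : (fun τ : (Fin d → ℤ) → ℕ => passageTime τ x y) ⁻¹' Set.Iic n
      = ⋃ p : (latticeGraph d).Walk x y, {τ | travelTime τ p ≤ n} := by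
    ext τ
    simp only [Set.mem_preimage, Set.mem_Iic, Set.mem_iUnion, Set.mem_ofPred_eq]
    refine ⟨fun h => ?_, fun ⟨p, hp⟩ => (passageTime_le_travelTime τ p).trans hp⟩
    obtain ⟨p, hp⟩ := exists_travelTime_eq τ x y
    exact ⟨p, hp ▸ h⟩
  rw [this]
  exact MeasurableSet.iUnion fun p => measurableSet_le (ht p) measurable_const

/-! ### Chains of zeros along a geodesic -/

/-- The sum of `c` over the consecutive pairs of the sequence `a, l, b`. -/
def chainCost {α β : Type*} [AddCommMonoid β] (c : α → α → β) : α → List α → α → β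
  | a, [], b => c a b
  | a, w :: l, b => c a w + chainCost c w l b

lemma chainCost_le_length {d : ℕ} {x y : Fin d → ℤ} (p : (latticeGraph d).Walk x y)
    {l : List (Fin d → ℤ)} (hl : l.Sublist p.support.dropLast) :
    chainCost (fun a b => l1 (b - a)) x l y ≤ p.length := by
  induction p generalizing l with
  | nil =>
    obtain rfl : l = [] := by simpa using hl
    simp [chainCost, l1_zero]
  | @cons x x' y h p ih =>
    rw [SimpleGraph.Walk.support_cons, List.dropLast_cons_of_ne_nil (by simp)] at hl
    have h1 := adj_iff_l1.1 h
    have key : ∀ l' : List (Fin d → ℤ), l'.Sublist p.support.dropLast →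
        chainCost (fun a b => l1 (b - a)) x l' y ≤ p.length + 1 := by
      intro l' hl'
      have h2 := ih hl'
      cases l' with
      | nil =>
        have := l1_add_le (x' - x) (y - x')
        simp only [chainCost, sub_add_sub_cancel'] at h2 this ⊢
        omega
      | cons w l' =>
        have := l1_add_le (x' - x) (w - x')
        simp only [chainCost, sub_add_sub_cancel'] at h2 this ⊢
        omega
    rw [SimpleGraph.Walk.length_cons]
    cases hl with
    | cons _ hl => exact key _ hl
    | cons_cons _ hl =>
      simpa [chainCost, l1_zero] using key _ hl

/-- The length of a path is its travel time plus the number of zeros it visits, and it dominates the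
length of any chain threaded through them. Loops are erased first: distinct zeros are needed later
to use independence. -/
lemma exists_zeros_of_passageTime {d : ℕ} {τ : (Fin d → ℤ) → ℕ} (hτ : ∀ x, τ x ≤ 1)
    (x y : Fin d → ℤ) : ∃ l : List (Fin d → ℤ), l.Nodup ∧ (∀ w ∈ l, τ w = 0) ∧
      chainCost (fun a b => l1 (b - a)) x l y ≤ passageTime τ x y + l.length := by
  obtain ⟨p, hp⟩ := exists_travelTime_eq τ x y
  refine ⟨p.bypass.support.dropLast.filter fun w => τ w = 0, ?_, by simp, ?_⟩
  · exact ((p.bypass_isPath.support_nodup).sublist (List.dropLast_sublist _)).filter _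
  -- Sublists are stable under `tail` but have to be reversed to lose their last element.
  · have hsub : p.bypass.support.dropLast.Sublist p.support.dropLast := by
      have := List.reverse_sublist.2 (SimpleGraph.Walk.support_bypass_sublist_support p)
      have := List.Sublist.tail this
      rwa [List.tail_reverse, List.tail_reverse, List.reverse_sublist] at this
    have h1 := chainCost_le_length p.bypass
      (List.filter_sublist (l := p.bypass.support.dropLast) (p := fun w => τ w = 0))
    have h2 : travelTime τ p.bypass ≤ travelTime τ p :=
      List.Sublist.sum_le_sum (hsub.map τ) (by simp)
    have h3 : ∀ l : List (Fin d → ℤ),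
        l.length = (l.map τ).sum + (l.filter fun w => τ w = 0).length := by
      intro l
      induction l with
      | nil => simp
      | cons a l ih =>
        have := hτ a
        by_cases h : τ a = 0
        · simp [h]; omega
        · have h' : τ a = 1 := by omega
          simp [h']; omega
    have h4 := h3 p.bypass.support.dropLast
    have h5 : p.bypass.support.dropLast.length = p.bypass.length := by simp
    have h6 : travelTime τ p.bypass = (p.bypass.support.dropLast.map τ).sum := rfl
    omega

/-! ### Existence of the time constant -/

instance (d : ℕ) (ε : unitInterval) : IsProbabilityMeasure (siteMeasure d ε) := by
  unfold siteMeasure; infer_instance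

lemma ae_site_le_one (d : ℕ) (ε : unitInterval) :
    ∀ᵐ τ ∂(siteMeasure d ε), ∀ x, τ x ≤ 1 := by
  rw [ae_all_iff]
  intro x
  have h : (siteMeasure d ε).map (fun τ => τ x) = bernoulliMeasure 1 0 (unitInterval.symm ε) :=
    Measure.infinitePi_map_eval _ x
  have h2 : ∀ᵐ k ∂((siteMeasure d ε).map fun τ => τ x), k ≤ 1 := by
    rw [h, ae_iff, bernoulliMeasure_apply _ (MeasurableSet.of_discrete)]
    simp
  exact ae_of_ae_map (measurable_pi_apply x).aemeasurable h2

lemma map_shift_siteMeasure (d : ℕ) (ε : unitInterval) (v : Fin d → ℤ) :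
    (siteMeasure d ε).map (fun τ w => τ (w + v)) = siteMeasure d ε :=
  Measure.map_infinitePi_infinitePi_of_inj
    (P := fun _ : Fin d → ℤ => bernoulliMeasure 1 0 (unitInterval.symm ε)) (add_left_injective v)

/-- The mean passage time between two sites. -/
def meanTime (d : ℕ) (ε : unitInterval) (x y : Fin d → ℤ) : ℝ :=
  ∫ τ, (passageTime τ x y : ℝ) ∂(siteMeasure d ε)

lemma integrable_passageTime (d : ℕ) (ε : unitInterval) (x y : Fin d → ℤ) :
    Integrable (fun τ => (passageTime τ x y : ℝ)) (siteMeasure d ε) := by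
  refine Integrable.of_bound
    (measurable_from_nat.comp (measurable_passageTime x y)).aestronglyMeasurable
    (l1 (y - x) : ℝ) ?_
  filter_upwards [ae_site_le_one d ε] with τ hτ
  simpa using passageTime_le_l1 hτ x y

lemma meanTime_nonneg (d : ℕ) (ε : unitInterval) (x y : Fin d → ℤ) : 0 ≤ meanTime d ε x y :=
  integral_nonneg fun _ => Nat.cast_nonneg _

lemma meanTime_le_l1 (d : ℕ) (ε : unitInterval) (x y : Fin d → ℤ) :
    meanTime d ε x y ≤ l1 (y - x) := by
  have : meanTime d ε x y ≤ ∫ _, (l1 (y - x) : ℝ) ∂(siteMeasure d ε) := by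
    refine integral_mono_ae (integrable_passageTime d ε x y) (integrable_const _) ?_
    filter_upwards [ae_site_le_one d ε] with τ hτ
    exact_mod_cast passageTime_le_l1 hτ x y
  simpa using this

lemma meanTime_triangle (d : ℕ) (ε : unitInterval) (x y z : Fin d → ℤ) :
    meanTime d ε x z ≤ meanTime d ε x y + meanTime d ε y z := by
  rw [meanTime, meanTime, meanTime, ← integral_add (integrable_passageTime ..)
    (integrable_passageTime ..)]
  refine integral_mono (integrable_passageTime ..)
    ((integrable_passageTime ..).add (integrable_passageTime ..)) fun τ => ?_
  have := passageTime_triangle τ x y z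
  beta_reduce
  exact_mod_cast this

lemma meanTime_shift (d : ℕ) (ε : unitInterval) (v x y : Fin d → ℤ) :
    meanTime d ε (x + v) (y + v) = meanTime d ε x y := by
  have hm : Measurable fun (τ : (Fin d → ℤ) → ℕ) w => τ (w + v) := by fun_prop
  rw [meanTime, meanTime]
  conv_rhs => rw [← map_shift_siteMeasure d ε v]
  have hT : Measurable fun τ : (Fin d → ℤ) → ℕ => (passageTime τ x y : ℝ) :=
    measurable_from_nat.comp (measurable_passageTime x y)
  rw [integral_map hm.aemeasurable hT.aestronglyMeasurable]
  simp only [passageTime_shift]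

/-- The coordinatewise integer part of `n z`. -/
def floorPoint {d : ℕ} (z : Fin d → ℝ) (n : ℕ) : Fin d → ℤ := fun i => ⌊(n : ℝ) * z i⌋

lemma meanPassageTime_eq (d : ℕ) (ε : unitInterval) (z : Fin d → ℝ) (n : ℕ) :
    meanPassageTime d ε z n = meanTime d ε 0 (floorPoint z n) / n := rfl

lemma l1_floorPoint_add_le {d : ℕ} (z : Fin d → ℝ) (m n : ℕ) :
    l1 (floorPoint z (m + n) - (floorPoint z n + floorPoint z m)) ≤ d := by
  have : ∀ i, ((floorPoint z (m + n) - (floorPoint z n + floorPoint z m)) i).natAbs ≤ 1 := by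
    intro i
    simp only [floorPoint, Pi.sub_apply, Pi.add_apply, Nat.cast_add, add_mul]
    have h1 := Int.le_floor_add ((m : ℝ) * z i) ((n : ℝ) * z i)
    have h2 := Int.le_floor_add_floor ((m : ℝ) * z i) ((n : ℝ) * z i)
    omega
  simpa [l1] using Finset.sum_le_card_nsmul Finset.univ _ 1 fun i _ => this i

lemma meanTime_floorPoint_add (d : ℕ) (ε : unitInterval) (z : Fin d → ℝ) (m n : ℕ) :
    meanTime d ε 0 (floorPoint z (m + n)) ≤
      meanTime d ε 0 (floorPoint z m) + meanTime d ε 0 (floorPoint z n) + d := by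
  have h1 := meanTime_triangle d ε 0 (floorPoint z m) (floorPoint z (m + n))
  have h2 := meanTime_triangle d ε (floorPoint z m) (floorPoint z n + floorPoint z m)
    (floorPoint z (m + n))
  have h3 := meanTime_shift d ε (floorPoint z m) 0 (floorPoint z n)
  have h4 := meanTime_le_l1 d ε (floorPoint z n + floorPoint z m) (floorPoint z (m + n))
  have h5 : (l1 (floorPoint z (m + n) - (floorPoint z n + floorPoint z m)) : ℝ) ≤ d :=
    mod_cast l1_floorPoint_add_le z m n
  rw [zero_add] at h3
  linarith

/-- Integer parts are additive up to one unit per coordinate; the added constant `d` absorbs this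
defect. -/
lemma subadditive_meanTime (d : ℕ) (ε : unitInterval) (z : Fin d → ℝ) :
    Subadditive fun n => meanTime d ε 0 (floorPoint z n) + d := fun m n => by
  have := meanTime_floorPoint_add d ε z m n
  linarith

/-- Fekete's lemma. The second half, that the limit is below every normalized term, is what later
controls the gain at a fixed `n`. -/
lemma tendsto_meanPassageTime (d : ℕ) (ε : unitInterval) (z : Fin d → ℝ) :
    Tendsto (meanPassageTime d ε z) atTop (𝓝 (timeConstant d ε z)) ∧
      ∀ n : ℕ, n ≠ 0 → timeConstant d ε z ≤ (meanTime d ε 0 (floorPoint z n) + d) / n := by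
  have hb : BddBelow (Set.range fun n : ℕ => (meanTime d ε 0 (floorPoint z n) + d) / n) :=
    ⟨0, by rintro _ ⟨n, rfl⟩; have := meanTime_nonneg d ε 0 (floorPoint z n); positivity⟩
  have h := (subadditive_meanTime d ε z).tendsto_lim hb
  have h2 : Tendsto (fun n : ℕ => (d : ℝ) / n) atTop (𝓝 0) :=
    tendsto_const_div_atTop_nhds_zero_nat _
  have h3 : Tendsto (meanPassageTime d ε z) atTop (𝓝 (subadditive_meanTime d ε z).lim) := by
    have := h.sub h2
    rw [sub_zero] at this
    refine this.congr fun n => ?_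
    rw [meanPassageTime_eq]; ring
  have h4 : timeConstant d ε z = (subadditive_meanTime d ε z).lim := h3.limUnder_eq
  rw [h4]
  exact ⟨h3, fun n hn => (subadditive_meanTime d ε z).lim_le_div hb hn⟩

/-! ### Construction of a Poisson point process with a countable sum of probability measures
as intensity -/

lemma integral_infinitePi_finset_prod {ι : Type*} {X : ι → Type*} [∀ i, MeasurableSpace (X i)]
    (μ : ∀ i, Measure (X i)) [∀ i, IsProbabilityMeasure (μ i)] (s : Finset ι)
    {φ : ∀ i, X i → ℂ} (hφ : ∀ i, Measurable (φ i)) :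
    ∫ y, ∏ i ∈ s, φ i (y i) ∂(Measure.infinitePi μ) = ∏ i ∈ s, ∫ x, φ i x ∂(μ i) := by
  have h := integral_restrict_infinitePi (μ := μ) (s := s)
    (f := fun y : (∀ i : s, X i) => ∏ i : s, φ i (y i))
    (Finset.measurable_fun_prod Finset.univ
      fun (i : s) _ => (hφ i).comp (measurable_pi_apply i)).aestronglyMeasurable
  rw [integral_fintype_prod_eq_prod (fun i : s => φ i),
    Finset.prod_coe_sort s (fun i => ∫ x, φ i x ∂(μ i))] at h
  rw [← h]
  refine integral_congr_ae (ae_of_all _ fun y => ?_)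
  exact (Finset.prod_coe_sort s (fun i => φ i (y i))).symm

/-- The number of indices `i < η.1` such that `η.2 i ∈ B`. -/
def pointCount {E : Type*} (B : Set E) (η : ℕ × (ℕ → E)) : ℕ :=
  ∑ i ∈ Finset.range η.1, B.indicator (fun _ => 1) (η.2 i)

lemma sum_mul_pointCount {E : Type*} {m : ℕ} (B : Fin m → Set E) (t : Fin m → ℝ) (η : ℕ × (ℕ → E)) :
    ∑ j, t j * (pointCount (B j) η : ℝ)
      = ∑ i ∈ Finset.range η.1, ∑ j, (B j).indicator (fun _ => t j) (η.2 i) := by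
  rw [Finset.sum_comm]
  refine Finset.sum_congr rfl fun j _ => ?_
  rw [pointCount, Nat.cast_sum, Finset.mul_sum]
  refine Finset.sum_congr rfl fun i _ => ?_
  by_cases h : η.2 i ∈ B j <;> simp [h]

/-- Disjointness leaves at most one nonzero indicator, so `e^{ig} - 1` is additive over the sets.
This additivity in the exponent becomes independence of the counts. -/
lemma cexp_sum_indicator_sub_one {E : Type*} {m : ℕ} {B : Fin m → Set E}
    (hd : ∀ i j, i ≠ j → Disjoint (B i) (B j)) (t : Fin m → ℝ) (x : E) :
    Complex.exp ((∑ j, (B j).indicator (fun _ => t j) x : ℝ) * Complex.I) - 1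
      = ∑ j, (B j).indicator (fun _ => Complex.exp (t j * Complex.I) - 1) x := by
  by_cases hx : ∃ j, x ∈ B j
  · obtain ⟨j, hj⟩ := hx
    have hne : ∀ k, k ≠ j → x ∉ B k := fun k hk hxk =>
      Set.disjoint_left.1 (hd k j hk) hxk hj
    rw [Finset.sum_eq_single j, Finset.sum_eq_single j]
    · simp [hj]
    · intro k _ hk; simp [hne k hk]
    · simp
    · intro k _ hk; simp [hne k hk]
    · simp
  · push Not at hx
    simp [hx]

section PointProcess

variable {E : Type*} [MeasurableSpace E]

lemma measurable_sum_range_points {M : Type*} [AddCommMonoid M] [MeasurableSpace M]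
    [MeasurableAdd₂ M] {g : E → M} (hg : Measurable g) :
    Measurable fun η : ℕ × (ℕ → E) => ∑ i ∈ Finset.range η.1, g (η.2 i) := by
  refine measurable_from_prod_countable_right fun n => ?_
  exact Finset.measurable_fun_sum (Finset.range n) fun i _ => hg.comp (measurable_pi_apply i)

lemma measurable_pointCount {B : Set E} (hB : MeasurableSet B) :
    Measurable (pointCount B) :=
  measurable_sum_range_points (measurable_const.indicator hB)

/-- The law of a Poisson number (of mean one) of points with law `ν`. -/
def cellMeasure (ν : Measure E) : Measure (ℕ × (ℕ → E)) :=
  (poissonMeasure 1).prod (Measure.infinitePi fun _ : ℕ => ν)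

instance (ν : Measure E) [IsProbabilityMeasure ν] : IsProbabilityMeasure (cellMeasure ν) := by
  unfold cellMeasure; infer_instance

/-- Compound Poisson formula: given `n` points the integral is `a ^ n`, and the mean-one Poisson
average of `a ^ n` is `exp (a - 1)`. -/
lemma integral_cexp_cellMeasure (ν : Measure E) [IsProbabilityMeasure ν] {g : E → ℝ}
    (hg : Measurable g) :
    ∫ η, Complex.exp ((∑ i ∈ Finset.range η.1, g (η.2 i) : ℝ) * Complex.I) ∂(cellMeasure ν)
      = Complex.exp (∫ x, (Complex.exp (g x * Complex.I) - 1) ∂ν) := by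
  have hφ : Measurable fun x => Complex.exp (g x * Complex.I) := by fun_prop
  have hm : Measurable fun η : ℕ × (ℕ → E) =>
      Complex.exp ((∑ i ∈ Finset.range η.1, g (η.2 i) : ℝ) * Complex.I) := by
    have := measurable_sum_range_points hg
    fun_prop
  have hnorm : ∀ x : ℝ, ‖Complex.exp (x * Complex.I)‖ ≤ 1 := fun x => by
    rw [Complex.norm_exp_ofReal_mul_I]
  have hint : Integrable (fun η : ℕ × (ℕ → E) =>
      Complex.exp ((∑ i ∈ Finset.range η.1, g (η.2 i) : ℝ) * Complex.I)) (cellMeasure ν) :=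
    Integrable.of_bound hm.aestronglyMeasurable 1 (ae_of_all _ fun η => hnorm _)
  have hφi : Integrable (fun x => Complex.exp (g x * Complex.I)) ν :=
    Integrable.of_bound hφ.aestronglyMeasurable 1 (ae_of_all _ fun x => hnorm _)
  rw [cellMeasure, integral_prod _ hint, integral_poissonMeasure]
  have h1 : ∀ n : ℕ, ∫ y : ℕ → E,
      Complex.exp ((∑ i ∈ Finset.range n, g (y i) : ℝ) * Complex.I)
        ∂(Measure.infinitePi fun _ : ℕ => ν) = (∫ x, Complex.exp (g x * Complex.I) ∂ν) ^ n := by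
    intro n
    have := integral_infinitePi_finset_prod (fun _ : ℕ => ν) (Finset.range n) (fun _ => hφ)
    rw [Finset.prod_const, Finset.card_range] at this
    rw [← this]
    congr 1
    funext y
    rw [← Complex.exp_sum, Complex.ofReal_sum, Finset.sum_mul]
  simp only [h1]
  rw [integral_sub hφi (integrable_const _)]
  simp only [integral_const, probReal_univ, one_smul]
  set a := ∫ x, Complex.exp (g x * Complex.I) ∂ν
  rw [sub_eq_add_neg, Complex.exp_add, Complex.exp_eq_exp_ℂ,
    ← (NormedSpace.expSeries_div_hasSum_exp a).tsum_eq, ← tsum_mul_right]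
  refine tsum_congr fun n => ?_
  simp only [NNReal.coe_one, one_pow, mul_one, Complex.real_smul, Complex.ofReal_div,
    Complex.ofReal_exp, Complex.ofReal_neg, Complex.ofReal_one, Complex.ofReal_natCast,
    Complex.exp_eq_exp_ℂ]
  ring

variable {ι : Type*}

/-- The law of independent cells, the cell `c` containing a Poisson number of points with law
`ν c`. -/
def cellsMeasure (ν : ι → Measure E) : Measure (ι → ℕ × (ℕ → E)) :=
  Measure.infinitePi fun c => cellMeasure (ν c)

variable {ν : ι → Measure E} [∀ c, IsProbabilityMeasure (ν c)]

instance : IsProbabilityMeasure (cellsMeasure ν) := by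
  unfold cellsMeasure; infer_instance

/-- The number of points in `B` coming from a finite set of cells. -/
def partialCount (A : Finset ι) (B : Set E) (ω : ι → ℕ × (ℕ → E)) : ℕ :=
  ∑ c ∈ A, pointCount B (ω c)

lemma measurable_partialCount (A : Finset ι) {B : Set E} (hB : MeasurableSet B) :
    Measurable (partialCount A B) :=
  Finset.measurable_fun_sum _ fun c _ => (measurable_pointCount hB).comp (measurable_pi_apply c)

/-- The joint characteristic function is a product of Poisson ones; both the law of one count and
the independence of several are read off it. -/
lemma integral_cexp_partialCount (A : Finset ι) {m : ℕ} {B : Fin m → Set E}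
    (hB : ∀ j, MeasurableSet (B j)) (hd : ∀ i j, i ≠ j → Disjoint (B i) (B j))
    (t : Fin m → ℝ) :
    ∫ ω, Complex.exp ((∑ j, t j * (partialCount A (B j) ω : ℝ) : ℝ) * Complex.I)
        ∂(cellsMeasure ν)
      = ∏ j, Complex.exp (((∑ c ∈ A, (ν c (B j)).toNNReal : NNReal) : ℂ) *
          (Complex.exp (t j * Complex.I) - 1)) := by
  set g : E → ℝ := fun x => ∑ j, (B j).indicator (fun _ => t j) x with hgdef
  have hg : Measurable g :=
    Finset.measurable_fun_sum _ fun j _ => measurable_const.indicator (hB j)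
  have hm : Measurable fun η : ℕ × (ℕ → E) =>
      Complex.exp ((∑ i ∈ Finset.range η.1, g (η.2 i) : ℝ) * Complex.I) := by
    have := measurable_sum_range_points hg
    fun_prop
  have h := integral_infinitePi_finset_prod (fun c => cellMeasure (ν c)) A (fun _ => hm)
  have h1 : ∀ ω : ι → ℕ × (ℕ → E),
      Complex.exp ((∑ j, t j * (partialCount A (B j) ω : ℝ) : ℝ) * Complex.I)
        = ∏ c ∈ A, Complex.exp
          ((∑ i ∈ Finset.range (ω c).1, g ((ω c).2 i) : ℝ) * Complex.I) := by
    intro ω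
    rw [← Complex.exp_sum, ← Finset.sum_mul, ← Complex.ofReal_sum]
    congr 3
    simp only [partialCount, Nat.cast_sum, Finset.mul_sum]
    rw [Finset.sum_comm]
    exact Finset.sum_congr rfl fun c _ => sum_mul_pointCount B t (ω c)
  simp only [h1]
  rw [cellsMeasure, h]
  simp only [integral_cexp_cellMeasure _ hg]
  rw [← Complex.exp_sum, ← Complex.exp_sum]
  congr 1
  have h2 : ∀ c, ∫ x, (Complex.exp (g x * Complex.I) - 1) ∂(ν c)
      = ∑ j, (((ν c (B j)).toNNReal : NNReal) : ℂ) * (Complex.exp (t j * Complex.I) - 1) := by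
    intro c
    simp only [hgdef, cexp_sum_indicator_sub_one hd]
    rw [integral_finsetSum]
    · refine Finset.sum_congr rfl fun j _ => ?_
      rw [integral_indicator_const _ (hB j)]
      rfl
    · exact fun j _ => (integrable_const _).indicator (hB j)
  simp only [h2]
  rw [Finset.sum_comm]
  refine Finset.sum_congr rfl fun j _ => ?_
  rw [← Finset.sum_mul]
  simp

lemma charFun_map_partialCount (A : Finset ι) {m : ℕ} {B : Fin m → Set E}
    (hB : ∀ j, MeasurableSet (B j)) (hd : ∀ i j, i ≠ j → Disjoint (B i) (B j))
    (j : Fin m) (s : ℝ) :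
    charFun ((cellsMeasure ν).map fun ω => (partialCount A (B j) ω : ℝ)) s
      = Complex.exp (((∑ c ∈ A, (ν c (B j)).toNNReal : NNReal) : ℂ) *
          (Complex.exp (s * Complex.I) - 1)) := by
  have hmeas : Measurable fun ω : ι → ℕ × (ℕ → E) => (partialCount A (B j) ω : ℝ) :=
    measurable_from_nat.comp (measurable_partialCount A (hB j))
  have h := integral_cexp_partialCount (ν := ν) A hB hd (Pi.single j s)
  rw [charFun_apply, integral_map hmeas.aemeasurable (by fun_prop)]
  rw [Finset.prod_eq_single j] at h
  · simp only [Pi.single_eq_same] at h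
    rw [← h]
    congr 1
    funext ω
    rw [Finset.sum_eq_single j]
    · simp
    · intro k _ hk; simp [hk]
    · simp
  · intro k _ hk; simp [hk]
  · simp

lemma iIndepFun_partialCount (A : Finset ι) {m : ℕ} {B : Fin m → Set E}
    (hB : ∀ j, MeasurableSet (B j)) (hd : ∀ i j, i ≠ j → Disjoint (B i) (B j)) :
    iIndepFun (fun j ω => (partialCount A (B j) ω : ℝ)) (cellsMeasure ν) := by
  have hmeas : ∀ j, Measurable fun ω : ι → ℕ × (ℕ → E) => (partialCount A (B j) ω : ℝ) :=
    fun j => measurable_from_nat.comp (measurable_partialCount A (hB j))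
  rw [iIndepFun_iff_charFun_pi fun j => (hmeas j).aemeasurable]
  intro t
  have h := integral_cexp_partialCount (ν := ν) A hB hd (fun j => t j)
  simp only [charFun_map_partialCount A hB hd, ← h]
  have hvec : Measurable fun ω : ι → ℕ × (ℕ → E) =>
      WithLp.toLp 2 fun j => (partialCount A (B j) ω : ℝ) :=
    (MeasurableEquiv.toLp 2 (Fin m → ℝ)).measurable.comp (measurable_pi_lambda _ hmeas)
  rw [charFun_apply, integral_map hvec.aemeasurable (by fun_prop)]
  simp [PiLp.inner_apply]

lemma map_partialCount (A : Finset ι) {B : Set E} (hB : MeasurableSet B) :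
    (cellsMeasure ν).map (partialCount A B)
      = poissonMeasure (∑ c ∈ A, (ν c B).toNNReal) := by
  have hm := measurable_partialCount A hB
  have h : ((cellsMeasure ν).map fun ω => (partialCount A B ω : ℝ))
      = (poissonMeasure (∑ c ∈ A, (ν c B).toNNReal)).map (Nat.cast : ℕ → ℝ) := by
    have hmeas : Measurable fun ω : ι → ℕ × (ℕ → E) => (partialCount A B ω : ℝ) :=
      measurable_from_nat.comp hm
    have : IsProbabilityMeasure ((cellsMeasure ν).map fun ω => (partialCount A B ω : ℝ)) :=
      Measure.isProbabilityMeasure_map hmeas.aemeasurable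
    refine Measure.ext_of_charFun (funext fun s => ?_)
    rw [charFun_map_cast_poissonMeasure]
    refine (charFun_map_partialCount (ν := ν) A (B := fun _ : Fin 1 => B) (fun _ => hB)
      (fun i j hij => absurd (Subsingleton.elim i j) hij) 0 s)
  ext s hs
  have h1 : s = (Nat.cast : ℕ → ℝ) ⁻¹' ((Nat.cast : ℕ → ℝ) '' s) :=
    (Set.preimage_image_eq s Nat.cast_injective).symm
  have h2 : MeasurableSet ((Nat.cast : ℕ → ℝ) '' s) :=
    (Set.Countable.image s.to_countable _).measurableSet
  have h3 := congrArg (fun μ => μ ((Nat.cast : ℕ → ℝ) '' s)) h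
  beta_reduce at h3
  have hm' : Measurable fun ω : ι → ℕ × (ℕ → E) => (partialCount A B ω : ℝ) :=
    measurable_from_nat.comp hm
  rw [Measure.map_apply hm' h2,
    Measure.map_apply measurable_from_nat h2, ← h1] at h3
  rw [Measure.map_apply hm hs, ← h3]
  conv_lhs => rw [h1]
  rfl

end PointProcess

/-! ### From finitely many cells to the whole process -/

lemma eNat_borelSpace : BorelSpace ℕ∞ := by
  constructor
  refine le_antisymm (fun s _ => ?_) le_top
  have : @MeasurableSet ℕ∞ (borel ℕ∞) s := by
    rw [← Set.biUnion_of_singleton s]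
    refine MeasurableSet.biUnion s.to_countable fun x _ => ?_
    exact (@isClosed_singleton ℕ∞ _ _ x).isOpen_compl |> fun h =>
      MeasurableSet.of_compl (MeasurableSpace.measurableSet_generateFrom h)
  exact this

attribute [local instance] eNat_borelSpace

lemma tendsto_poissonMeasure_Iic {α : Type*} {l : Filter α} {r : α → NNReal} {s : NNReal}
    (h : Tendsto r l (𝓝 s)) (n : ℕ) :
    Tendsto (fun a => poissonMeasure (r a) (Set.Iic n)) l (𝓝 (poissonMeasure s (Set.Iic n))) := by
  have key : ∀ r : NNReal, poissonMeasure r (Set.Iic n)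
      = ∑ k ∈ Finset.Iic n, ENNReal.ofReal (Real.exp (-r) * r ^ k / k.factorial) := by
    intro r
    rw [← Finset.coe_Iic, ← sum_measure_singleton]
    exact Finset.sum_congr rfl fun k _ => poissonMeasure_singleton r k
  simp only [key]
  refine tendsto_finsetSum _ fun k _ => ENNReal.tendsto_ofReal ?_
  have hc : Continuous fun r : NNReal => Real.exp (-r) * (r : ℝ) ^ k / k.factorial := by fun_prop
  exact (hc.tendsto s).comp h

lemma ae_prod_ne {α β E : Type*} [MeasurableSpace α] [MeasurableSpace β] [MeasurableSpace E]
    [MeasurableEq E] {μ : Measure α} {μ' : Measure β} [SFinite μ'] {f : α → E} {g : β → E}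
    (hf : Measurable f) (hg : Measurable g) (h : ∀ x, ∀ᵐ y ∂μ', f x ≠ g y) :
    ∀ᵐ z ∂(μ.prod μ'), f z.1 ≠ g z.2 := by
  have hm : MeasurableSet {z : α × β | f z.1 = g z.2} :=
    measurableSet_eq_fun (hf.comp measurable_fst) (hg.comp measurable_snd)
  have : μ.prod μ' {z : α × β | f z.1 = g z.2} = 0 := by
    rw [Measure.measure_prod_null hm]
    refine ae_of_all _ fun x => ?_
    have := ae_iff.1 (h x)
    simpa using this
  rw [ae_iff]
  simpa using this

section PointProcess

variable {E ι : Type*}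

/-- All the points of all the cells are distinct. -/
def DistinctPoints (ω : ι → ℕ × (ℕ → E)) : Prop :=
  ∀ p q : Σ _ : ι, ℕ, p ≠ q → (ω p.1).2 p.2 ≠ (ω q.1).2 q.2

open Classical in
/-- The point process made of the first `(ω c).1` points of each cell `c`. -/
def cellProcess (ω : ι → ℕ × (ℕ → E)) : Set E :=
  if DistinctPoints ω then {x | ∃ p : Σ _ : ι, ℕ, p.2 < (ω p.1).1 ∧ (ω p.1).2 p.2 = x} else ∅

/-- Distinctness makes (cell, rank) an injective labelling, so counting points is counting labels,
and a cardinality is the supremum over finite sets of cells. -/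
lemma encard_cellProcess_inter {ω : ι → ℕ × (ℕ → E)} (h : DistinctPoints ω) (B : Set E) :
    (cellProcess ω ∩ B).encard = ⨆ A : Finset ι, (partialCount A B ω : ℕ∞) := by
  classical
  let I : Set (Σ _ : ι, ℕ) := {p | p.2 < (ω p.1).1 ∧ (ω p.1).2 p.2 ∈ B}
  have hinj : Function.Injective fun p : Σ _ : ι, ℕ => (ω p.1).2 p.2 := fun p q hpq => by
    by_contra hne; exact h p q hne hpq
  have h1 : cellProcess ω ∩ B = (fun p : Σ _ : ι, ℕ => (ω p.1).2 p.2) '' I := by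
    ext x
    simp only [cellProcess, if_pos h, Set.mem_inter_iff, Set.mem_image, I, Set.mem_ofPred_eq]
    constructor
    · rintro ⟨⟨p, hp, rfl⟩, hx⟩; exact ⟨p, ⟨hp, hx⟩, rfl⟩
    · rintro ⟨p, ⟨hp, hx⟩, rfl⟩; exact ⟨⟨p, hp, rfl⟩, hx⟩
  let F : Finset ι → Finset (Σ _ : ι, ℕ) := fun A =>
    A.sigma fun c => (Finset.range (ω c).1).filter fun i => (ω c).2 i ∈ B
  have hF : ∀ A, (F A).card = partialCount A B ω := by
    intro A
    rw [Finset.card_sigma]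
    refine Finset.sum_congr rfl fun c _ => ?_
    rw [Finset.card_filter, pointCount]
    exact Finset.sum_congr rfl fun i _ => by simp [Set.indicator_apply]
  have hmem : ∀ A p, p ∈ F A ↔ p.1 ∈ A ∧ p ∈ I := by
    intro A p
    simp [F, I, Finset.mem_sigma]
  rw [h1, hinj.injOn.encard_image]
  apply le_antisymm
  · refine ENat.forall_natCast_le_iff_le.1 fun k hk => ?_
    obtain ⟨t, htI, htk⟩ := Set.exists_subset_encard_eq hk
    have htf : t.Finite := Set.finite_of_encard_eq_coe htk
    refine le_trans ?_ (le_iSup _ (htf.toFinset.image Sigma.fst))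
    rw [← htk, ← hF, ← Set.encard_coe_eq_coe_finsetCard]
    refine Set.encard_le_encard fun p hp => ?_
    rw [Finset.mem_coe, hmem]
    exact ⟨Finset.mem_image_of_mem _ (htf.mem_toFinset.2 hp), htI hp⟩
  · refine iSup_le fun A => ?_
    rw [← hF, ← Set.encard_coe_eq_coe_finsetCard]
    exact Set.encard_le_encard fun p hp => ((hmem A p).1 hp).2

lemma partialCount_mono {A A' : Finset ι} (h : A ⊆ A') (B : Set E) (ω : ι → ℕ × (ℕ → E)) :
    partialCount A B ω ≤ partialCount A' B ω :=
  Finset.sum_le_sum_of_subset h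

variable [MeasurableSpace E] {ν : ι → Measure E} [∀ c, IsProbabilityMeasure (ν c)]

lemma map_point_cellMeasure (ν : Measure E) [IsProbabilityMeasure ν] (i : ℕ) :
    (cellMeasure ν).map (fun η => η.2 i) = ν := by
  have h : (fun η : ℕ × (ℕ → E) => η.2 i) = (fun y : ℕ → E => y i) ∘ Prod.snd := rfl
  rw [h, ← Measure.map_map (measurable_pi_apply i) measurable_snd, cellMeasure,
    Measure.map_snd_prod, measure_univ, one_smul, Measure.infinitePi_map_eval]

lemma measure_partialCount_le_eq_prod (A : Finset ι) {m : ℕ} {B : Fin m → Set E}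
    (hB : ∀ j, MeasurableSet (B j)) (hd : ∀ i j, i ≠ j → Disjoint (B i) (B j)) (n : Fin m → ℕ∞) :
    cellsMeasure ν {ω | ∀ j, (partialCount A (B j) ω : ℕ∞) ≤ n j}
      = ∏ j, cellsMeasure ν {ω | (partialCount A (B j) ω : ℕ∞) ≤ n j} := by
  have h := (iIndepFun_partialCount (ν := ν) A hB hd).measure_inter_preimage_eq_mul Finset.univ
    (sets := fun j => (Nat.cast : ℕ → ℝ) '' {k | (k : ℕ∞) ≤ n j})
    (fun j _ => (Set.Countable.image (Set.to_countable _) _).measurableSet)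
  have h1 : ∀ j, (fun ω : ι → ℕ × (ℕ → E) => (partialCount A (B j) ω : ℝ)) ⁻¹'
      ((Nat.cast : ℕ → ℝ) '' {k | (k : ℕ∞) ≤ n j})
      = {ω | (partialCount A (B j) ω : ℕ∞) ≤ n j} := by
    intro j; ext ω; simp
  simp only [h1] at h
  rw [← h]
  congr 1
  ext ω; simp

variable [MeasurableEq E] [Countable ι]

/-- There are countably many pairs of labels, and two independent points coincide with probability
zero since the laws have no atoms. -/
lemma ae_distinctPoints (hν : ∀ c x, ν c {x} = 0) :
    ∀ᵐ ω ∂(cellsMeasure ν), DistinctPoints ω := by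
  classical
  refine ae_all_iff.2 fun p => ae_all_iff.2 fun q => ?_
  by_cases hpq : p = q
  · exact ae_of_all _ fun ω h => absurd hpq h
  obtain ⟨c, i⟩ := p
  obtain ⟨c', j⟩ := q
  have key : ∀ᵐ ω ∂(cellsMeasure ν), (ω c).2 i ≠ (ω c').2 j := by
    by_cases hc : c = c'
    · subst hc
      have hij : i ≠ j := by rintro rfl; exact hpq rfl
      have h1 : (cellsMeasure ν).map (fun ω => ((ω c).2 i, (ω c).2 j))
          = (ν c).prod (ν c) := by
        have e : (fun ω : ι → ℕ × (ℕ → E) => ((ω c).2 i, (ω c).2 j))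
            = (fun y : ℕ → E => (y i, y j)) ∘ Prod.snd ∘ (fun ω => ω c) := rfl
        rw [e, ← Measure.map_map (by fun_prop) (by fun_prop),
          ← Measure.map_map (by fun_prop) (by fun_prop), cellsMeasure,
          Measure.infinitePi_map_eval, cellMeasure, Measure.map_snd_prod, measure_univ, one_smul,
          Measure.infinitePi_map_eval_prod hij]
      have h2 : ∀ᵐ x ∂((ν c).prod (ν c)), x.1 ≠ x.2 := by
        refine ae_prod_ne measurable_id measurable_id fun x => ?_
        rw [ae_iff]
        simpa [eq_comm] using hν c x
      rw [← h1] at h2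
      exact ae_of_ae_map (p := fun x : E × E => x.1 ≠ x.2) (by fun_prop) h2
    · have h1 : (cellsMeasure ν).map (fun ω => (ω c, ω c'))
          = (cellMeasure (ν c)).prod (cellMeasure (ν c')) :=
        Measure.infinitePi_map_eval_prod hc
      have h2 : ∀ᵐ x ∂((cellMeasure (ν c)).prod (cellMeasure (ν c'))),
          x.1.2 i ≠ x.2.2 j := by
        refine ae_prod_ne (f := fun η : ℕ × (ℕ → E) => η.2 i) (g := fun η : ℕ × (ℕ → E) => η.2 j)
          (by fun_prop) (by fun_prop) fun x => ?_
        have h3 : ∀ᵐ y ∂((cellMeasure (ν c')).map fun η => η.2 j), x.2 i ≠ y := by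
          rw [map_point_cellMeasure, ae_iff]
          simpa [eq_comm] using hν c' (x.2 i)
        exact ae_of_ae_map (by fun_prop) h3
      rw [← h1] at h2
      exact ae_of_ae_map (p := fun x : (ℕ × (ℕ → E)) × (ℕ × (ℕ → E)) => x.1.2 i ≠ x.2.2 j)
        (by fun_prop) h2
  filter_upwards [key] with ω hω _ using hω

lemma measurableSet_distinctPoints :
    MeasurableSet {ω : ι → ℕ × (ℕ → E) | DistinctPoints ω} := by
  have : {ω : ι → ℕ × (ℕ → E) | DistinctPoints ω}
      = ⋂ p : Σ _ : ι, ℕ, ⋂ q : Σ _ : ι, ℕ, ⋂ _ : p ≠ q,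
        {ω | (ω p.1).2 p.2 = (ω q.1).2 q.2}ᶜ := by
    ext ω; simp [DistinctPoints]
  rw [this]
  refine MeasurableSet.iInter fun p => MeasurableSet.iInter fun q => MeasurableSet.iInter fun _ =>
    (measurableSet_eq_fun (by fun_prop) (by fun_prop)).compl

lemma measurable_encard_cellProcess {B : Set E} (hB : MeasurableSet B) :
    Measurable fun ω : ι → ℕ × (ℕ → E) => (cellProcess ω ∩ B).encard := by
  classical
  have : (fun ω : ι → ℕ × (ℕ → E) => (cellProcess ω ∩ B).encard)
      = fun ω => if DistinctPoints ω then ⨆ A : Finset ι, (partialCount A B ω : ℕ∞) else 0 := by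
    funext ω
    by_cases h : DistinctPoints ω
    · simp [h, encard_cellProcess_inter]
    · simp [h, cellProcess]
  rw [this]
  refine Measurable.ite measurableSet_distinctPoints ?_ measurable_const
  exact Measurable.iSup fun A => measurable_from_nat.comp (measurable_partialCount A hB)

/-- The partial counts increase with `A`, so the events decrease to the limiting one: continuity
from above. -/
lemma tendsto_measure_partialCount_le (hν : ∀ c x, ν c {x} = 0) {m : ℕ} {B : Fin m → Set E}
    (hB : ∀ j, MeasurableSet (B j)) (n : Fin m → ℕ∞) :
    Tendsto (fun A : Finset ι => cellsMeasure ν {ω | ∀ j, (partialCount A (B j) ω : ℕ∞) ≤ n j})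
      atTop (𝓝 (cellsMeasure ν {ω | ∀ j, (cellProcess ω ∩ B j).encard ≤ n j})) := by
  have h1 : cellsMeasure ν {ω | ∀ j, (cellProcess ω ∩ B j).encard ≤ n j}
      = cellsMeasure ν (⋂ A : Finset ι, {ω | ∀ j, (partialCount A (B j) ω : ℕ∞) ≤ n j}) := by
    refine measure_congr ?_
    filter_upwards [ae_distinctPoints hν] with ω hω
    refine propext ?_
    change (∀ j, _) ↔ ω ∈ ⋂ A : Finset ι, {ω | ∀ j, (partialCount A (B j) ω : ℕ∞) ≤ n j}
    simp only [encard_cellProcess_inter hω, iSup_le_iff, Set.mem_iInter, Set.mem_ofPred_eq]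
    exact forall_comm
  rw [h1]
  refine tendsto_measure_iInter_atTop (fun A => MeasurableSet.nullMeasurableSet ?_) ?_
    ⟨∅, measure_ne_top _ _⟩
  · have : {ω : ι → ℕ × (ℕ → E) | ∀ j, (partialCount A (B j) ω : ℕ∞) ≤ n j}
        = ⋂ j, partialCount A (B j) ⁻¹' {k | (k : ℕ∞) ≤ n j} := by
      ext ω; simp
    rw [this]
    exact MeasurableSet.iInter fun j => measurable_partialCount A (hB j) MeasurableSet.of_discrete
  · intro A A' h ω hω j
    exact (Nat.cast_le.2 (partialCount_mono h _ _)).trans (hω j)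

lemma measure_encard_le_eq_prod (hν : ∀ c x, ν c {x} = 0) {m : ℕ} {B : Fin m → Set E}
    (hB : ∀ j, MeasurableSet (B j)) (hd : ∀ i j, i ≠ j → Disjoint (B i) (B j)) (n : Fin m → ℕ∞) :
    cellsMeasure ν {ω | ∀ j, (cellProcess ω ∩ B j).encard ≤ n j}
      = ∏ j, cellsMeasure ν {ω | (cellProcess ω ∩ B j).encard ≤ n j} := by
  refine tendsto_nhds_unique (tendsto_measure_partialCount_le hν hB n) ?_
  simp only [measure_partialCount_le_eq_prod _ hB hd]
  refine ENNReal.tendsto_finsetProd_of_ne_top _ (fun j _ => ?_) fun j _ => measure_ne_top _ _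
  have := tendsto_measure_partialCount_le hν (B := fun _ : Fin 1 => B j) (fun _ => hB j)
    (fun _ => n j)
  simpa using this

/-- Half-lines generate the σ-algebra of `ℕ∞` and form a π-system, so laws and independence only
have to be tested on events `count ≤ n`, which are stable under the limit over finite sets of cells.
-/
theorem isPoissonPointProcess_cellProcess (hν : ∀ c x, ν c {x} = 0) :
    IsPoissonPointProcess (cellProcess (E := E) (ι := ι)) (Measure.sum ν) (cellsMeasure ν) where
  measurable_count B hB := measurable_encard_cellProcess hB
  map_count B hB hfin := by
    have hm := measurable_encard_cellProcess (ι := ι) hB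
    have : IsProbabilityMeasure
        ((cellsMeasure ν).map fun ω => (cellProcess ω ∩ B).encard) :=
      Measure.isProbabilityMeasure_map hm.aemeasurable
    refine Measure.ext_of_Iic _ _ fun n => ?_
    rw [Measure.map_apply hm measurableSet_Iic,
      Measure.map_apply measurable_from_nat measurableSet_Iic]
    induction n using ENat.recTopCoe with
    | top => simp
    | coe n =>
      have h1 := tendsto_measure_partialCount_le hν (B := fun _ : Fin 1 => B) (fun _ => hB)
        (fun _ => (n : ℕ∞))
      simp only [forall_const] at h1
      have h2 : ∀ A : Finset ι, cellsMeasure ν {ω | (partialCount A B ω : ℕ∞) ≤ n}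
          = poissonMeasure (∑ c ∈ A, (ν c B).toNNReal) (Set.Iic n) := by
        intro A
        rw [← map_partialCount A hB, Measure.map_apply (measurable_partialCount A hB)
          measurableSet_Iic]
        congr 1
        ext ω; simp
      simp only [h2] at h1
      rw [Measure.sum_apply _ hB] at hfin ⊢
      have h3 : Tendsto (fun A : Finset ι => ∑ c ∈ A, (ν c B).toNNReal) atTop
          (𝓝 (∑' c, ν c B).toNNReal) := by
        rw [ENNReal.tsum_toNNReal_eq fun c => measure_ne_top _ _]
        exact (ENNReal.summable_toNNReal_of_tsum_ne_top hfin).hasSum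
      have h4 := tendsto_nhds_unique h1 (tendsto_poissonMeasure_Iic h3 n)
      have h5 : (Nat.cast : ℕ → ℕ∞) ⁻¹' Set.Iic (n : ℕ∞) = Set.Iic n := by
        ext k; simp
      rw [h5, ← h4]
      rfl
  indep_count m B hB hd := by
    have hm : ∀ j, Measurable fun ω : ι → ℕ × (ℕ → E) => (cellProcess ω ∩ B j).encard :=
      fun j => measurable_encard_cellProcess (hB j)
    have hp : ∀ j, IsProbabilityMeasure
        ((cellsMeasure ν).map fun ω => (cellProcess ω ∩ B j).encard) := fun j =>
      Measure.isProbabilityMeasure_map (hm j).aemeasurable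
    rw [iIndepFun_iff_map_fun_eq_pi_map fun j => (hm j).aemeasurable]
    symm
    refine Measure.pi_eq_generateFrom (C := fun _ => Set.range Set.Iic) (fun _ => ?_)
      (fun _ => isPiSystem_Iic) (fun j => ⟨fun _ => Set.univ, fun _ => ⟨⊤, Set.Iic_top⟩,
        fun _ => measure_lt_top _ _, Set.iUnion_const _⟩) fun s hs => ?_
    · rw [← borel_eq_generateFrom_Iic, eNat_borelSpace.measurable_eq]
    · choose n hn using hs
      obtain rfl : (fun j => Set.Iic (n j)) = s := funext hn
      rw [Measure.map_apply (measurable_pi_lambda _ hm)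
        (MeasurableSet.univ_pi fun _ => measurableSet_Iic)]
      simp only [Measure.map_apply (hm _) measurableSet_Iic]
      have := measure_encard_le_eq_prod hν hB hd n
      refine Eq.trans ?_ this
      congr 1
      ext ω; simp [Pi.le_def]

end PointProcess

/-! ### Cells of `ℝ^{d₁} × ℤ^{d₂}` and existence of the Poisson process -/

/-- The box with sides `h` indexed by `c ∈ ℤ^{d₁} × ℤ^{d₂}`. -/
def cell {d₁ d₂ : ℕ} (h : Fin d₁ → ℝ) (c : (Fin d₁ → ℤ) × (Fin d₂ → ℤ)) :
    Set (SemiSpace d₁ d₂) :=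
  (Set.univ.pi fun a => Set.Ico (h a * c.1 a) (h a * (c.1 a + 1))) ×ˢ {c.2}

lemma mem_cell {d₁ d₂ : ℕ} {h : Fin d₁ → ℝ} {c : (Fin d₁ → ℤ) × (Fin d₂ → ℤ)}
    {p : SemiSpace d₁ d₂} : p ∈ cell h c ↔
      (∀ a, h a * c.1 a ≤ p.1 a ∧ p.1 a < h a * (c.1 a + 1)) ∧ p.2 = c.2 := by
  simp [cell, Set.mem_prod, Set.mem_pi]

lemma measurableSet_cell {d₁ d₂ : ℕ} (h : Fin d₁ → ℝ) (c : (Fin d₁ → ℤ) × (Fin d₂ → ℤ)) :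
    MeasurableSet (cell h c) :=
  (MeasurableSet.univ_pi fun _ => measurableSet_Ico).prod (measurableSet_singleton _)

lemma semiIntensity_cell {d₁ d₂ : ℕ} {h : Fin d₁ → ℝ} (hh : ∀ a, 0 < h a)
    (c : (Fin d₁ → ℤ) × (Fin d₂ → ℤ)) :
    semiIntensity d₁ d₂ (cell h c) = ENNReal.ofReal (∏ a, h a) := by
  rw [semiIntensity, cell, Measure.prod_prod, Measure.count_singleton, mul_one, volume_pi_pi,
    ENNReal.ofReal_prod_of_nonneg fun a _ => (hh a).le]
  refine Finset.prod_congr rfl fun a _ => ?_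
  rw [Real.volume_Ico]
  congr 1; ring

/-- The index of the cell of a point. -/
def cellIndex {d₁ d₂ : ℕ} (h : Fin d₁ → ℝ) (p : SemiSpace d₁ d₂) :
    (Fin d₁ → ℤ) × (Fin d₂ → ℤ) :=
  (fun a => ⌊p.1 a / h a⌋, p.2)

lemma mem_cell_iff {d₁ d₂ : ℕ} {h : Fin d₁ → ℝ} (hh : ∀ a, 0 < h a)
    {c : (Fin d₁ → ℤ) × (Fin d₂ → ℤ)} {p : SemiSpace d₁ d₂} :
    p ∈ cell h c ↔ cellIndex h p = c := by
  rw [mem_cell, Prod.ext_iff]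
  refine and_congr (Iff.trans (forall_congr' fun a => ?_) funext_iff.symm) Iff.rfl
  simp only [cellIndex]
  rw [Int.floor_eq_iff, le_div_iff₀ (hh a), div_lt_iff₀ (hh a), mul_comm (h a), mul_comm (h a)]

lemma pairwise_disjoint_cell {d₁ d₂ : ℕ} {h : Fin d₁ → ℝ} (hh : ∀ a, 0 < h a) :
    Pairwise (Function.onFun Disjoint (cell (d₂ := d₂) h)) := by
  intro c c' hc
  refine Set.disjoint_left.2 fun p hp hp' => hc ?_
  rw [mem_cell_iff hh] at hp hp'
  exact hp.symm.trans hp'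

lemma iUnion_cell {d₁ d₂ : ℕ} {h : Fin d₁ → ℝ} (hh : ∀ a, 0 < h a) :
    ⋃ c, cell (d₂ := d₂) h c = Set.univ :=
  Set.eq_univ_of_forall fun _ => Set.mem_iUnion.2 ⟨_, (mem_cell_iff hh).2 rfl⟩

lemma semiIntensity_singleton {d₁ d₂ : ℕ} (hd : 1 ≤ d₁) (x : SemiSpace d₁ d₂) :
    semiIntensity d₁ d₂ {x} = 0 := by
  have : Nonempty (Fin d₁) := ⟨⟨0, hd⟩⟩
  rw [semiIntensity, ← Set.singleton_prod_singleton, Measure.prod_prod, measure_singleton,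
    zero_mul]

theorem exists_isPoissonPointProcess {d₁ d₂ : ℕ} (hd : 1 ≤ d₁) :
    ∃ (Ω : Type) (_ : MeasurableSpace Ω) (P : Measure Ω) (_ : IsProbabilityMeasure P)
      (ξ : Ω → Set (SemiSpace d₁ d₂)), IsPoissonPointProcess ξ (semiIntensity d₁ d₂) P := by
  have hh : ∀ a : Fin d₁, (0 : ℝ) < (fun _ => 1 : Fin d₁ → ℝ) a := fun _ => one_pos
  let ν : (Fin d₁ → ℤ) × (Fin d₂ → ℤ) → Measure (SemiSpace d₁ d₂) :=
    fun c => (semiIntensity d₁ d₂).restrict (cell (fun _ => 1) c)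
  have hp : ∀ c, IsProbabilityMeasure (ν c) := fun c => ⟨by
    rw [Measure.restrict_apply_univ, semiIntensity_cell hh]; simp⟩
  have hsum : Measure.sum ν = semiIntensity d₁ d₂ := by
    rw [← Measure.restrict_iUnion (pairwise_disjoint_cell hh) (measurableSet_cell _),
      iUnion_cell hh, Measure.restrict_univ]
  refine ⟨_, inferInstance, cellsMeasure ν, inferInstance, cellProcess, ?_⟩
  rw [← hsum]
  refine isPoissonPointProcess_cellProcess fun c x => ?_
  exact le_antisymm ((Measure.restrict_apply_le _ _).trans
    (semiIntensity_singleton hd x).le) (zero_le)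

/-! ### The lattice configuration read off a point process -/

/-- A signed identification of the coordinates of `ℤ^d` with those of `ℤ^{d₁} × ℤ^{d₂}`. -/
structure Frame (d d₁ d₂ : ℕ) where
  /-- the identification of the coordinates -/
  e : Fin d₁ ⊕ Fin d₂ ≃ Fin d
  /-- the signs of the first coordinates -/
  σ : Fin d₁ → ℤ
  σ_sq : ∀ a, σ a * σ a = 1

namespace Frame

variable {d d₁ d₂ : ℕ} (f : Frame d d₁ d₂)

/-- The signed coordinates of a site. -/
def coord (x : Fin d → ℤ) : (Fin d₁ → ℤ) × (Fin d₂ → ℤ) :=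
  (fun a => f.σ a * x (f.e (.inl a)), fun b => x (f.e (.inr b)))

/-- The site with given signed coordinates. -/
def site (c : (Fin d₁ → ℤ) × (Fin d₂ → ℤ)) : Fin d → ℤ :=
  fun i => Sum.elim (fun a => f.σ a * c.1 a) c.2 (f.e.symm i)

lemma coord_site (c : (Fin d₁ → ℤ) × (Fin d₂ → ℤ)) : f.coord (f.site c) = c := by
  refine Prod.ext (funext fun a => ?_) (funext fun b => ?_)
  · simp [coord, site, ← mul_assoc, f.σ_sq]
  · simp [coord, site]

lemma site_coord (x : Fin d → ℤ) : f.site (f.coord x) = x := by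
  funext i
  obtain ⟨s, rfl⟩ := f.e.surjective i
  rcases s with a | b
  · simp [coord, site, ← mul_assoc, f.σ_sq]
  · simp [coord, site]

lemma coord_injective : Function.Injective f.coord :=
  Function.LeftInverse.injective f.site_coord

lemma coord_sub (x y : Fin d → ℤ) : f.coord (x - y) = f.coord x - f.coord y := by
  refine Prod.ext (funext fun a => ?_) (funext fun b => ?_) <;> simp [coord, mul_sub]

lemma coord_zero : f.coord 0 = 0 := by
  refine Prod.ext (funext fun a => ?_) (funext fun b => ?_) <;> simp [coord]

lemma abs_σ (a : Fin d₁) : |f.σ a| = 1 := by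
  rcases Int.isUnit_iff.1 (IsUnit.of_mul_eq_one _ (f.σ_sq a)) with h | h <;> simp [h]

lemma l1_eq (x : Fin d → ℤ) :
    (l1 x : ℤ) = (∑ a, |(f.coord x).1 a|) + ∑ b, |(f.coord x).2 b| := by
  rw [l1_cast, ← f.e.sum_comp, Fintype.sum_sum_type]
  simp [coord, abs_mul, f.abs_σ]

/-- The lattice configuration vanishing at the sites whose cell meets `S`. -/
def config (h : Fin d₁ → ℝ) (S : Set (SemiSpace d₁ d₂)) (x : Fin d → ℤ) : ℕ :=
  if (S ∩ cell h (f.coord x)).encard = 0 then 1 else 0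

lemma config_le_one (h : Fin d₁ → ℝ) (S : Set (SemiSpace d₁ d₂)) (x : Fin d → ℤ) :
    f.config h S x ≤ 1 := by
  rw [config]; split_ifs <;> simp

lemma config_eq_zero_iff {h : Fin d₁ → ℝ} {S : Set (SemiSpace d₁ d₂)} {x : Fin d → ℤ} :
    f.config h S x = 0 ↔ ∃ p ∈ S, p ∈ cell h (f.coord x) := by
  rw [config]
  simp [Set.encard_eq_zero, Set.eq_empty_iff_forall_notMem]

end Frame

section Coupling

variable {d d₁ d₂ : ℕ} (f : Frame d d₁ d₂) {Ω : Type*} [MeasurableSpace Ω] {P : Measure Ω}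
  {ξ : Ω → Set (SemiSpace d₁ d₂)}

lemma measurable_config (hξ : IsPoissonPointProcess ξ (semiIntensity d₁ d₂) P) (h : Fin d₁ → ℝ) :
    Measurable fun ω => f.config h (ξ ω) := by
  refine measurable_pi_lambda _ fun x => ?_
  have h1 : Measurable fun n : ℕ∞ => if n = 0 then 1 else 0 := Measurable.of_discrete (f := _)
  exact h1.comp (hξ.measurable_count _ (measurableSet_cell h _))

lemma measure_encard_cell_eq_zero [IsProbabilityMeasure P]
    (hξ : IsPoissonPointProcess ξ (semiIntensity d₁ d₂) P)
    {h : Fin d₁ → ℝ} (hh : ∀ a, 0 < h a) (c : (Fin d₁ → ℤ) × (Fin d₂ → ℤ)) :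
    P {ω | (ξ ω ∩ cell h c).encard = 0} = ENNReal.ofReal (Real.exp (-∏ a, h a)) := by
  have hc := measurableSet_cell h c
  have h1 := hξ.map_count _ hc (by rw [semiIntensity_cell hh]; exact ENNReal.ofReal_ne_top)
  have h2 := congrArg (fun μ => μ {0}) h1
  beta_reduce at h2
  rw [Measure.map_apply (hξ.measurable_count _ hc) (measurableSet_singleton _),
    Measure.map_apply measurable_from_nat (measurableSet_singleton _)] at h2
  have h3 : (Nat.cast : ℕ → ℕ∞) ⁻¹' {0} = {0} := by ext; simp
  have h4 : 0 ≤ ∏ a, h a := Finset.prod_nonneg fun a _ => (hh a).le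
  rw [h3, poissonMeasure_singleton, semiIntensity_cell hh] at h2
  refine Eq.trans h2 ?_
  simp only [ENNReal.ofReal, ENNReal.toNNReal_coe, Real.coe_toNNReal _ h4, pow_zero, mul_one,
    Nat.factorial_zero, Nat.cast_one, div_one]

/-- The coupling is exact rather than approximate: disjoint boxes are independent, and the volume is
tuned so that a box is empty with probability `1 - ε`. -/
lemma map_config [IsProbabilityMeasure P]
    (hξ : IsPoissonPointProcess ξ (semiIntensity d₁ d₂) P)
    {h : Fin d₁ → ℝ} (hh : ∀ a, 0 < h a) {ε : unitInterval}
    (hε : Real.exp (-∏ a, h a) = 1 - ε) :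
    P.map (fun ω => f.config h (ξ ω)) = siteMeasure d ε := by
  have hm : ∀ x, Measurable fun ω => f.config h (ξ ω) x :=
    fun x => (measurable_pi_apply x).comp (measurable_config f hξ h)
  have hind : iIndepFun (fun x ω => (ξ ω ∩ cell h (f.coord x)).encard) P := by
    rw [iIndepFun_iff_finset]
    intro s
    have h1 := hξ.indep_count s.card (fun k => cell h (f.coord (s.equivFin.symm k)))
      (fun k => measurableSet_cell _ _) (fun i j hij => pairwise_disjoint_cell hh fun hc => hij
        (s.equivFin.symm.injective (Subtype.ext (f.coord_injective hc))))
    have h2 := h1.precomp s.equivFin.injective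
    convert! h2 using 2 with i
    simp
  have hind2 : iIndepFun (fun x ω => f.config h (ξ ω) x) P :=
    hind.comp (fun _ n => if n = 0 then 1 else 0) fun _ => Measurable.of_discrete
  have := hind2.map_fun_eq_infinitePi_map hm
  rw [this, siteMeasure]
  congr 1
  funext x
  have hp : IsProbabilityMeasure (P.map fun ω => f.config h (ξ ω) x) :=
    Measure.isProbabilityMeasure_map (hm x).aemeasurable
  have h0 := measure_encard_cell_eq_zero hξ hh (f.coord x)
  have hmz : MeasurableSet {ω | (ξ ω ∩ cell h (f.coord x)).encard = 0} :=
    hξ.measurable_count _ (measurableSet_cell h _) (measurableSet_singleton 0)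
  have hone : P {ω | f.config h (ξ ω) x = 1} = ENNReal.ofReal (1 - ε) := by
    rw [← hε, ← h0]
    congr 1
    ext ω
    simp [Frame.config]
  have hzero : P {ω | f.config h (ξ ω) x = 0} = ENNReal.ofReal ε := by
    have : {ω | f.config h (ξ ω) x = 0} = {ω | (ξ ω ∩ cell h (f.coord x)).encard = 0}ᶜ := by
      ext ω; simp [Frame.config]
    rw [this, prob_compl_eq_one_sub hmz, h0, hε, ← ENNReal.ofReal_one,
      ← ENNReal.ofReal_sub _ (by linarith [ε.2.2])]
    congr 1; ring
  refine Measure.ext_of_singleton fun n => ?_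
  rw [Measure.map_apply (hm x) (measurableSet_singleton n),
    bernoulliMeasure_apply _ (measurableSet_singleton n)]
  have hpre : (fun ω => f.config h (ξ ω) x) ⁻¹' {n} = {ω | f.config h (ξ ω) x = n} := rfl
  rw [hpre]
  rcases n with _ | _ | n
  · rw [hzero]; simp [ENNReal.ofReal, unitInterval.toNNReal, Real.toNNReal, ε.2.1]; rfl
  · rw [hone]; simp [ENNReal.ofReal, unitInterval.toNNReal, Real.toNNReal, ε.2.2]; rfl
  · have : {ω | f.config h (ξ ω) x = n + 1 + 1} = ∅ := by
      ext ω
      have := f.config_le_one h (ξ ω) x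
      simp only [Set.mem_ofPred_eq, Set.mem_empty_iff_false, iff_false]
      omega
    rw [this]; simp

end Coupling

/-! ### The semi-continuous score bounds the gain of the lattice model from below -/

namespace Frame

variable {d d₁ d₂ : ℕ} (f : Frame d d₁ d₂)

lemma l1_site_sub (c c' : (Fin d₁ → ℤ) × (Fin d₂ → ℤ)) :
    (l1 (f.site c' - f.site c) : ℤ) = (∑ a, |c'.1 a - c.1 a|) + ∑ b, |c'.2 b - c.2 b| := by
  rw [f.l1_eq, f.coord_sub, f.coord_site, f.coord_site]
  rfl

/-- Each leg leaving a zero saves one. Strict monotonicity makes these legs nontrivial and lets the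
horizontal distances telescope, so only vertical moves are extra cost. -/
lemma passageTime_add_le_of_chain (hd : 1 ≤ d₁) {τ : (Fin d → ℤ) → ℕ} (hτ : ∀ x, τ x ≤ 1) (k : ℕ)
    (c : ℕ → (Fin d₁ → ℤ) × (Fin d₂ → ℤ)) (h0 : c 0 = 0)
    (hz : ∀ i, 1 ≤ i → i ≤ k → τ (f.site (c i)) = 0)
    (hfirst : ∀ a, 0 ≤ (c 1).1 a)
    (hlt : ∀ i, 1 ≤ i → i ≤ k → ∀ a, (c i).1 a < (c (i + 1)).1 a) :
    (passageTime τ 0 (f.site (c (k + 1))) : ℤ) + k ≤ (∑ a, (c (k + 1)).1 a)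
      + ∑ i ∈ Finset.range (k + 1), ∑ b, |(c (i + 1)).2 b - (c i).2 b| := by
  induction k with
  | zero =>
    have h1 := passageTime_le_l1 hτ 0 (f.site (c 1))
    have h2 : f.site (c 0) = 0 := by rw [h0, ← f.coord_zero, f.site_coord]
    have h3 := f.l1_site_sub (c 0) (c 1)
    rw [h2] at h3
    have h4 : ∑ a, |(c 1).1 a - (c 0).1 a| = ∑ a, (c 1).1 a :=
      Finset.sum_congr rfl fun a _ => by rw [h0]; simpa using hfirst a
    simp only [zero_add, Finset.range_one, Finset.sum_singleton, Nat.cast_zero, add_zero]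
    rw [h4] at h3
    omega
  | succ k ih =>
    have h1 := ih (fun i hi hi' => hz i hi (by omega)) (fun i hi hi' => hlt i hi (by omega))
    have h2 := passageTime_triangle τ 0 (f.site (c (k + 1))) (f.site (c (k + 1 + 1)))
    have hl := hlt (k + 1) (by omega) le_rfl
    have hne : f.site (c (k + 1)) ≠ f.site (c (k + 1 + 1)) := by
      intro he
      have h5 := congrArg f.coord he
      rw [f.coord_site, f.coord_site] at h5
      have h6 := hl ⟨0, hd⟩
      rw [← h5] at h6
      exact lt_irrefl _ h6
    have h3 := passageTime_add_one_le hτ (hz (k + 1) (by omega) le_rfl) hne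
    have h4 := f.l1_site_sub (c (k + 1)) (c (k + 1 + 1))
    have h5 : ∑ a, |(c (k + 1 + 1)).1 a - (c (k + 1)).1 a|
        = ∑ a, (c (k + 1 + 1)).1 a - ∑ a, (c (k + 1)).1 a := by
      rw [← Finset.sum_sub_distrib]
      exact Finset.sum_congr rfl fun a _ => abs_of_pos (by linarith [hl a])
    rw [Finset.sum_range_succ]
    rw [h5] at h4
    push_cast
    omega

lemma passageTime_config_add_le (hd : 1 ≤ d₁) {h : Fin d₁ → ℝ} (hh : ∀ a, 0 < h a)
    {S : Set (SemiSpace d₁ d₂)} {L : ℝ} {k : ℕ} {w : ℕ → SemiSpace d₁ d₂}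
    (hw : IsMonotoneSeq S (fun _ => L) k w) {y : Fin d → ℤ}
    (hgap : ∀ i ∈ Finset.range (k + 1), ∀ a, 1 ≤ i → h a < (w (i + 1)).1 a - (w i).1 a)
    (hL : ∀ a, h a < L) (hy : ∀ a, L / h a - 1 ≤ (f.coord y).1 a) (hy2 : (f.coord y).2 = 0) :
    (passageTime (f.config h S) 0 y : ℤ) + k ≤ l1 y + verticalDisplacement k w := by
  -- The endpoint is `y` itself rather than the box of `(L, 0)`, because `y` is only known to be far
  -- enough up to one unit of rounding.
  set c : ℕ → (Fin d₁ → ℤ) × (Fin d₂ → ℤ) :=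
    fun i => if i ≤ k then cellIndex h (w i) else f.coord y with hc
  have hypos : ∀ a, 0 < (f.coord y).1 a := by
    intro a
    have h1 : (1 : ℝ) < L / h a := by rw [lt_div_iff₀ (hh a)]; linarith [hL a]
    have h2 := hy a
    have : (0 : ℝ) < (f.coord y).1 a := by linarith
    exact_mod_cast this
  have hcend : c (k + 1) = f.coord y := by simp [hc]
  have h0 : c 0 = 0 := by
    simp only [hc, zero_le, if_true, hw.left]
    refine Prod.ext (funext fun a => ?_) rfl
    simp [cellIndex]
  have hsnd : ∀ i, i ≤ k + 1 → (c i).2 = (w i).2 := by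
    intro i hi
    by_cases hik : i ≤ k
    · simp [hc, hik, cellIndex]
    · obtain rfl : i = k + 1 := by omega
      rw [hcend, hy2, hw.right]
  have key := f.passageTime_add_le_of_chain hd (f.config_le_one h S) k c h0 ?_ ?_ ?_
  · rw [hcend, f.site_coord] at key
    have h1 : (l1 y : ℤ) = ∑ a, (f.coord y).1 a := by
      rw [f.l1_eq, hy2]
      simp only [Pi.zero_apply, abs_zero, Finset.sum_const_zero, add_zero]
      exact Finset.sum_congr rfl fun a _ => abs_of_pos (hypos a)
    have h2 : ∑ i ∈ Finset.range (k + 1), ∑ b, |(c (i + 1)).2 b - (c i).2 b|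
        = verticalDisplacement k w := by
      refine Finset.sum_congr rfl fun i hi => ?_
      rw [Finset.mem_range] at hi
      rw [hsnd i (by omega), hsnd (i + 1) (by omega)]
    rw [h1, ← h2]
    exact key
  · intro i hi hik
    rw [f.config_eq_zero_iff, f.coord_site]
    exact ⟨w i, hw.mem i hi hik, (mem_cell_iff hh).2 (by simp [hc, hik])⟩
  · intro a
    by_cases hk : 1 ≤ k
    · simp only [hc, hk, if_true, cellIndex]
      have := hw.first_le a
      rw [hw.left] at this
      exact Int.floor_nonneg.2 (div_nonneg this (hh a).le)
    · obtain rfl : k = 0 := by omega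
      rw [zero_add] at hcend
      rw [hcend]
      exact (hypos a).le
  · intro i hi hik a
    have hg := hgap i (Finset.mem_range.2 (by omega)) a hi
    have h1 : (c i).1 a = ⌊(w i).1 a / h a⌋ := by simp [hc, hik, cellIndex]
    rw [h1]
    by_cases hik' : i + 1 ≤ k
    · have h2 : (c (i + 1)).1 a = ⌊(w (i + 1)).1 a / h a⌋ := by simp [hc, hik', cellIndex]
      rw [h2, ← Int.add_one_le_iff, Int.le_floor, Int.cast_add, Int.cast_one,
        le_div_iff₀ (hh a), add_mul, one_mul]
      have := Int.floor_le ((w i).1 a / h a)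
      rw [le_div_iff₀ (hh a)] at this
      linarith
    · obtain rfl : i = k := by omega
      rw [hcend, Int.floor_lt]
      rw [hw.right] at hg
      refine lt_of_lt_of_le ?_ (hy a)
      -- The last gap exceeds a full mesh, which compensates the `- 1` in `hy`.
      rw [lt_sub_iff_add_lt, lt_div_iff₀ (hh a), add_mul, one_mul, div_mul_cancel₀ _ (hh a).ne']
      simp only at hg
      linarith

/-- The gain of the first-passage time from `0` to `y` with respect to the distance. -/
def gain (h : Fin d₁ → ℝ) (S : Set (SemiSpace d₁ d₂)) (y : Fin d → ℤ) : ℝ :=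
  (l1 y : ℝ) - passageTime (f.config h S) 0 y

lemma gain_nonneg (h : Fin d₁ → ℝ) (S : Set (SemiSpace d₁ d₂)) (y : Fin d → ℤ) :
    0 ≤ f.gain h S y := by
  have := passageTime_le_l1 (f.config_le_one h S) 0 y
  rw [sub_zero] at this
  exact sub_nonneg.2 (mod_cast this)

/-- A single monotone sequence has finitely many positive gaps, so a fine mesh separates its points.
No uniformity over sequences is needed, as the supremum is taken after the liminf. -/
lemma score_le_liminf_gain (hd : 1 ≤ d₁) {α : Type*} {l : Filter α} {h : α → Fin d₁ → ℝ}
    (hh : ∀ i a, 0 < h i a) (hlim : ∀ a, Tendsto (fun i => h i a) l (𝓝 0))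
    {L : ℝ} (hL : 0 < L) {y : α → Fin d → ℤ}
    (hy : ∀ i a, L / h i a - 1 ≤ (f.coord (y i)).1 a) (hy2 : ∀ i, (f.coord (y i)).2 = 0)
    (S : Set (SemiSpace d₁ d₂)) :
    score S (fun _ => L) ≤ liminf (fun i => ENNReal.ofReal (f.gain (h i) S (y i))) l := by
  refine iSup_le fun k => iSup_le fun w => iSup_le fun hw => ?_
  refine le_liminf_of_le (by isBoundedDefault) ?_
  have h1 : ∀ᶠ i in l, ∀ j ∈ Finset.range (k + 1), ∀ a, 1 ≤ j →
      h i a < (w (j + 1)).1 a - (w j).1 a := by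
    rw [eventually_all_finset]
    intro j hj
    rw [eventually_all]
    intro a
    by_cases hj1 : 1 ≤ j
    · have : 0 < (w (j + 1)).1 a - (w j).1 a := by
        have := hw.lt_next j hj1 (by rw [Finset.mem_range] at hj; omega) a
        linarith
      filter_upwards [(hlim a).eventually_lt_const this] with i hi _ using hi
    · exact Eventually.of_forall fun i hc => absurd hc hj1
  have h2 : ∀ᶠ i in l, ∀ a, h i a < L := by
    rw [eventually_all]
    exact fun a => (hlim a).eventually_lt_const hL
  filter_upwards [h1, h2] with i hi1 hi2
  have key := f.passageTime_config_add_le hd (hh i) hw hi1 hi2 (hy i) (hy2 i)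
  refine ENNReal.ofReal_le_ofReal ?_
  have key' : (passageTime (f.config (h i) S) 0 (y i) : ℝ) + k
      ≤ l1 (y i) + verticalDisplacement k w := by exact_mod_cast key
  rw [gain]
  linarith

end Frame

section Expectation

variable {d d₁ d₂ : ℕ} (f : Frame d d₁ d₂) {Ω : Type*} [MeasurableSpace Ω] {P : Measure Ω}
  {ξ : Ω → Set (SemiSpace d₁ d₂)}

lemma measurable_gain (hξ : IsPoissonPointProcess ξ (semiIntensity d₁ d₂) P) (h : Fin d₁ → ℝ)
    (y : Fin d → ℤ) : Measurable fun ω => f.gain h (ξ ω) y := by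
  have h1 : Measurable fun ω => (passageTime (f.config h (ξ ω)) 0 y : ℝ) :=
    measurable_from_nat.comp ((measurable_passageTime 0 y).comp (measurable_config f hξ h))
  exact measurable_const.sub h1

lemma lintegral_gain [IsProbabilityMeasure P]
    (hξ : IsPoissonPointProcess ξ (semiIntensity d₁ d₂) P)
    {h : Fin d₁ → ℝ} (hh : ∀ a, 0 < h a) {ε : unitInterval}
    (hε : Real.exp (-∏ a, h a) = 1 - ε) (y : Fin d → ℤ) :
    ∫⁻ ω, ENNReal.ofReal (f.gain h (ξ ω) y) ∂P
      = ENNReal.ofReal (l1 y - meanTime d ε 0 y) := by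
  have hT : Measurable fun τ : (Fin d → ℤ) → ℕ => (passageTime τ 0 y : ℝ) :=
    measurable_from_nat.comp (measurable_passageTime 0 y)
  have hi := integrable_passageTime d ε 0 y
  rw [← map_config f hξ hh hε] at hi
  have hi2 : Integrable (fun ω => (passageTime (f.config h (ξ ω)) 0 y : ℝ)) P :=
    hi.comp_measurable (measurable_config f hξ h)
  have hi3 : Integrable (fun ω => f.gain h (ξ ω) y) P := (integrable_const _).sub hi2
  rw [← ofReal_integral_eq_lintegral_ofReal hi3 (ae_of_all _ fun ω => f.gain_nonneg h (ξ ω) y)]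
  congr 1
  simp only [Frame.gain]
  rw [integral_sub (integrable_const _) hi2, meanTime, ← map_config f hξ hh hε,
    integral_map (measurable_config f hξ h).aemeasurable hT.aestronglyMeasurable]
  simp

/-- Fatou's lemma, with one Poisson process serving all the meshes. It also spares any measurability
of the score. -/
theorem lintegral_score_le_liminf [IsProbabilityMeasure P]
    (hξ : IsPoissonPointProcess ξ (semiIntensity d₁ d₂) P) (hd : 1 ≤ d₁)
    {h : ℕ → Fin d₁ → ℝ} (hh : ∀ i a, 0 < h i a)
    (hlim : ∀ a, Tendsto (fun i => h i a) atTop (𝓝 0)) {ε : ℕ → unitInterval}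
    (hε : ∀ i, Real.exp (-∏ a, h i a) = 1 - ε i) {L : ℝ} (hL : 0 < L) {y : ℕ → Fin d → ℤ}
    (hy : ∀ i a, L / h i a - 1 ≤ (f.coord (y i)).1 a) (hy2 : ∀ i, (f.coord (y i)).2 = 0) :
    ∫⁻ ω, score (ξ ω) (fun _ => L) ∂P
      ≤ liminf (fun i => ENNReal.ofReal (l1 (y i) - meanTime d (ε i) 0 (y i))) atTop := by
  calc ∫⁻ ω, score (ξ ω) (fun _ => L) ∂P
      ≤ ∫⁻ ω, liminf (fun i => ENNReal.ofReal (f.gain (h i) (ξ ω) (y i))) atTop ∂P :=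
        lintegral_mono fun ω => f.score_le_liminf_gain hd hh hlim hL hy hy2 (ξ ω)
    _ ≤ liminf (fun i => ∫⁻ ω, ENNReal.ofReal (f.gain (h i) (ξ ω) (y i)) ∂P) atTop :=
        lintegral_liminf_le fun i => (measurable_gain f hξ (h i) (y i)).ennreal_ofReal
    _ = _ := by simp only [lintegral_gain f hξ (hh _) (hε _)]

end Expectation

/-! ### Extracting a strictly increasing chain from a sequence of zeros -/

/-- All the consecutive pairs of the sequence `a, l, b` are related by `R`. -/
def chainAll {α : Type*} (R : α → α → Prop) : α → List α → α → Prop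
  | a, [], b => R a b
  | a, w :: l, b => R a w ∧ chainAll R w l b

/-- The sequence `a, l, b, b, …`. -/
def listSeq {α : Type*} : α → List α → α → ℕ → α
  | a, _, _, 0 => a
  | _, [], b, _ + 1 => b
  | _, w :: l, b, i + 1 => listSeq w l b i

lemma listSeq_zero {α : Type*} (a : α) (l : List α) (b : α) : listSeq a l b 0 = a := by
  cases l <;> rfl

lemma listSeq_length_add_one {α : Type*} (a : α) (l : List α) (b : α) :
    listSeq a l b (l.length + 1) = b := by
  induction l generalizing a with
  | nil => rfl
  | cons w l ih => exact ih w

lemma listSeq_mem {α : Type*} (a : α) (l : List α) (b : α) (i : ℕ) (hi : 1 ≤ i)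
    (hil : i ≤ l.length) : listSeq a l b i ∈ l := by
  induction l generalizing a i with
  | nil => simp at hil; omega
  | cons w l ih =>
    obtain ⟨i, rfl⟩ : ∃ j, i = j + 1 := ⟨i - 1, by omega⟩
    rcases Nat.eq_zero_or_pos i with rfl | h
    · simp [listSeq, listSeq_zero]
    · exact List.mem_cons_of_mem _ (ih w i h (by simpa using hil))

lemma chainAll.listSeq {α : Type*} {R : α → α → Prop} {a : α} {l : List α} {b : α}
    (h : chainAll R a l b) (i : ℕ) (hi : i ≤ l.length) :
    R (listSeq a l b i) (listSeq a l b (i + 1)) := by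
  induction l generalizing a i with
  | nil =>
    obtain rfl : i = 0 := by simpa using hi
    exact h
  | cons w l ih =>
    rcases i with _ | i
    · simpa [_root_.listSeq, listSeq_zero] using h.1
    · exact ih h.2 i (by simpa using hi)

lemma sum_listSeq {α β : Type*} [AddCommMonoid β] (c : α → α → β) (a : α) (l : List α) (b : α) :
    ∑ i ∈ Finset.range (l.length + 1), c (listSeq a l b i) (listSeq a l b (i + 1))
      = chainCost c a l b := by
  induction l generalizing a with
  | nil => simp [listSeq, chainCost]
  | cons w l ih =>
    rw [List.length_cons, Finset.sum_range_succ', chainCost, ← ih w, add_comm]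
    simp only [listSeq, listSeq_zero]

section Cells

variable {d₁ d₂ : ℕ}

/-- The vertical `ℓ¹` distance. -/
def vertStep (c c' : (Fin d₁ → ℤ) × (Fin d₂ → ℤ)) : ℤ := ∑ b, |c'.2 b - c.2 b|

/-- The total backward displacement in the first `d₁` coordinates. -/
def backStep (c c' : (Fin d₁ → ℤ) × (Fin d₂ → ℤ)) : ℤ := ∑ a, max (c.1 a - c'.1 a) 0

/-- The number of the first `d₁` coordinates which increase by at most `M`. -/
def shortStep (M : ℤ) (c c' : (Fin d₁ → ℤ) × (Fin d₂ → ℤ)) : ℤ :=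
  ∑ a, if c'.1 a - c.1 a ≤ M then 1 else 0

/-- Greedy extraction of a strictly increasing chain above `m` and below `X`. -/
def greedy (X : Fin d₁ → ℤ) : (Fin d₁ → ℤ) → List ((Fin d₁ → ℤ) × (Fin d₂ → ℤ)) →
    List ((Fin d₁ → ℤ) × (Fin d₂ → ℤ))
  | _, [] => []
  | m, w :: l => open Classical in
    if ∀ a, m a < w.1 a ∧ w.1 a < X a then w :: greedy X w.1 l else greedy X m l

lemma greedy_sublist (X m : Fin d₁ → ℤ) (l : List ((Fin d₁ → ℤ) × (Fin d₂ → ℤ))) :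
    (greedy X m l).Sublist l := by
  induction l generalizing m with
  | nil => exact .slnil
  | cons w l ih =>
    rw [greedy]
    split_ifs
    · exact (ih _).cons_cons w
    · exact (ih _).cons w

lemma chainAll_greedy {X m : Fin d₁ → ℤ} (hm : ∀ a, m a < X a) (u v : Fin d₂ → ℤ)
    (l : List ((Fin d₁ → ℤ) × (Fin d₂ → ℤ))) :
    chainAll (fun c c' => ∀ a, c.1 a < c'.1 a) (m, u) (greedy X m l) (X, v) := by
  induction l generalizing m u with
  | nil => exact hm
  | cons w l ih =>
    rw [greedy]
    split_ifs with h
    · exact ⟨fun a => (h a).1, ih (fun a => (h a).2) w.2⟩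
    · exact ih hm u

/-- One step of the potential argument, for a discarded `w`: some coordinate is not above the record
`m`, or is not below `X`. If the step from `c` is short there, the term `2 * M` pays. If it is long,
it either lowers the deficit behind `m` by at least `M`, or leaves `w` beyond `X` with a debt to be
settled on the way back. Backward moves count twice, as they can change both the deficit and the
overshoot. -/
lemma sum_pos_part_le_of_not_lt (M : ℤ) (hM : 0 ≤ M) (X m c w : Fin d₁ → ℤ)
    (h : ¬ ∀ a, m a < w a ∧ w a < X a) :
    M + ∑ a, ((if X a ≤ c a then M else 0) + max (c a - X a) 0 + max (m a - w a) 0)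
      ≤ ∑ a, ((if X a ≤ w a then M else 0) + max (w a - X a) 0
        + 2 * (M * (if w a - c a ≤ M then 1 else 0)) + 2 * max (c a - w a) 0
        + max (m a - c a) 0) := by
  push Not at h
  obtain ⟨a₀, ha₀⟩ := h
  rw [← Finset.add_sum_erase _ _ (Finset.mem_univ a₀),
    ← Finset.add_sum_erase (a := a₀) _ (fun a => (if X a ≤ w a then M else 0) + max (w a - X a) 0
        + 2 * (M * (if w a - c a ≤ M then 1 else 0)) + 2 * max (c a - w a) 0
        + max (m a - c a) 0) (Finset.mem_univ a₀), ← add_assoc]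
  -- The violating coordinate `a₀` supplies the extra `M`; the others satisfy the inequality without
  -- it.
  refine add_le_add ?_ (Finset.sum_le_sum fun a _ => ?_)
  · rcases le_or_gt (w a₀) (m a₀) with h | h
    · split_ifs <;> omega
    · have := ha₀ h
      split_ifs <;> omega
  · split_ifs <;> omega

/-- Each discarded zero costs `M`. The sum on the left is the debt of standing at or beyond `X`, and
the last sum on the right is the credit for lagging behind the record `m`. Carrying both makes the
induction close; started at `m = 0` and `c = 0`, the credit vanishes. -/
lemma length_sub_length_greedy_le (M : ℤ) (hM : 0 ≤ M) (X : Fin d₁ → ℤ) (v : Fin d₂ → ℤ)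
    (m : Fin d₁ → ℤ) (c : (Fin d₁ → ℤ) × (Fin d₂ → ℤ))
    (l : List ((Fin d₁ → ℤ) × (Fin d₂ → ℤ))) :
    M * (l.length - (greedy X m l).length)
        + ∑ a, ((if X a ≤ c.1 a then M else 0) + max (c.1 a - X a) 0)
      ≤ 2 * (M * chainCost (shortStep M) c l (X, v)) + 2 * chainCost backStep c l (X, v)
        + ∑ a, max (m a - c.1 a) 0 := by
  induction l generalizing m c with
  | nil =>
    simp only [greedy, chainCost, shortStep, backStep, List.length_nil, Nat.cast_zero, sub_self,
      mul_zero, zero_add, Finset.mul_sum, ← Finset.sum_add_distrib]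
    refine Finset.sum_le_sum fun a _ => ?_
    split_ifs <;> omega
  | cons w l ih =>
    rw [greedy]
    split_ifs with h
    · have h1 := ih w.1 w
      have h2 : ∑ a, ((if X a ≤ c.1 a then M else 0) + max (c.1 a - X a) 0)
          ≤ ∑ a, ((if X a ≤ w.1 a then M else 0) + max (w.1 a - X a) 0)
            + 2 * (M * shortStep M c w) + 2 * backStep c w := by
        simp only [shortStep, backStep, Finset.mul_sum, ← Finset.sum_add_distrib]
        refine Finset.sum_le_sum fun a _ => ?_
        split_ifs <;> omega
      have h3 : 0 ≤ ∑ a, max (m a - c.1 a) 0 := Finset.sum_nonneg fun a _ => le_max_right _ _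
      simp only [sub_self, max_self, Finset.sum_const_zero, add_zero] at h1
      simp only [List.length_cons, chainCost]
      push_cast
      linarith
    · have h1 := ih m w
      have h2 := sum_pos_part_le_of_not_lt M hM X m c.1 w.1 h
      simp only [Finset.sum_add_distrib, ← Finset.mul_sum] at h1 h2 ⊢
      simp only [List.length_cons, chainCost, shortStep, backStep] at h1 h2 ⊢
      push_cast
      linarith

lemma chainCost_mono_sublist {α : Type*} {c : α → α → ℤ}
    (htri : ∀ x y z, c x z ≤ c x y + c y z) {l l' : List α} (h : l'.Sublist l) (a b : α) :
    chainCost c a l' b ≤ chainCost c a l b := by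
  induction h generalizing a with
  | slnil => exact le_rfl
  | @cons l₁ l₂ w h ih =>
    refine le_trans ?_ (add_le_add_right (ih w) (c a w))
    cases l₁ with
    | nil => exact htri _ _ _
    | cons w' l₁ =>
      simp only [chainCost]
      linarith [htri a w w']
  | cons_cons w h ih => exact add_le_add_right (ih w) _

lemma vertStep_triangle (x y z : (Fin d₁ → ℤ) × (Fin d₂ → ℤ)) :
    vertStep x z ≤ vertStep x y + vertStep y z := by
  rw [vertStep, vertStep, vertStep, ← Finset.sum_add_distrib]
  refine Finset.sum_le_sum fun b _ => ?_
  have := abs_sub_le (z.2 b) (y.2 b) (x.2 b)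
  linarith

/-! ### Strictly increasing chains of occupied cells bound the score from below -/

lemma chainAll_map_of_mem_cell {h : Fin d₁ → ℝ} (hh : ∀ a, 0 < h a)
    {p : (Fin d₁ → ℤ) × (Fin d₂ → ℤ) → SemiSpace d₁ d₂} {X : Fin d₁ → ℤ} {v : Fin d₂ → ℤ}
    {x : Fin d₁ → ℝ} (hX : ∀ a, h a * X a ≤ x a)
    {K : List ((Fin d₁ → ℤ) × (Fin d₂ → ℤ))} (hp : ∀ c ∈ K, p c ∈ cell h c)
    {c : (Fin d₁ → ℤ) × (Fin d₂ → ℤ)} {q : SemiSpace d₁ d₂}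
    (hq : ∀ a, q.1 a < h a * (c.1 a + 1))
    (hK : chainAll (fun c c' => ∀ a, c.1 a < c'.1 a) c K (X, v)) :
    chainAll (fun q q' : SemiSpace d₁ d₂ => ∀ a, q.1 a < q'.1 a) q (K.map p) (x, v) := by
  have hstep : ∀ (k k' : ℤ) (a : Fin d₁), k < k' → h a * ((k : ℝ) + 1) ≤ h a * k' := by
    intro k k' a hk
    exact mul_le_mul_of_nonneg_left (mod_cast hk) (hh a).le
  induction K generalizing c q with
  | nil => exact fun a => (hq a).trans_le ((hstep _ _ a (hK a)).trans (hX a))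
  | cons w K ih =>
    have hw := mem_cell.1 (hp w List.mem_cons_self)
    exact ⟨fun a => (hq a).trans_le ((hstep _ _ a (hK.1 a)).trans (hw.1 a).1),
      ih (fun c hc => hp c (List.mem_cons_of_mem _ hc)) (fun a => (hw.1 a).2) hK.2⟩

lemma chainCost_vert_map {h : Fin d₁ → ℝ}
    {p : (Fin d₁ → ℤ) × (Fin d₂ → ℤ) → SemiSpace d₁ d₂} (x : Fin d₁ → ℝ) (X : Fin d₁ → ℤ)
    (v : Fin d₂ → ℤ) {K : List ((Fin d₁ → ℤ) × (Fin d₂ → ℤ))} (hp : ∀ c ∈ K, p c ∈ cell h c)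
    {c : (Fin d₁ → ℤ) × (Fin d₂ → ℤ)} {q : SemiSpace d₁ d₂} (hq : q.2 = c.2) :
    chainCost (fun q q' : SemiSpace d₁ d₂ => ∑ b, |q'.2 b - q.2 b|) q (K.map p) (x, v)
      = chainCost vertStep c K (X, v) := by
  induction K generalizing c q with
  | nil => simp [chainCost, vertStep, hq]
  | cons w K ih =>
    have hw := (mem_cell.1 (hp w List.mem_cons_self)).2
    rw [List.map_cons, chainCost, chainCost,
      ih (fun c hc => hp c (List.mem_cons_of_mem _ hc)) hw, vertStep, hw, hq]

/-- Any choice of one point per box works, because strictly increasing half-open boxes force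
strictly increasing points. A start at `-1` is allowed since the first comparison with `0` is only
large, so boxes with index `0` may be used. -/
lemma le_score_of_chainAll {h : Fin d₁ → ℝ} (hh : ∀ a, 0 < h a) {S : Set (SemiSpace d₁ d₂)}
    {X : Fin d₁ → ℤ} {x : Fin d₁ → ℝ} (hX : ∀ a, h a * X a ≤ x a)
    {K : List ((Fin d₁ → ℤ) × (Fin d₂ → ℤ))} (hS : ∀ c ∈ K, ∃ p ∈ S, p ∈ cell h c)
    {m : Fin d₁ → ℤ} (hm : ∀ a, m a = 0 ∨ m a = -1)
    (hK : chainAll (fun c c' => ∀ a, c.1 a < c'.1 a) (m, 0) K (X, 0)) :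
    ENNReal.ofReal ((K.length : ℝ) - (chainCost vertStep (m, 0) K (X, 0) : ℤ)) ≤ score S x := by
  classical
  let p : (Fin d₁ → ℤ) × (Fin d₂ → ℤ) → SemiSpace d₁ d₂ := fun c =>
    if hc : ∃ p ∈ S, p ∈ cell h c then hc.choose else 0
  have hpS : ∀ c ∈ K, p c ∈ S ∧ p c ∈ cell h c := by
    intro c hc
    have := hS c hc
    simp only [p, dif_pos this]
    exact this.choose_spec
  have hpc : ∀ c ∈ K, p c ∈ cell h c := fun c hc => (hpS c hc).2
  have hfst : ∀ l : List ((Fin d₁ → ℤ) × (Fin d₂ → ℤ)), (∀ c ∈ l, p c ∈ cell h c) →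
      chainAll (fun c c' => ∀ a, c.1 a < c'.1 a) (m, 0) l (X, 0) →
      ∀ a, 0 ≤ (listSeq (0 : SemiSpace d₁ d₂) (l.map p) (x, 0) 1).1 a := by
    intro l hl hc a
    have hpos : ∀ k : ℤ, m a < k → 0 ≤ h a * (k : ℝ) := fun k hk =>
      mul_nonneg (hh a).le (by
        have : 0 ≤ k := by rcases hm a with h | h <;> omega
        exact_mod_cast this)
    cases l with
    | nil => exact (hpos _ (hc a)).trans (hX a)
    | cons w l =>
      simp only [List.map_cons, listSeq, listSeq_zero]
      exact (hpos _ (hc.1 a)).trans ((mem_cell.1 (hl w List.mem_cons_self)).1 a).1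
  have hlen : (K.map p).length = K.length := List.length_map _
  have hseq : IsMonotoneSeq S x K.length (listSeq (0 : SemiSpace d₁ d₂) (K.map p) (x, 0)) := by
    refine ⟨listSeq_zero _ _ _, ?_, ?_, ?_, ?_⟩
    · rw [← hlen, listSeq_length_add_one]
    · intro i hi hik
      obtain ⟨c, hc, hce⟩ := List.mem_map.1
        (listSeq_mem (0 : SemiSpace d₁ d₂) (K.map p) (x, 0) i hi (by rwa [hlen]))
      rw [← hce]
      exact (hpS c hc).1
    · intro a
      rw [listSeq_zero]
      exact hfst K hpc hK a
    · intro i hi hik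
      have hbase : chainAll (fun q q' : SemiSpace d₁ d₂ => ∀ a, q.1 a < q'.1 a)
          ((fun a => h a * m a), 0) (K.map p) (x, 0) :=
        chainAll_map_of_mem_cell hh hX hpc (c := (m, 0))
          (fun a => mul_lt_mul_of_pos_left (by simp) (hh a)) hK
      obtain ⟨i, rfl⟩ : ∃ j, i = j + 1 := ⟨i - 1, by omega⟩
      have := hbase.listSeq (i + 1) (by omega)
      cases hKm : K.map p with
      | nil => rw [← hlen, hKm] at hik; simp at hik
      | cons w l => rw [hKm] at this; exact this
  have hvert : verticalDisplacement K.length (listSeq (0 : SemiSpace d₁ d₂) (K.map p) (x, 0))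
      = chainCost vertStep (m, 0) K (X, 0) := by
    rw [← chainCost_vert_map x X 0 hpc (q := 0) (c := (m, 0)) rfl, ← sum_listSeq, hlen]
    rfl
  rw [← hvert]
  exact le_iSup_of_le _ (le_iSup_of_le _ (le_iSup_of_le hseq le_rfl))

end Cells

/-! ### The gain is bounded by the score up to a sum over sequences of zeros -/

section Cells

variable {d d₁ d₂ : ℕ}

lemma vertStep_nonneg (c c' : (Fin d₁ → ℤ) × (Fin d₂ → ℤ)) : 0 ≤ vertStep c c' :=
  Finset.sum_nonneg fun _ _ => abs_nonneg _

lemma backStep_nonneg (c c' : (Fin d₁ → ℤ) × (Fin d₂ → ℤ)) : 0 ≤ backStep c c' :=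
  Finset.sum_nonneg fun _ _ => le_max_right _ _

lemma shortStep_nonneg (M : ℤ) (c c' : (Fin d₁ → ℤ) × (Fin d₂ → ℤ)) : 0 ≤ shortStep M c c' :=
  Finset.sum_nonneg fun _ _ => by split_ifs <;> simp

lemma chainCost_nonneg {α : Type*} {c : α → α → ℤ} (hc : ∀ x y, 0 ≤ c x y) (a : α) (l : List α)
    (b : α) : 0 ≤ chainCost c a l b := by
  induction l generalizing a with
  | nil => exact hc _ _
  | cons w l ih => exact add_nonneg (hc _ _) (ih w)

/-- Writing `|s| = s + 2 s⁻` in the first coordinates, the signed parts telescope and only backward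
moves remain, doubled. -/
lemma Frame.chainCost_l1 (f : Frame d d₁ d₂) (x y : Fin d → ℤ) (l : List (Fin d → ℤ)) :
    ((chainCost (fun a b => l1 (b - a)) x l y : ℕ) : ℤ)
      = ∑ a, ((f.coord y).1 a - (f.coord x).1 a)
        + 2 * chainCost backStep (f.coord x) (l.map f.coord) (f.coord y)
        + chainCost vertStep (f.coord x) (l.map f.coord) (f.coord y) := by
  have hstep : ∀ x y : Fin d → ℤ, (l1 (y - x) : ℤ) = ∑ a, ((f.coord y).1 a - (f.coord x).1 a)
      + 2 * backStep (f.coord x) (f.coord y) + vertStep (f.coord x) (f.coord y) := by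
    intro x y
    rw [f.l1_eq, f.coord_sub, backStep, vertStep, Finset.mul_sum, ← Finset.sum_add_distrib]
    congr 1
    refine Finset.sum_congr rfl fun a _ => ?_
    simp only [Prod.fst_sub, Pi.sub_apply]
    rcases le_total ((f.coord y).1 a - (f.coord x).1 a) 0 with h | h
    · rw [abs_of_nonpos h]; omega
    · rw [abs_of_nonneg h]; omega
  induction l generalizing x with
  | nil => exact hstep x y
  | cons w l ih =>
    simp only [chainCost, List.map_cons]
    push_cast
    rw [hstep x w, ih w]
    simp only [Finset.sum_sub_distrib]
    ring

/-- The zeros of the geodesic satisfy `gain + 2 B + V ≤ length`. Passing to the greedy subchain does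
not increase `V`, and what it loses in length is the error term. -/
lemma Frame.exists_list_of_gain (f : Frame d d₁ d₂) {h : Fin d₁ → ℝ} (hh : ∀ a, 0 < h a)
    (S : Set (SemiSpace d₁ d₂)) {y : Fin d → ℤ} {X : Fin d₁ → ℤ} (hy : f.coord y = (X, 0))
    (hX : ∀ a, 0 < X a) {t : ℝ} (ht : ∀ a, h a * X a ≤ t) {M : ℕ} (hM : 1 ≤ M) :
    ∃ l : List ((Fin d₁ → ℤ) × (Fin d₂ → ℤ)), l.Nodup ∧ (∀ c ∈ l, ∃ p ∈ S, p ∈ cell h c) ∧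
      chainCost vertStep 0 l (X, 0) + 2 * chainCost backStep 0 l (X, 0) ≤ l.length ∧
      f.gain h S y ≤ l.length ∧
      ENNReal.ofReal (f.gain h S y) ≤ score S (fun _ => t)
        + ENNReal.ofReal (2 * (chainCost (shortStep M) 0 l (X, 0) : ℤ) + (l.length : ℝ) / M) := by
  obtain ⟨lx, hnd, hz, hc⟩ := exists_zeros_of_passageTime (f.config_le_one h S) 0 y
  set l := lx.map f.coord with hl
  have hlen : l.length = lx.length := List.length_map _
  have h1 := f.chainCost_l1 0 y lx
  rw [f.coord_zero, hy, ← hl] at h1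
  have h2 : (l1 y : ℤ) = ∑ a, X a := by
    rw [f.l1_eq, hy]
    simp only [Pi.zero_apply, abs_zero, Finset.sum_const_zero, add_zero]
    exact Finset.sum_congr rfl fun a _ => abs_of_pos (hX a)
  simp only [Prod.fst_zero, Pi.zero_apply, sub_zero] at h1
  rw [← h2] at h1
  have hB := chainCost_nonneg backStep_nonneg (0 : (Fin d₁ → ℤ) × (Fin d₂ → ℤ)) l (X, 0)
  have hV := chainCost_nonneg vertStep_nonneg (0 : (Fin d₁ → ℤ) × (Fin d₂ → ℤ)) l (X, 0)
  set B := chainCost backStep 0 l (X, 0)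
  set V := chainCost vertStep 0 l (X, 0)
  have hgain : ((l1 y : ℤ) - passageTime (f.config h S) 0 y) + 2 * B + V ≤ l.length := by omega
  have hgain' : f.gain h S y + 2 * (B : ℝ) + V ≤ l.length := by
    rw [Frame.gain]; exact_mod_cast hgain
  have hg0 := f.gain_nonneg h S y
  have hB' : (0 : ℝ) ≤ B := mod_cast hB
  have hV' : (0 : ℝ) ≤ V := mod_cast hV
  have hlS : ∀ c ∈ l, ∃ p ∈ S, p ∈ cell h c := by
    intro c hc
    obtain ⟨x, hx, rfl⟩ := List.mem_map.1 hc
    exact f.config_eq_zero_iff.1 (hz x hx)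
  refine ⟨l, hnd.map f.coord_injective, hlS, ?_, by linarith, ?_⟩
  · have : (V : ℝ) + 2 * B ≤ l.length := by linarith
    exact_mod_cast this
  · set K := greedy X 0 l with hK
    have hsub : K.Sublist l := greedy_sublist X 0 l
    have hchain := chainAll_greedy (m := 0) hX (0 : Fin d₂ → ℤ) 0 l
    have hscore := le_score_of_chainAll hh ht (fun c hc => hlS c (hsub.subset hc))
      (m := 0) (fun a => Or.inl rfl) hchain
    have hdel := length_sub_length_greedy_le (M : ℤ) (by omega) X (0 : Fin d₂ → ℤ) 0 0 l
    have hnn : 0 ≤ ∑ a, ((if X a ≤ (0 : (Fin d₁ → ℤ) × (Fin d₂ → ℤ)).1 a then (M : ℤ) else 0)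
        + max ((0 : (Fin d₁ → ℤ) × (Fin d₂ → ℤ)).1 a - X a) 0) :=
      Finset.sum_nonneg fun a _ => add_nonneg (by split_ifs <;> omega) (le_max_right _ _)
    simp only [Prod.fst_zero, Pi.zero_apply, sub_self, max_self, Finset.sum_const_zero,
      add_zero] at hdel hnn
    have hVK : chainCost vertStep ((0 : Fin d₁ → ℤ), (0 : Fin d₂ → ℤ)) K (X, 0) ≤ V :=
      chainCost_mono_sublist vertStep_triangle hsub _ _
    set VK := chainCost vertStep ((0 : Fin d₁ → ℤ), (0 : Fin d₂ → ℤ)) K (X, 0)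
    set T := chainCost (shortStep M) 0 l (X, 0)
    have hVK' : (VK : ℝ) ≤ V := mod_cast hVK
    have hdel' : (M : ℝ) * (l.length - K.length) ≤ 2 * (M * T) + 2 * B := by
      have : (M : ℤ) * (l.length - K.length) ≤ 2 * (M * T) + 2 * B := by linarith
      exact_mod_cast this
    have hM0 : (0 : ℝ) < M := by exact_mod_cast hM
    -- The backward displacement is at most half the length, hence contributes at most `length / M`.
    have hdel2 : (l.length : ℝ) - K.length ≤ 2 * T + l.length / M := by
      have h3 : (l.length : ℝ) / M * M = l.length := div_mul_cancel₀ _ hM0.ne'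
      refine le_of_mul_le_mul_left ?_ hM0
      nlinarith
    refine (ENNReal.ofReal_le_ofReal ?_).trans (ENNReal.ofReal_add_le.trans
      (add_le_add_left hscore _))
    linarith

/-! ### Exponential weights of sequences of cells -/

/-- The logarithmic weight of a step. -/
def logWeight (θ : ℝ) (M : ℕ) (α : Fin d₁ → ℝ) (c c' : (Fin d₁ → ℤ) × (Fin d₂ → ℤ)) : ℝ :=
  2 * θ * (shortStep M c c' : ℤ) + (θ / M + 1) - (vertStep c c' : ℤ) - 2 * (backStep c c' : ℤ)
    - ∑ a, α a * ((c'.1 a : ℝ) - c.1 a)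

/-- The weight is `θ` times the loss to be controlled, plus one unit per step, which pays for `V + 2
B`, minus a drift `α` that telescopes to a deterministic quantity. -/
lemma chainCost_logWeight (θ : ℝ) (M : ℕ) (α : Fin d₁ → ℝ)
    (c x : (Fin d₁ → ℤ) × (Fin d₂ → ℤ)) (l : List ((Fin d₁ → ℤ) × (Fin d₂ → ℤ))) :
    chainCost (logWeight θ M α) c l x = 2 * θ * (chainCost (shortStep M) c l x : ℤ)
      + (l.length + 1) * (θ / M + 1) - (chainCost vertStep c l x : ℤ)
      - 2 * (chainCost backStep c l x : ℤ) - ∑ a, α a * ((x.1 a : ℝ) - c.1 a) := by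
  induction l generalizing c with
  | nil => simp [chainCost, logWeight]
  | cons w l ih =>
    have h1 : ∑ a, α a * ((x.1 a : ℝ) - c.1 a)
        = ∑ a, α a * ((x.1 a : ℝ) - w.1 a) + ∑ a, α a * ((w.1 a : ℝ) - c.1 a) := by
      rw [← Finset.sum_add_distrib]
      exact Finset.sum_congr rfl fun a _ => by ring
    simp only [chainCost, ih w, logWeight, List.length_cons]
    rw [h1]
    push_cast
    ring

/-- Used for the final step, which goes to a fixed endpoint and is not summed over. With `α ≤ 2`,
the drift gained by going backward never exceeds the backward penalty. -/
lemma logWeight_le {θ : ℝ} (hθ : 0 ≤ θ) (M : ℕ) {α : Fin d₁ → ℝ} (hα : ∀ a, 0 ≤ α a ∧ α a ≤ 2)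
    (c c' : (Fin d₁ → ℤ) × (Fin d₂ → ℤ)) :
    logWeight θ M α c c' ≤ 2 * θ * d₁ + (θ / M + 1) := by
  have h1 : (shortStep M c c' : ℝ) ≤ d₁ := by
    have : shortStep M c c' ≤ ∑ _a : Fin d₁, (1 : ℤ) :=
      Finset.sum_le_sum fun a _ => by split_ifs <;> simp
    have h2 : shortStep M c c' ≤ d₁ := by simpa using this
    exact_mod_cast h2
  have h2 : (0 : ℝ) ≤ vertStep c c' := mod_cast vertStep_nonneg c c'
  have h3 : 0 ≤ 2 * ((backStep c c' : ℤ) : ℝ) + ∑ a, α a * ((c'.1 a : ℝ) - c.1 a) := by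
    rw [backStep, Int.cast_sum, Finset.mul_sum, ← Finset.sum_add_distrib]
    refine Finset.sum_nonneg fun a _ => ?_
    push_cast
    rcases le_total ((c.1 a : ℝ) - c'.1 a) 0 with h | h
    · rw [max_eq_right h]
      have := mul_nonneg (hα a).1 (neg_nonneg.2 h)
      linarith
    · rw [max_eq_left h]
      have := mul_le_mul_of_nonneg_right (hα a).2 h
      linarith
  have h4 : 2 * θ * (shortStep M c c' : ℝ) ≤ 2 * θ * d₁ :=
    mul_le_mul_of_nonneg_left h1 (by linarith)
  rw [logWeight]
  linarith

/-- The weight of a sequence of cells. -/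
def chainWeight (θ : ℝ) (M : ℕ) (α : Fin d₁ → ℝ) (c : (Fin d₁ → ℤ) × (Fin d₂ → ℤ))
    (l : List ((Fin d₁ → ℤ) × (Fin d₂ → ℤ))) (x : (Fin d₁ → ℤ) × (Fin d₂ → ℤ)) : ENNReal :=
  ENNReal.ofReal (Real.exp (chainCost (logWeight θ M α) c l x))

lemma chainWeight_cons (θ : ℝ) (M : ℕ) (α : Fin d₁ → ℝ) (c w x : (Fin d₁ → ℤ) × (Fin d₂ → ℤ))
    (l : List ((Fin d₁ → ℤ) × (Fin d₂ → ℤ))) : chainWeight θ M α c (w :: l) x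
      = ENNReal.ofReal (Real.exp (logWeight θ M α c w)) * chainWeight θ M α w l x := by
  rw [chainWeight, chainWeight, chainCost, Real.exp_add, ENNReal.ofReal_mul (Real.exp_pos _).le]

/-- The total weight of the steps. -/
def totalWeight (d₁ d₂ : ℕ) (θ : ℝ) (M : ℕ) (α : Fin d₁ → ℝ) : ENNReal :=
  ∑' c : (Fin d₁ → ℤ) × (Fin d₂ → ℤ), ENNReal.ofReal (Real.exp (logWeight θ M α 0 c))

lemma tsum_logWeight (θ : ℝ) (M : ℕ) (α : Fin d₁ → ℝ) (c : (Fin d₁ → ℤ) × (Fin d₂ → ℤ)) :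
    ∑' w, ENNReal.ofReal (Real.exp (logWeight θ M α c w)) = totalWeight d₁ d₂ θ M α := by
  rw [totalWeight, ← (Equiv.addRight c).tsum_eq
    fun w => ENNReal.ofReal (Real.exp (logWeight θ M α c w))]
  refine tsum_congr fun w => ?_
  congr 2
  simp [logWeight, shortStep, vertStep, backStep]

/-- By translation invariance each of the `k` free steps contributes the same factor, whatever the
current box. -/
lemma tsum_chainWeight_le {θ : ℝ} (hθ : 0 ≤ θ) (M : ℕ) {α : Fin d₁ → ℝ}
    (hα : ∀ a, 0 ≤ α a ∧ α a ≤ 2) (k : ℕ) (c x : (Fin d₁ → ℤ) × (Fin d₂ → ℤ)) :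
    ∑' v : Fin k → (Fin d₁ → ℤ) × (Fin d₂ → ℤ), chainWeight θ M α c (List.ofFn v) x
      ≤ totalWeight d₁ d₂ θ M α ^ k
        * ENNReal.ofReal (Real.exp (2 * θ * d₁ + (θ / M + 1))) := by
  induction k generalizing c with
  | zero =>
    rw [tsum_fintype]
    simp only [Finset.univ_unique, Finset.sum_singleton, List.ofFn_zero, pow_zero, one_mul]
    exact ENNReal.ofReal_le_ofReal (Real.exp_le_exp.2 (logWeight_le hθ M hα c x))
  | succ k ih =>
    rw [← (Fin.consEquiv fun _ : Fin (k + 1) => (Fin d₁ → ℤ) × (Fin d₂ → ℤ)).tsum_eq,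
      ENNReal.tsum_prod']
    calc _ = ∑' w, ∑' v : Fin k → (Fin d₁ → ℤ) × (Fin d₂ → ℤ),
          ENNReal.ofReal (Real.exp (logWeight θ M α c w))
            * chainWeight θ M α w (List.ofFn v) x := by
          refine tsum_congr fun w => tsum_congr fun v => ?_
          rw [← chainWeight_cons]
          congr 1
          simp [Fin.consEquiv, List.ofFn_succ]
      _ ≤ ∑' w, ENNReal.ofReal (Real.exp (logWeight θ M α c w))
            * (totalWeight d₁ d₂ θ M α ^ k
              * ENNReal.ofReal (Real.exp (2 * θ * d₁ + (θ / M + 1)))) := by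
          refine ENNReal.tsum_le_tsum fun w => ?_
          rw [ENNReal.tsum_mul_left]
          exact mul_le_mul_right (ih w) _
      _ = _ := by
          rw [ENNReal.tsum_mul_right, tsum_logWeight, pow_succ]
          ring

/-! ### Bounding the total weight -/

lemma tsum_pi_prod {n : ℕ} (g : Fin n → ℤ → ENNReal) :
    ∑' v : Fin n → ℤ, ∏ i, g i (v i) = ∏ i, ∑' k, g i k := by
  induction n with
  | zero => rw [tsum_fintype]; simp
  | succ n ih =>
    rw [← (Fin.consEquiv fun _ : Fin (n + 1) => ℤ).tsum_eq, ENNReal.tsum_prod',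
      Fin.prod_univ_succ, ← ih, ← ENNReal.tsum_mul_right]
    refine tsum_congr fun k => ?_
    rw [← ENNReal.tsum_mul_left]
    refine tsum_congr fun v => ?_
    simp [Fin.consEquiv, Fin.prod_univ_succ]

lemma ennreal_tsum_mul_prod {α β : Type*} (F : α → ENNReal) (G : β → ENNReal) :
    ∑' c : α × β, F c.1 * G c.2 = (∑' a, F a) * ∑' b, G b := by
  rw [ENNReal.tsum_prod', ← ENNReal.tsum_mul_right]
  exact tsum_congr fun a => ENNReal.tsum_mul_left (a := F a) (f := G)

lemma tsum_exp_neg_mul_le {α : ℝ} (hα : 0 < α) :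
    ∑' n : ℕ, ENNReal.ofReal (Real.exp (-(α * (n + 1)))) ≤ ENNReal.ofReal (1 / α) := by
  have h1 : Real.exp (-α) < 1 := by
    rw [← Real.exp_zero]; exact Real.exp_lt_exp.2 (by linarith)
  have hs := (hasSum_geometric_of_lt_one (Real.exp_pos (-α)).le h1).mul_left (Real.exp (-α))
  have h2 : ∀ n : ℕ, Real.exp (-(α * (n + 1))) = Real.exp (-α) * Real.exp (-α) ^ n := by
    intro n
    rw [← Real.exp_nat_mul, ← Real.exp_add]
    congr 1; ring
  simp only [h2]
  rw [← ENNReal.ofReal_tsum_of_nonneg (fun n => by positivity) hs.summable, hs.tsum_eq]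
  refine ENNReal.ofReal_le_ofReal ?_
  rw [← div_eq_mul_inv, div_le_div_iff₀ (by linarith) hα, one_mul]
  have h3 := Real.add_one_le_exp α
  have h4 : Real.exp (-α) * Real.exp α = 1 := by rw [← Real.exp_add]; simp
  nlinarith [Real.exp_pos (-α)]

lemma ennreal_tsum_int (f : ℤ → ENNReal) :
    ∑' k, f k = ∑' n : ℕ, f n + ∑' n : ℕ, f (-(n + 1)) :=
  (HasSum.of_nat_of_neg_add_one ENNReal.summable.hasSum ENNReal.summable.hasSum).tsum_eq

lemma tsum_exp_neg_abs_le : ∑' k : ℤ, ENNReal.ofReal (Real.exp (-|(k : ℝ)|)) ≤ 3 := by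
  have h := tsum_exp_neg_mul_le one_pos
  simp only [one_mul, div_one, ENNReal.ofReal_one] at h
  rw [ennreal_tsum_int, tsum_eq_zero_add' ENNReal.summable]
  have h1 : ∀ n : ℕ, |(((-((n : ℤ) + 1)) : ℤ) : ℝ)| = n + 1 := fun n => by
    push_cast; rw [abs_neg, abs_of_nonneg (by positivity)]
  have h2 : ∀ n : ℕ, |((((n + 1 : ℕ)) : ℤ) : ℝ)| = n + 1 := fun n => by
    push_cast; rw [abs_of_nonneg (by positivity)]
  simp only [h1, h2]
  calc _ ≤ (1 : ENNReal) + 1 + 1 := add_le_add (add_le_add (by simp) h) h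
    _ = 3 := by norm_num

/-- Forward short steps give `M + 1` terms `e^{2θ}`, backward steps one more in total (penalty `2`
against drift `α ≤ 1`), and long forward steps, free of the factor `e^{2θ}`, give `1 / α`. -/
lemma tsum_exp_step_le {θ α : ℝ} (hα : 0 < α) (hα1 : α ≤ 1) (M : ℕ) :
    ∑' k : ℤ, ENNReal.ofReal (Real.exp (2 * θ * (if k ≤ M then 1 else 0)
        - 2 * max (-(k : ℝ)) 0 - α * k))
      ≤ ENNReal.ofReal (Real.exp (2 * θ) * (M + 2) + 1 / α) := by
  have hpos := tsum_exp_neg_mul_le hα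
  have hneg := tsum_exp_neg_mul_le one_pos
  rw [ennreal_tsum_int]
  have h1 : ∀ n : ℕ, ENNReal.ofReal (Real.exp (2 * θ * (if (n : ℤ) ≤ M then 1 else 0)
      - 2 * max (-((n : ℤ) : ℝ)) 0 - α * (n : ℤ)))
      ≤ (if n ∈ Finset.range (M + 1) then ENNReal.ofReal (Real.exp (2 * θ)) else 0)
        + (if n = 0 then 0 else ENNReal.ofReal (Real.exp (-(α * n)))) := by
    intro n
    have hmax : max (-((n : ℤ) : ℝ)) 0 = 0 := max_eq_right (by simp)
    rw [hmax]
    by_cases hn : n ≤ M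
    · have hn' : (n : ℤ) ≤ M := by exact_mod_cast hn
      rw [if_pos hn', if_pos (Finset.mem_range.2 (by omega))]
      refine le_trans (ENNReal.ofReal_le_ofReal (Real.exp_le_exp.2 ?_)) le_self_add
      have : 0 ≤ α * (((n : ℕ) : ℤ) : ℝ) := by positivity
      linarith
    · have hn' : ¬ (n : ℤ) ≤ M := by exact_mod_cast hn
      rw [if_neg hn', if_neg (by simp; omega), if_neg (by omega), zero_add]
      refine ENNReal.ofReal_le_ofReal (Real.exp_le_exp.2 ?_)
      push_cast
      linarith
  have h2 : ∀ n : ℕ, ENNReal.ofReal (Real.exp (2 * θ * (if (-((n : ℤ) + 1)) ≤ (M : ℤ) then 1 else 0)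
      - 2 * max (-(((-((n : ℤ) + 1)) : ℤ) : ℝ)) 0 - α * ((-((n : ℤ) + 1) : ℤ) : ℝ)))
      ≤ ENNReal.ofReal (Real.exp (2 * θ)) * ENNReal.ofReal (Real.exp (-(1 * ((n : ℝ) + 1)))) := by
    intro n
    rw [if_pos (by omega), ← ENNReal.ofReal_mul (Real.exp_pos _).le, ← Real.exp_add]
    refine ENNReal.ofReal_le_ofReal (Real.exp_le_exp.2 ?_)
    push_cast
    have hn : (0 : ℝ) ≤ (n : ℝ) + 1 := by positivity
    rw [neg_neg, max_eq_left hn]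
    have := mul_le_mul_of_nonneg_right hα1 hn
    linarith
  refine (add_le_add (ENNReal.tsum_le_tsum h1) (ENNReal.tsum_le_tsum h2)).trans ?_
  rw [ENNReal.tsum_add, ENNReal.tsum_mul_left]
  have h3 : ∑' n : ℕ, (if n ∈ Finset.range (M + 1) then ENNReal.ofReal (Real.exp (2 * θ)) else 0)
      = ENNReal.ofReal (Real.exp (2 * θ) * (M + 1)) := by
    rw [tsum_eq_sum (s := Finset.range (M + 1)) fun n hn => if_neg hn,
      Finset.sum_congr rfl fun n hn => if_pos hn, Finset.sum_const, Finset.card_range,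
      nsmul_eq_mul, mul_comm, ENNReal.ofReal_mul (Real.exp_pos _).le]
    congr 1
    rw [← Nat.cast_add_one, ENNReal.ofReal_natCast]
  have h4 : ∑' n : ℕ, (if n = 0 then 0 else ENNReal.ofReal (Real.exp (-(α * n))))
      ≤ ENNReal.ofReal (1 / α) := by
    rw [tsum_eq_zero_add' ENNReal.summable, if_pos rfl, zero_add]
    refine le_trans (le_of_eq ?_) hpos
    exact tsum_congr fun n => by simp
  calc _ ≤ ENNReal.ofReal (Real.exp (2 * θ) * (M + 1)) + ENNReal.ofReal (1 / α)
        + ENNReal.ofReal (Real.exp (2 * θ)) * ENNReal.ofReal (1 / 1) :=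
        add_le_add (add_le_add h3.le h4) (mul_le_mul_right hneg _)
    _ = _ := by
        rw [← ENNReal.ofReal_mul (Real.exp_pos _).le, ← ENNReal.ofReal_add (by positivity)
          (by positivity), ← ENNReal.ofReal_add (by positivity) (by positivity)]
        congr 1; ring

lemma totalWeight_le (θ : ℝ) (M : ℕ) {α : Fin d₁ → ℝ}
    (hα : ∀ a, 0 < α a ∧ α a ≤ 1) :
    totalWeight d₁ d₂ θ M α ≤ ENNReal.ofReal (Real.exp (θ / M + 1) * 3 ^ d₂
      * ∏ a, (Real.exp (2 * θ) * (M + 2) + 1 / α a)) := by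
  have h1 : ∀ c : (Fin d₁ → ℤ) × (Fin d₂ → ℤ),
      ENNReal.ofReal (Real.exp (logWeight θ M α 0 c)) = ENNReal.ofReal (Real.exp (θ / M + 1))
        * ((∏ a, ENNReal.ofReal (Real.exp (2 * θ * (if c.1 a ≤ M then 1 else 0)
          - 2 * max (-(c.1 a : ℝ)) 0 - α a * c.1 a)))
        * ∏ b, ENNReal.ofReal (Real.exp (-|(c.2 b : ℝ)|))) := by
    intro c
    rw [← ENNReal.ofReal_prod_of_nonneg fun _ _ => (Real.exp_pos _).le,
      ← ENNReal.ofReal_prod_of_nonneg fun _ _ => (Real.exp_pos _).le, ← Real.exp_sum,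
      ← Real.exp_sum, ← ENNReal.ofReal_mul (Real.exp_pos _).le,
      ← ENNReal.ofReal_mul (Real.exp_pos _).le, ← Real.exp_add, ← Real.exp_add]
    congr 2
    simp only [logWeight, shortStep, vertStep, backStep, Finset.sum_sub_distrib,
      Finset.sum_neg_distrib, Finset.mul_sum, Prod.fst_zero, Prod.snd_zero, Pi.zero_apply,
      Int.cast_sum, sub_zero, zero_sub]
    push_cast
    simp only [sub_zero]
    ring
  rw [totalWeight]
  simp only [h1]
  rw [ENNReal.tsum_mul_left, ennreal_tsum_mul_prod
      (fun x : Fin d₁ → ℤ => ∏ a, ENNReal.ofReal (Real.exp (2 * θ * (if x a ≤ M then 1 else 0)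
          - 2 * max (-(x a : ℝ)) 0 - α a * x a)))
      (fun y : Fin d₂ → ℤ => ∏ b, ENNReal.ofReal (Real.exp (-|(y b : ℝ)|))),
    tsum_pi_prod (fun (a : Fin d₁) (k : ℤ) => ENNReal.ofReal
      (Real.exp (2 * θ * (if k ≤ M then 1 else 0) - 2 * max (-(k : ℝ)) 0 - α a * k))),
    tsum_pi_prod (fun (_ : Fin d₂) (k : ℤ) => ENNReal.ofReal (Real.exp (-|(k : ℝ)|)))]
  have h2 : ∏ a : Fin d₁, ∑' k : ℤ, ENNReal.ofReal
      (Real.exp (2 * θ * (if k ≤ M then 1 else 0) - 2 * max (-(k : ℝ)) 0 - α a * k))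
      ≤ ENNReal.ofReal (∏ a, (Real.exp (2 * θ) * (M + 2) + 1 / α a)) := by
    rw [ENNReal.ofReal_prod_of_nonneg fun a _ => by have := (hα a).1; positivity]
    exact Finset.prod_le_prod' fun a _ => tsum_exp_step_le (hα a).1 (hα a).2 M
  have h3 : ∏ _b : Fin d₂, ∑' k : ℤ, ENNReal.ofReal (Real.exp (-|(k : ℝ)|))
      ≤ ENNReal.ofReal (3 ^ d₂) := by
    rw [Finset.prod_const, Finset.card_univ, Fintype.card_fin, ENNReal.ofReal_pow (by norm_num)]
    refine pow_le_pow_left' (tsum_exp_neg_abs_le.trans ?_) _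
    simp
  have h4 : 0 ≤ ∏ a, (Real.exp (2 * θ) * (M + 2) + 1 / α a) :=
    Finset.prod_nonneg fun a _ => by have := (hα a).1; positivity
  calc _ ≤ ENNReal.ofReal (Real.exp (θ / M + 1))
        * (ENNReal.ofReal (∏ a, (Real.exp (2 * θ) * (M + 2) + 1 / α a))
          * ENNReal.ofReal (3 ^ d₂)) := mul_le_mul_right (mul_le_mul' h2 h3) _
    _ = _ := by
        rw [← ENNReal.ofReal_mul h4, ← ENNReal.ofReal_mul (Real.exp_pos _).le]
        congr 1; ring

end Cells

/-! ### The expected weight of the sequences of occupied cells -/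

section Expectation

variable {d d₁ d₂ : ℕ} {Ω : Type*} {ξ : Ω → Set (SemiSpace d₁ d₂)}

/-- The event that the cells of the sequence `v` are distinct and all meet `ξ`. -/
def occupiedEvent (ξ : Ω → Set (SemiSpace d₁ d₂)) (h : Fin d₁ → ℝ) {k : ℕ}
    (v : Fin k → (Fin d₁ → ℤ) × (Fin d₂ → ℤ)) : Set Ω :=
  {ω | Function.Injective v ∧ ∀ i, (ξ ω ∩ cell h (v i)).encard ≠ 0}

/-- The total weight of the sequences of distinct occupied cells. -/
def occupiedWeight (θ : ℝ) (M : ℕ) (α h : Fin d₁ → ℝ) (ξ : Ω → Set (SemiSpace d₁ d₂))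
    (x : (Fin d₁ → ℤ) × (Fin d₂ → ℤ)) (ω : Ω) : ENNReal :=
  ∑' k : ℕ, ∑' v : Fin k → (Fin d₁ → ℤ) × (Fin d₂ → ℤ),
    (occupiedEvent ξ h v).indicator (fun _ => chainWeight θ M α 0 (List.ofFn v) x) ω

/-- The list of zeros is random and depends on the environment; it is handled by summing over all
admissible lists. -/
lemma chainWeight_le_occupiedWeight (θ : ℝ) (M : ℕ) (α h : Fin d₁ → ℝ)
    (x : (Fin d₁ → ℤ) × (Fin d₂ → ℤ)) {ω : Ω} {l : List ((Fin d₁ → ℤ) × (Fin d₂ → ℤ))}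
    (hl : l.Nodup) (hl2 : ∀ c ∈ l, ∃ p ∈ ξ ω, p ∈ cell h c) :
    chainWeight θ M α 0 l x ≤ occupiedWeight θ M α h ξ x ω := by
  have hmem : ω ∈ occupiedEvent ξ h l.get := by
    refine ⟨List.nodup_iff_injective_get.1 hl, fun i => ?_⟩
    obtain ⟨p, hp, hpc⟩ := hl2 (l.get i) (List.get_mem _ _)
    rw [Set.encard_ne_zero]
    exact ⟨p, hp, hpc⟩
  refine le_trans ?_ (ENNReal.le_tsum l.length)
  refine le_trans ?_ (ENNReal.le_tsum l.get)
  rw [Set.indicator_of_mem hmem, List.ofFn_get]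

variable [MeasurableSpace Ω] {P : Measure Ω}

lemma measurableSet_occupiedEvent (hξ : IsPoissonPointProcess ξ (semiIntensity d₁ d₂) P)
    (h : Fin d₁ → ℝ) {k : ℕ} (v : Fin k → (Fin d₁ → ℤ) × (Fin d₂ → ℤ)) :
    MeasurableSet (occupiedEvent ξ h v) := by
  refine (MeasurableSet.const _).inter (s₂ := {ω | ∀ i, (ξ ω ∩ cell h (v i)).encard ≠ 0}) ?_
  rw [Set.ofPred_forall]
  exact MeasurableSet.iInter fun i =>
    hξ.measurable_count _ (measurableSet_cell h (v i)) (measurableSet_singleton 0).compl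

lemma measure_encard_cell_ne_zero_le [IsProbabilityMeasure P]
    (hξ : IsPoissonPointProcess ξ (semiIntensity d₁ d₂) P)
    {h : Fin d₁ → ℝ} (hh : ∀ a, 0 < h a) (c : (Fin d₁ → ℤ) × (Fin d₂ → ℤ)) :
    P {ω | (ξ ω ∩ cell h c).encard ≠ 0} ≤ ENNReal.ofReal (∏ a, h a) := by
  have h0 := measure_encard_cell_eq_zero hξ hh c
  have hm : MeasurableSet {ω | (ξ ω ∩ cell h c).encard = 0} :=
    hξ.measurable_count _ (measurableSet_cell h c) (measurableSet_singleton 0)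
  have h1 : {ω | (ξ ω ∩ cell h c).encard ≠ 0} = {ω | (ξ ω ∩ cell h c).encard = 0}ᶜ := rfl
  rw [h1, prob_compl_eq_one_sub hm, h0, ← ENNReal.ofReal_one,
    ← ENNReal.ofReal_sub _ (Real.exp_pos _).le]
  refine ENNReal.ofReal_le_ofReal ?_
  have := Real.add_one_le_exp (-∏ a, h a)
  linarith

lemma measure_occupiedEvent_le [IsProbabilityMeasure P]
    (hξ : IsPoissonPointProcess ξ (semiIntensity d₁ d₂) P)
    {h : Fin d₁ → ℝ} (hh : ∀ a, 0 < h a) {k : ℕ} (v : Fin k → (Fin d₁ → ℤ) × (Fin d₂ → ℤ)) :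
    P (occupiedEvent ξ h v) ≤ ENNReal.ofReal (∏ a, h a) ^ k := by
  by_cases hv : Function.Injective v
  · have h1 := hξ.indep_count k (fun i => cell h (v i)) (fun i => measurableSet_cell h _)
      (fun i j hij => pairwise_disjoint_cell hh fun hc => hij (hv hc))
    have h2 := h1.measure_inter_preimage_eq_mul Finset.univ (sets := fun _ => {0}ᶜ)
      (fun _ _ => (measurableSet_singleton 0).compl)
    have h3 : occupiedEvent ξ h v
        = ⋂ i ∈ Finset.univ, (fun ω => (ξ ω ∩ cell h (v i)).encard) ⁻¹' {0}ᶜ := by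
      ext ω
      simp [occupiedEvent, hv]
    rw [h3, h2]
    refine (Finset.prod_le_prod' fun i _ => measure_encard_cell_ne_zero_le hξ hh (v i)).trans ?_
    simp
  · have : occupiedEvent ξ h v = ∅ := by
      ext ω; simp [occupiedEvent, hv]
    simp [this]

lemma measurable_occupiedWeight (hξ : IsPoissonPointProcess ξ (semiIntensity d₁ d₂) P)
    (θ : ℝ) (M : ℕ) (α h : Fin d₁ → ℝ) (x : (Fin d₁ → ℤ) × (Fin d₂ → ℤ)) :
    Measurable (occupiedWeight θ M α h ξ x) :=
  Measurable.tsum fun _ => Measurable.tsum fun v =>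
    measurable_const.indicator (measurableSet_occupiedEvent hξ h v)

/-- First moment: sequences of `k` boxes contribute at most the `k`-th power of (volume of a box) ×
(weight of a step), which is at most `1 / 2`, so the series is geometric. -/
lemma lintegral_occupiedWeight_le [IsProbabilityMeasure P]
    (hξ : IsPoissonPointProcess ξ (semiIntensity d₁ d₂) P)
    {h : Fin d₁ → ℝ} (hh : ∀ a, 0 < h a) {θ : ℝ} (hθ : 0 ≤ θ) (M : ℕ) {α : Fin d₁ → ℝ}
    (hα : ∀ a, 0 ≤ α a ∧ α a ≤ 2)
    (hq : ENNReal.ofReal (∏ a, h a) * totalWeight d₁ d₂ θ M α ≤ 2⁻¹)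
    (x : (Fin d₁ → ℤ) × (Fin d₂ → ℤ)) :
    ∫⁻ ω, occupiedWeight θ M α h ξ x ω ∂P
      ≤ 2 * ENNReal.ofReal (Real.exp (2 * θ * d₁ + (θ / M + 1))) := by
  set D := ENNReal.ofReal (Real.exp (2 * θ * d₁ + (θ / M + 1)))
  have hm : ∀ (k : ℕ) (v : Fin k → (Fin d₁ → ℤ) × (Fin d₂ → ℤ)), Measurable
      ((occupiedEvent ξ h v).indicator fun _ : Ω => chainWeight θ M α 0 (List.ofFn v) x) :=
    fun k v => measurable_const.indicator (measurableSet_occupiedEvent hξ h v)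
  unfold occupiedWeight
  rw [lintegral_tsum fun k => (Measurable.tsum fun v => hm k v).aemeasurable]
  calc _ ≤ ∑' k : ℕ, (2⁻¹ : ENNReal) ^ k * D := by
        refine ENNReal.tsum_le_tsum fun k => ?_
        rw [lintegral_tsum fun v => (hm k v).aemeasurable]
        calc _ ≤ ∑' v : Fin k → (Fin d₁ → ℤ) × (Fin d₂ → ℤ),
              chainWeight θ M α 0 (List.ofFn v) x * ENNReal.ofReal (∏ a, h a) ^ k := by
              refine ENNReal.tsum_le_tsum fun v => ?_
              rw [lintegral_indicator_const (measurableSet_occupiedEvent hξ h v)]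
              exact mul_le_mul_right (measure_occupiedEvent_le hξ hh v) _
          _ ≤ (totalWeight d₁ d₂ θ M α ^ k * D) * ENNReal.ofReal (∏ a, h a) ^ k := by
              rw [ENNReal.tsum_mul_right]
              exact mul_le_mul_left (tsum_chainWeight_le hθ M hα k 0 x) _
          _ = (ENNReal.ofReal (∏ a, h a) * totalWeight d₁ d₂ θ M α) ^ k * D := by
              rw [mul_pow]; ring
          _ ≤ _ := mul_le_mul_left (pow_le_pow_left' hq k) _
    _ = 2 * D := by
        rw [ENNReal.tsum_mul_right, ENNReal.tsum_geometric, ENNReal.one_sub_inv_two, inv_inv]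

/-- With drift `A * h a`, the long steps contribute `h a / (A * h a) = 1 / A` whatever `θ` is, while
the short ones vanish with the mesh. This is why `A` can be fixed before `θ` and `M`. The value `32
* 3 ^ d₂` comes from `e² ≤ 8`, the vertical factor `3 ^ d₂`, and one factor `2 / A`. -/
lemma ofReal_prod_mul_totalWeight_le (hd : 1 ≤ d₁) {θ A : ℝ} {M : ℕ} (hM : 1 ≤ M)
    (hθM : θ ≤ M) (hA : A = 32 * 3 ^ d₂) {h : Fin d₁ → ℝ} (hh : ∀ a, 0 < h a)
    (hsmall : ∀ a, h a ≤ 1 / (A * (Real.exp (2 * θ) * (M + 2)))) (hsmall2 : ∀ a, h a ≤ 1 / A) :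
    ENNReal.ofReal (∏ a, h a) * totalWeight d₁ d₂ θ M (fun a => A * h a) ≤ 2⁻¹ := by
  have hA32 : 32 ≤ A := by
    rw [hA]; linarith [one_le_pow₀ (M₀ := ℝ) (a := 3) (by norm_num) (n := d₂)]
  have hA0 : 0 < A := by linarith
  have hM0 : (0 : ℝ) < M := by exact_mod_cast hM
  have hα : ∀ a, 0 < A * h a ∧ A * h a ≤ 1 := fun a =>
    ⟨mul_pos hA0 (hh a), by
      have := mul_le_mul_of_nonneg_left (hsmall2 a) hA0.le
      rwa [mul_one_div_cancel hA0.ne'] at this⟩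
  refine (mul_le_mul_right (totalWeight_le θ M hα) _).trans ?_
  have hp0 : 0 ≤ ∏ a, h a := Finset.prod_nonneg fun a _ => (hh a).le
  rw [← ENNReal.ofReal_mul hp0]
  have hhalf : (2⁻¹ : ENNReal) = ENNReal.ofReal (1 / 2) := by
    rw [one_div, ENNReal.ofReal_inv_of_pos (by norm_num)]; norm_num
  rw [hhalf]
  refine ENNReal.ofReal_le_ofReal ?_
  have hE : 0 < Real.exp (2 * θ) * (M + 2) := by positivity
  have hfac : ∀ a, 0 ≤ h a * (Real.exp (2 * θ) * (M + 2) + 1 / (A * h a))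
      ∧ h a * (Real.exp (2 * θ) * (M + 2) + 1 / (A * h a)) ≤ 2 / A := by
    intro a
    have h1 : h a * (1 / (A * h a)) = 1 / A := by
      have := (hh a).ne'
      field_simp
    have h2 : h a * (Real.exp (2 * θ) * (M + 2)) ≤ 1 / A := by
      have := mul_le_mul_of_nonneg_right (hsmall a) hE.le
      refine this.trans (le_of_eq ?_)
      field_simp
    have h3 : 0 ≤ h a * (Real.exp (2 * θ) * (M + 2)) := mul_nonneg (hh a).le hE.le
    rw [mul_add, h1]
    have h4 : 0 ≤ 1 / A := by positivity
    refine ⟨by linarith, ?_⟩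
    have : 2 / A = 1 / A + 1 / A := by ring
    linarith
  have hprod : (∏ a, h a) * ∏ a, (Real.exp (2 * θ) * (M + 2) + 1 / (A * h a)) ≤ 2 / A := by
    rw [← Finset.prod_mul_distrib]
    let a₀ : Fin d₁ := ⟨0, hd⟩
    have h1 : 2 / A ≤ 1 := by rw [div_le_one hA0]; linarith
    rw [← Finset.mul_prod_erase _ _ (Finset.mem_univ a₀)]
    have h2 : ∏ a ∈ Finset.univ.erase a₀,
        h a * (Real.exp (2 * θ) * (M + 2) + 1 / (A * h a)) ≤ 1 :=
      Finset.prod_le_one (fun a _ => (hfac a).1) fun a _ => (hfac a).2.trans h1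
    calc _ ≤ 2 / A * 1 :=
          mul_le_mul (hfac a₀).2 h2 (Finset.prod_nonneg fun a _ => (hfac a).1) (by positivity)
      _ = 2 / A := mul_one _
  have hexp : Real.exp (θ / M + 1) ≤ 8 := by
    have h1 : θ / M ≤ 1 := by rw [div_le_one hM0]; exact hθM
    have h2 : Real.exp (θ / M + 1) ≤ Real.exp (1 + 1) := Real.exp_le_exp.2 (by linarith)
    have h3 : Real.exp (1 + 1) = Real.exp 1 * Real.exp 1 := Real.exp_add 1 1
    have h4 : Real.exp 1 ≤ 2.72 := by linarith [Real.exp_one_lt_d9]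
    have h5 : Real.exp 1 * Real.exp 1 ≤ 2.72 * 2.72 :=
      mul_le_mul h4 h4 (Real.exp_pos 1).le (by norm_num)
    exact h2.trans (h3.le.trans (h5.trans (by norm_num)))
  calc (∏ a, h a) * (Real.exp (θ / M + 1) * 3 ^ d₂
        * ∏ a, (Real.exp (2 * θ) * (M + 2) + 1 / (A * h a)))
      = Real.exp (θ / M + 1) * 3 ^ d₂
        * ((∏ a, h a) * ∏ a, (Real.exp (2 * θ) * (M + 2) + 1 / (A * h a))) := by ring
    _ ≤ 8 * 3 ^ d₂ * (2 / A) := by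
        refine mul_le_mul (mul_le_mul_of_nonneg_right hexp (by positivity)) hprod ?_
          (by positivity)
        rw [← Finset.prod_mul_distrib]
        exact Finset.prod_nonneg fun a _ => (hfac a).1
    _ = 1 / 2 := by rw [hA]; field_simp; norm_num

/-! ### Upper bound for the expected gain -/

/-- The order of the quantifiers matters: `A` precedes `θ`, so the linear error `A t / θ` is as
small as desired. The second, cruder bound does not involve the score and gives boundedness before
the score is known to be integrable. -/
theorem exists_upper_bound (d₁ d₂ : ℕ) (hd : 1 ≤ d₁) : ∃ A : ℝ, 0 < A ∧
    ∀ (θ : ℝ) (M : ℕ), 0 < θ → 1 ≤ M → θ ≤ M → ∃ h₀ > (0 : ℝ), ∃ D : ℝ, 0 ≤ D ∧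
      ∀ (d : ℕ) (f : Frame d d₁ d₂) {Ω : Type*} [MeasurableSpace Ω] (P : Measure Ω)
        [IsProbabilityMeasure P] (ξ : Ω → Set (SemiSpace d₁ d₂)),
        IsPoissonPointProcess ξ (semiIntensity d₁ d₂) P →
        ∀ (h : Fin d₁ → ℝ) (ε : unitInterval) (y : Fin d → ℤ) (t : ℝ),
          (∀ a, 0 < h a ∧ h a ≤ h₀) → Real.exp (-∏ a, h a) = 1 - ε →
          (∀ a, 0 < (f.coord y).1 a) → (f.coord y).2 = 0 → 0 ≤ t →
          (∀ a, h a * (f.coord y).1 a ≤ t) →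
          ENNReal.ofReal (l1 y - meanTime d ε 0 y)
              ≤ (∫⁻ ω, score (ξ ω) (fun _ => t) ∂P) + ENNReal.ofReal ((A * t + D) / θ) ∧
            ENNReal.ofReal (l1 y - meanTime d ε 0 y)
              ≤ ENNReal.ofReal (M * ((A * t + D) / θ)) := by
  set A₀ : ℝ := 32 * 3 ^ d₂ with hA₀
  have hA₀0 : 0 < A₀ := by positivity
  refine ⟨A₀ * d₁, mul_pos hA₀0 (by exact_mod_cast hd), fun θ M hθ hM hθM => ?_⟩
  have hM0 : (0 : ℝ) < M := by exact_mod_cast hM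
  refine ⟨min (1 / (A₀ * (Real.exp (2 * θ) * (M + 2)))) (1 / A₀), by positivity,
    2 * Real.exp (2 * θ * d₁ + (θ / M + 1)), by positivity, ?_⟩
  intro d f Ω _ P _ ξ hξ h ε y t hh hε hX hy2 ht0 ht
  have hh0 : ∀ a, 0 < h a := fun a => (hh a).1
  have hq := ofReal_prod_mul_totalWeight_le (d₂ := d₂) hd hM hθM hA₀ hh0
    (fun a => (hh a).2.trans (min_le_left _ _)) (fun a => (hh a).2.trans (min_le_right _ _))
  set α : Fin d₁ → ℝ := fun a => A₀ * h a with hα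
  have hα2 : ∀ a, 0 ≤ α a ∧ α a ≤ 2 := fun a => by
    refine ⟨(mul_pos hA₀0 (hh0 a)).le, ?_⟩
    have := mul_le_mul_of_nonneg_left ((hh a).2.trans (min_le_right _ _)) hA₀0.le
    rw [mul_one_div_cancel hA₀0.ne'] at this
    simp only [hα]
    linarith
  set X := (f.coord y).1 with hXdef
  have hy : f.coord y = (X, 0) := Prod.ext rfl hy2
  have hY := lintegral_occupiedWeight_le hξ hh0 hθ.le M hα2 hq (X, 0)
  have hYm := measurable_occupiedWeight hξ θ M α h (X, 0)
  set Y := occupiedWeight θ M α h ξ (X, 0) with hYdef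
  have hsumX : ∑ a, α a * (X a : ℝ) ≤ A₀ * d₁ * t := by
    have : ∀ a ∈ Finset.univ, α a * (X a : ℝ) ≤ A₀ * t := fun a _ => by
      simp only [hα]
      rw [mul_assoc]
      exact mul_le_mul_of_nonneg_left (ht a) hA₀0.le
    refine (Finset.sum_le_sum this).trans (le_of_eq ?_)
    simp; ring
  have hpt : ∀ ω, ENNReal.ofReal (f.gain h (ξ ω) y) ≤ score (ξ ω) (fun _ => t)
        + (ENNReal.ofReal (A₀ * d₁ * t / θ) + ENNReal.ofReal (1 / θ) * Y ω) ∧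
      ENNReal.ofReal (f.gain h (ξ ω) y)
        ≤ ENNReal.ofReal M * (ENNReal.ofReal (A₀ * d₁ * t / θ) + ENNReal.ofReal (1 / θ) * Y ω) := by
    intro ω
    obtain ⟨l, hnd, hocc, hVB, hlen, hscore⟩ :=
      f.exists_list_of_gain hh0 (ξ ω) hy hX ht hM
    have hw := chainWeight_le_occupiedWeight (ξ := ξ) θ M α h (X, 0) hnd hocc
    have hlog := chainCost_logWeight θ M α (0 : (Fin d₁ → ℤ) × (Fin d₂ → ℤ)) (X, 0) l
    have hT := chainCost_nonneg (shortStep_nonneg (M : ℤ))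
      (0 : (Fin d₁ → ℤ) × (Fin d₂ → ℤ)) l (X, 0)
    set T := chainCost (shortStep (M : ℤ)) 0 l (X, 0)
    set V := chainCost vertStep 0 l (X, 0)
    set B := chainCost backStep 0 l (X, 0)
    set Ψ := chainCost (logWeight θ M α) 0 l (X, 0) with hΨ
    have hVB' : (V : ℝ) + 2 * B ≤ l.length := mod_cast hVB
    have hT' : (0 : ℝ) ≤ T := mod_cast hT
    -- The crude `Ψ ≤ exp Ψ` suffices, as a bounded expectation is negligible against `t`.
    have hΨY : ENNReal.ofReal Ψ ≤ Y ω := by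
      refine le_trans (ENNReal.ofReal_le_ofReal ?_) hw
      linarith [Real.add_one_le_exp Ψ]
    have hmain : θ * (2 * T + l.length / M) ≤ A₀ * d₁ * t + Ψ := by
      have h1 : (∑ a, α a * ((((X, 0) : (Fin d₁ → ℤ) × (Fin d₂ → ℤ)).1 a : ℝ)
          - ((0 : (Fin d₁ → ℤ) × (Fin d₂ → ℤ)).1 a : ℤ))) = ∑ a, α a * (X a : ℝ) := by
        simp
      rw [h1] at hlog
      have h2 : (0 : ℝ) < θ / M := div_pos hθ hM0
      have h3 : θ * ((l.length : ℝ) / M) = l.length * (θ / M) := by ring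
      rw [mul_add, h3]
      linarith
    have hdel : ENNReal.ofReal (2 * T + (l.length : ℝ) / M)
        ≤ ENNReal.ofReal (A₀ * d₁ * t / θ) + ENNReal.ofReal (1 / θ) * Y ω := by
      calc ENNReal.ofReal (2 * T + (l.length : ℝ) / M)
          ≤ ENNReal.ofReal (A₀ * d₁ * t / θ + 1 / θ * Ψ) := by
            refine ENNReal.ofReal_le_ofReal ?_
            have : A₀ * d₁ * t / θ + 1 / θ * Ψ = (A₀ * d₁ * t + Ψ) / θ := by ring
            rw [this, le_div_iff₀ hθ, mul_comm]
            exact hmain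
        _ ≤ _ := by
            refine ENNReal.ofReal_add_le.trans (add_le_add_right ?_ _)
            rw [ENNReal.ofReal_mul (by positivity)]
            exact mul_le_mul_right hΨY _
    refine ⟨hscore.trans (add_le_add_right hdel _), ?_⟩
    refine le_trans ?_ (mul_le_mul_right hdel _)
    rw [← ENNReal.ofReal_mul hM0.le]
    refine ENNReal.ofReal_le_ofReal (hlen.trans ?_)
    have h3 : (M : ℝ) * ((l.length : ℝ) / M) = l.length := mul_div_cancel₀ _ hM0.ne'
    rw [mul_add, h3]
    have := mul_nonneg hM0.le (by linarith : (0 : ℝ) ≤ 2 * T)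
    linarith
  have hgm : Measurable fun ω => ENNReal.ofReal (A₀ * d₁ * t / θ) + ENNReal.ofReal (1 / θ) * Y ω :=
    measurable_const.add (measurable_const.mul hYm)
  have hE : ∫⁻ ω, (ENNReal.ofReal (A₀ * d₁ * t / θ) + ENNReal.ofReal (1 / θ) * Y ω) ∂P
      ≤ ENNReal.ofReal ((A₀ * d₁ * t + 2 * Real.exp (2 * θ * d₁ + (θ / M + 1))) / θ) := by
    rw [lintegral_add_left measurable_const, lintegral_const_mul _ hYm, lintegral_const,
      measure_univ, mul_one]
    refine (add_le_add_right (mul_le_mul_right hY _) _).trans (le_of_eq ?_)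
    rw [add_div, ENNReal.ofReal_add (by positivity) (by positivity)]
    congr 1
    rw [div_eq_mul_one_div (2 * Real.exp _) θ, mul_comm (2 * Real.exp _) (1 / θ),
      ENNReal.ofReal_mul (by positivity), ENNReal.ofReal_mul (by norm_num)]
    norm_num
  rw [← lintegral_gain f hξ hh0 hε y]
  constructor
  · refine (lintegral_mono fun ω => (hpt ω).1).trans ?_
    rw [lintegral_add_right _ hgm]
    exact add_le_add_right hE _
  · refine (lintegral_mono fun ω => (hpt ω).2).trans ?_
    rw [lintegral_const_mul _ hgm, ENNReal.ofReal_mul hM0.le]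
    exact mul_le_mul_right hE _

/-! ### Linear lower bound for the score -/

/-- The unit boxes along the diagonal at height `0` form a strictly increasing chain without
vertical cost, and each is occupied with probability `1 - e⁻¹`. -/
theorem le_lintegral_score [IsProbabilityMeasure P]
    (hξ : IsPoissonPointProcess ξ (semiIntensity d₁ d₂) P) (n : ℕ) (hn : 0 < n) {t : ℝ}
    (ht : (n : ℝ) ≤ t) :
    ENNReal.ofReal (n * (1 - Real.exp (-1))) ≤ ∫⁻ ω, score (ξ ω) (fun _ => t) ∂P := by
  classical
  let h : Fin d₁ → ℝ := fun _ => 1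
  have hh : ∀ a, 0 < h a := fun _ => one_pos
  let c : ℕ → (Fin d₁ → ℤ) × (Fin d₂ → ℤ) := fun i => (fun _ => (i : ℤ), 0)
  let E : ℕ → Set Ω := fun i => {ω | (ξ ω ∩ cell h (c i)).encard ≠ 0}
  have hEm : ∀ i, MeasurableSet (E i) := fun i =>
    hξ.measurable_count _ (measurableSet_cell h (c i)) (measurableSet_singleton 0).compl
  have hPE : ∀ i, P (E i) = ENNReal.ofReal (1 - Real.exp (-1)) := by
    intro i
    have h0 := measure_encard_cell_eq_zero hξ hh (c i)
    have hm : MeasurableSet {ω | (ξ ω ∩ cell h (c i)).encard = 0} :=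
      hξ.measurable_count _ (measurableSet_cell h (c i)) (measurableSet_singleton 0)
    have h1 : E i = {ω | (ξ ω ∩ cell h (c i)).encard = 0}ᶜ := rfl
    rw [h1, prob_compl_eq_one_sub hm, h0, ENNReal.ofReal_sub _ (Real.exp_pos _).le]
    simp [h]
  have hpt : ∀ ω, ∑ i ∈ Finset.range n, (E i).indicator (fun _ => (1 : ENNReal)) ω
      ≤ score (ξ ω) (fun _ => t) := by
    intro ω
    have key : ∀ m k : ℕ, m + k = n → 0 < n → ∃ K : List ((Fin d₁ → ℤ) × (Fin d₂ → ℤ)),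
        (∀ c ∈ K, (ξ ω ∩ cell h c).encard ≠ 0) ∧
        (K.length : ENNReal) = ∑ i ∈ Finset.range k,
          (E (m + i)).indicator (fun _ => (1 : ENNReal)) ω ∧
        ∀ j : ℤ, j < m → chainAll (fun c c' : (Fin d₁ → ℤ) × (Fin d₂ → ℤ) =>
            ∀ a, c.1 a < c'.1 a) (fun _ => j, 0) K (fun _ => (n : ℤ), 0) ∧
          chainCost vertStep ((fun _ => j, 0) : (Fin d₁ → ℤ) × (Fin d₂ → ℤ)) K
            (fun _ => (n : ℤ), 0) = 0 := by
      intro m k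
      induction k generalizing m with
      | zero =>
        intro hm _
        refine ⟨[], by simp, by simp, fun j hj => ⟨fun a => ?_, by simp [chainCost, vertStep]⟩⟩
        change j < (n : ℤ)
        omega
      | succ k ih =>
        intro hm hn
        obtain ⟨K, hK1, hK2, hK3⟩ := ih (m + 1) (by omega) hn
        have hsum : ∑ i ∈ Finset.range (k + 1), (E (m + i)).indicator (fun _ => (1 : ENNReal)) ω
            = (K.length : ENNReal) + (E m).indicator (fun _ => (1 : ENNReal)) ω := by
          rw [Finset.sum_range_succ', hK2, add_zero]
          congr 1
          exact Finset.sum_congr rfl fun i _ => by rw [add_assoc, add_comm 1 i]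
        by_cases hmE : ω ∈ E m
        · refine ⟨c m :: K, ?_, ?_, fun j hj => ⟨⟨fun a => hj, (hK3 m (by push_cast; omega)).1⟩,
          ?_⟩⟩
          · intro c' hc'
            rcases List.mem_cons.1 hc' with rfl | hc'
            · exact hmE
            · exact hK1 c' hc'
          · rw [hsum, Set.indicator_of_mem hmE]; simp
          · rw [chainCost, (hK3 m (by push_cast; omega)).2]
            simp [vertStep, c]
        · refine ⟨K, hK1, ?_, fun j hj => hK3 j (by push_cast; omega)⟩
          rw [hsum, Set.indicator_of_notMem hmE, add_zero]
    obtain ⟨K, hK1, hK2, hK3⟩ := key 0 n (by omega) hn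
    -- Starting just below `0` lets the box of index `0` be the first of the chain.
    have h3 := hK3 (-1) (by simp)
    have h4 := le_score_of_chainAll (S := ξ ω) (x := fun _ => t) hh (fun a => by simpa [h] using ht)
      (fun c hc => by
        obtain ⟨p, hp⟩ := Set.encard_ne_zero.1 (hK1 c hc)
        exact ⟨p, hp.1, hp.2⟩) (fun a => Or.inr rfl) h3.1
    rw [h3.2] at h4
    simp only [zero_add] at hK2
    rw [← hK2]
    simpa using h4
  refine le_trans (le_of_eq ?_) (lintegral_mono hpt)
  rw [lintegral_finsetSum _ fun i _ => measurable_const.indicator (hEm i)]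
  simp only [lintegral_indicator_const (hEm _), hPE, one_mul, Finset.sum_const, Finset.card_range]
  rw [ENNReal.ofReal_mul (by positivity), ENNReal.ofReal_natCast, nsmul_eq_mul]

end Expectation

/-! ### Two-scale comparison -/

/-- If `ψ` is asymptotically squeezed between the large-time ratios `f t / t` and conversely,
then both converge to the same limit. -/
lemma exists_tendsto_of_comparison {α : Type*} {l : Filter α} [l.NeBot] {f : ℝ → ℝ} {ψ : α → ℝ}
    {A K : ℝ} (hK : 0 ≤ K) (hA : ∀ᶠ ε in l, ψ ε ∈ Set.Icc 0 A)
    (hU : ∀ η > 0, ∀ᶠ ε in l, ∀ᶠ t in atTop, ψ ε ≤ f t / t + η)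
    (hL : ∀ L > 0, ∀ η > 0, ∀ᶠ ε in l, f L ≤ K + L * (ψ ε + η)) :
    ∃ C, Tendsto (fun t => f t / t) atTop (𝓝 C) ∧ Tendsto ψ l (𝓝 C) := by
  -- A cluster value `C` of `ψ` exists by compactness. One well-chosen `ε` bounds `f t / t` from
  -- below for all large `t`, and for each `t` some `ε` bounds it from above, so `f t / t → C`.
  -- Convergence of `ψ` along all of `l` is then deduced from that of `f t / t`.
  let u : Ultrafilter α := Ultrafilter.of l
  have hu : (u : Filter α) ≤ l := Ultrafilter.of_le l
  obtain ⟨C, -, hC⟩ := (isCompact_Icc (a := (0 : ℝ)) (b := A)).ultrafilter_le_nhds (u.map ψ)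
    (le_principal_iff.2 (mem_map.2 (hu hA)))
  have hψ : Tendsto ψ u (𝓝 C) := hC
  have hKt : Tendsto (fun t : ℝ => K / t) atTop (𝓝 0) := tendsto_const_nhds.div_atTop tendsto_id
  have hf : Tendsto (fun t => f t / t) atTop (𝓝 C) := by
    rw [tendsto_order]
    constructor
    · intro a ha
      obtain ⟨ε, h1, h2⟩ := (((hψ.eventually_const_lt (show C - (C - a) / 2 < C by linarith))).and
        (hu (hU ((C - a) / 4) (by linarith)))).exists
      filter_upwards [h2] with t ht
      linarith
    · intro a ha
      filter_upwards [eventually_gt_atTop 0,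
        hKt.eventually_lt_const (show (0 : ℝ) < (a - C) / 4 by linarith)] with t ht0 htK
      obtain ⟨ε, h1, h2⟩ := ((hψ.eventually_lt_const (show C < C + (a - C) / 4 by linarith)).and
        (hu (hL t ht0 ((a - C) / 4) (by linarith)))).exists
      rw [div_lt_iff₀ ht0] at htK ⊢
      nlinarith
  refine ⟨C, hf, ?_⟩
  rw [tendsto_order]
  constructor
  · intro a ha
    obtain ⟨t, ⟨ht0, htK⟩, ht⟩ := (((eventually_gt_atTop (0 : ℝ)).and
      (hKt.eventually_lt_const (show (0 : ℝ) < (C - a) / 4 by linarith))).and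
      (hf.eventually_const_lt (show C - (C - a) / 4 < C by linarith))).exists
    filter_upwards [hL t ht0 ((C - a) / 4) (by linarith)] with ε hε
    rw [div_lt_iff₀ ht0] at htK
    rw [lt_div_iff₀ ht0] at ht
    by_contra! h
    nlinarith
  · intro a ha
    filter_upwards [hU ((a - C) / 4) (by linarith)] with ε hε
    obtain ⟨t, h1, h2⟩ := (hε.and
      (hf.eventually_lt_const (show C < C + (a - C) / 4 by linarith))).exists
    linarith

/-! ### The lattice scale -/

/-- The mesh for which a cell of `ℝ^{d₁}` is hit with probability `ε`. -/
def meshSize (d₁ : ℕ) (ε : unitInterval) : ℝ := (-Real.log (1 - ε)) ^ (1 / (d₁ : ℝ))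

instance : (𝓝[>] (0 : unitInterval)).NeBot :=
  nhdsGT_neBot_of_exists_gt ⟨1, zero_lt_one⟩

lemma tendsto_coe_nhdsGT_zero :
    Tendsto (fun ε : unitInterval => (ε : ℝ)) (𝓝[>] 0) (𝓝[>] 0) := by
  refine tendsto_nhdsWithin_iff.2 ⟨?_, ?_⟩
  · exact (continuous_subtype_val.tendsto' (0 : unitInterval) 0 rfl).mono_left nhdsWithin_le_nhds
  · filter_upwards [self_mem_nhdsWithin] with ε hε
    exact hε

lemma eventually_coe_mem_Ioo :
    ∀ᶠ ε : unitInterval in 𝓝[>] 0, (0 : ℝ) < ε ∧ (ε : ℝ) < 1 :=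
  tendsto_coe_nhdsGT_zero.eventually
    ((eventually_mem_nhdsWithin).and (eventually_nhdsWithin_of_eventually_nhds
      (eventually_lt_nhds zero_lt_one)))

lemma tendsto_neg_log_one_sub_div :
    Tendsto (fun x : ℝ => -Real.log (1 - x) / x) (𝓝[>] 0) (𝓝 1) := by
  have h : HasDerivAt (fun x : ℝ => -Real.log (1 - x)) 1 0 := by
    have h1 : HasDerivAt (fun x : ℝ => 1 - x) (-1) 0 := by
      simpa using (hasDerivAt_id (0 : ℝ)).const_sub 1
    have h2 := (h1.log (by norm_num)).neg
    norm_num at h2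
    exact h2
  have h2 := h.tendsto_slope.mono_left
    (nhdsWithin_mono 0 fun x (hx : x ∈ Set.Ioi 0) => (ne_of_gt hx : x ≠ 0))
  refine h2.congr fun x => ?_
  simp [slope_def_field]

lemma neg_log_one_sub_pos {ε : unitInterval} (h0 : (0 : ℝ) < ε) (h1 : (ε : ℝ) < 1) :
    0 < -Real.log (1 - ε) :=
  neg_pos.2 (Real.log_neg (by linarith) (by linarith))

lemma meshSize_pos (d₁ : ℕ) {ε : unitInterval} (h0 : (0 : ℝ) < ε) (h1 : (ε : ℝ) < 1) :
    0 < meshSize d₁ ε :=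
  Real.rpow_pos_of_pos (neg_log_one_sub_pos h0 h1) _

lemma meshSize_pow {d₁ : ℕ} (hd : 1 ≤ d₁) {ε : unitInterval} (h0 : (0 : ℝ) < ε)
    (h1 : (ε : ℝ) < 1) : meshSize d₁ ε ^ d₁ = -Real.log (1 - ε) := by
  rw [meshSize, one_div, Real.rpow_inv_natCast_pow (neg_log_one_sub_pos h0 h1).le (by omega)]

lemma tendsto_meshSize_div (d₁ : ℕ) :
    Tendsto (fun ε : unitInterval => meshSize d₁ ε / (ε : ℝ) ^ (1 / (d₁ : ℝ))) (𝓝[>] 0)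
      (𝓝 1) := by
  have h := (tendsto_neg_log_one_sub_div.comp tendsto_coe_nhdsGT_zero).rpow_const
    (p := 1 / (d₁ : ℝ)) (Or.inl one_ne_zero)
  rw [Real.one_rpow] at h
  refine h.congr' ?_
  filter_upwards [eventually_coe_mem_Ioo] with ε hε
  exact Real.div_rpow (neg_log_one_sub_pos hε.1 hε.2).le hε.1.le _

lemma tendsto_meshSize {d₁ : ℕ} (hd : 1 ≤ d₁) : Tendsto (meshSize d₁) (𝓝[>] 0) (𝓝 0) := by
  have hp : 0 < 1 / (d₁ : ℝ) := by positivity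
  have h := (tendsto_meshSize_div d₁).mul
    ((tendsto_coe_nhdsGT_zero.mono_right nhdsWithin_le_nhds).rpow_const
      (p := 1 / (d₁ : ℝ)) (Or.inr hp.le))
  rw [Real.zero_rpow hp.ne', mul_zero] at h
  refine h.congr' ?_
  filter_upwards [eventually_coe_mem_Ioo] with ε hε
  exact div_mul_cancel₀ _ (Real.rpow_pos_of_pos hε.1 _).ne'

/-! ### Frames adapted to a direction -/

namespace Frame

variable {d d₁ d₂ : ℕ}

/-- The nonzero coordinates of `z` are the first ones of the frame, with the signs of the
frame. -/
structure Adapted (f : Frame d d₁ d₂) (z : Fin d → ℝ) : Prop where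
  pos : ∀ a, 0 < (f.σ a : ℝ) * z (f.e (.inl a))
  zero : ∀ b, z (f.e (.inr b)) = 0

variable {f : Frame d d₁ d₂} {z : Fin d → ℝ}

namespace Adapted

lemma abs_eq (hf : f.Adapted z) (a : Fin d₁) :
    |z (f.e (.inl a))| = (f.σ a : ℝ) * z (f.e (.inl a)) := by
  rw [← abs_of_pos (hf.pos a), abs_mul, ← Int.cast_abs, f.abs_σ, Int.cast_one, one_mul]

lemma ne_zero (hf : f.Adapted z) (a : Fin d₁) : z (f.e (.inl a)) ≠ 0 := fun h => by
  simpa [h] using hf.pos a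

lemma numNonzero_eq (hf : f.Adapted z) : numNonzero z = d₁ := by
  rw [numNonzero, Finset.card_filter, ← f.e.sum_comp, Fintype.sum_sum_type]
  simp [hf.ne_zero, hf.zero]

lemma geomMean_eq (hf : f.Adapted z) :
    geomMean z = ∏ a, |z (f.e (.inl a))| ^ (1 / (d₁ : ℝ)) := by
  rw [geomMean, hf.numNonzero_eq, Finset.prod_filter, ← f.e.prod_comp, Fintype.prod_sum_type]
  simp [hf.ne_zero, hf.zero]

lemma geomMean_pos (hf : f.Adapted z) : 0 < geomMean z := by
  rw [hf.geomMean_eq]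
  exact Finset.prod_pos fun a _ => Real.rpow_pos_of_pos (abs_pos.2 (hf.ne_zero a)) _

lemma geomMean_pow (hf : f.Adapted z) (hd : 1 ≤ d₁) :
    geomMean z ^ d₁ = ∏ a, |z (f.e (.inl a))| := by
  rw [hf.geomMean_eq, ← Finset.prod_pow]
  refine Finset.prod_congr rfl fun a _ => ?_
  rw [one_div, Real.rpow_inv_natCast_pow (abs_nonneg _) (by omega)]

lemma coord_floorPoint_snd (hf : f.Adapted z) (n : ℕ) : (f.coord (floorPoint z n)).2 = 0 := by
  funext b
  simp [coord, floorPoint, hf.zero]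

lemma abs_coord_floorPoint_sub_le (hf : f.Adapted z) (n : ℕ) (a : Fin d₁) :
    |((f.coord (floorPoint z n)).1 a : ℝ) - (n * |z (f.e (.inl a))|)| ≤ 1 := by
  have h : ((f.coord (floorPoint z n)).1 a : ℝ) - n * |z (f.e (.inl a))|
      = (f.σ a : ℝ) * -Int.fract (n * z (f.e (.inl a))) := by
    rw [hf.abs_eq, Int.fract]
    simp only [coord, floorPoint, Int.cast_mul]
    ring
  rw [h, abs_mul, ← Int.cast_abs, f.abs_σ, Int.cast_one, one_mul, abs_neg, Int.abs_fract]
  exact (Int.fract_lt_one _).le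

end Adapted

end Frame

lemma abs_l1_floorPoint_sub_le {d : ℕ} (z : Fin d → ℝ) (n : ℕ) :
    |(l1 (floorPoint z n) : ℝ) - (n * ∑ i, |z i|)| ≤ d := by
  have h : (l1 (floorPoint z n) : ℝ) = ∑ i, |(⌊(n : ℝ) * z i⌋ : ℝ)| := by
    rw [← Int.cast_natCast, l1_cast]
    simp [floorPoint]
  rw [h, Finset.mul_sum, ← Finset.sum_sub_distrib]
  calc _ ≤ ∑ i : Fin d, |(|(⌊(n : ℝ) * z i⌋ : ℝ)| - n * |z i|)| := Finset.abs_sum_le_sum_abs _ _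
    _ ≤ ∑ _i : Fin d, (1 : ℝ) := by
        refine Finset.sum_le_sum fun i _ => ?_
        have h1 : (n : ℝ) * |z i| = |(n : ℝ) * z i| := by
          rw [abs_mul, Nat.abs_cast]
        rw [h1]
        refine (abs_abs_sub_abs_le _ _).trans ?_
        rw [abs_sub_comm]
        change |Int.fract ((n : ℝ) * z i)| ≤ 1
        rw [Int.abs_fract]
        exact (Int.fract_lt_one _).le
    _ = d := by simp

/-! ### The expected gain along a direction -/

/-- The mean saving with respect to the `ℓ¹` distance for the `n`-th point in direction `z`. -/
def meanGain {d : ℕ} (ε : unitInterval) (z : Fin d → ℝ) (n : ℕ) : ℝ :=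
  l1 (floorPoint z n) - meanTime d ε 0 (floorPoint z n)

section MeanGain

variable {d : ℕ} (ε : unitInterval) (z : Fin d → ℝ)

lemma meanGain_nonneg (n : ℕ) : 0 ≤ meanGain ε z n := by
  have := meanTime_le_l1 d ε 0 (floorPoint z n)
  rw [sub_zero] at this
  exact sub_nonneg.2 this

lemma tendsto_meanGain_div :
    Tendsto (fun n => meanGain ε z n / n) atTop (𝓝 ((∑ i, |z i|) - timeConstant d ε z)) := by
  have h1 : Tendsto (fun n : ℕ => (l1 (floorPoint z n) : ℝ) / n) atTop (𝓝 (∑ i, |z i|)) := by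
    have h0 : Tendsto (fun n : ℕ => (d : ℝ) / n) atTop (𝓝 0) :=
      tendsto_const_div_atTop_nhds_zero_nat _
    rw [tendsto_iff_norm_sub_tendsto_zero]
    refine squeeze_zero' (Eventually.of_forall fun _ => norm_nonneg _) ?_ h0
    filter_upwards [eventually_gt_atTop 0] with n hn
    have hn' : (0 : ℝ) < n := Nat.cast_pos.2 hn
    have h2 : (l1 (floorPoint z n) : ℝ) / n - ∑ i, |z i|
        = ((l1 (floorPoint z n) : ℝ) - n * ∑ i, |z i|) / n := by field_simp
    rw [h2, Real.norm_eq_abs, abs_div, abs_of_pos hn']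
    exact div_le_div_of_nonneg_right (abs_l1_floorPoint_sub_le z n) hn'.le
  refine (h1.sub (tendsto_meanPassageTime d ε z).1).congr fun n => ?_
  rw [meanPassageTime_eq, meanGain, sub_div]

lemma timeConstant_le_sum_abs : timeConstant d ε z ≤ ∑ i, |z i| := by
  refine sub_nonneg.1 (ge_of_tendsto' (tendsto_meanGain_div ε z) fun n => ?_)
  exact div_nonneg (meanGain_nonneg ε z n) n.cast_nonneg

/-- One `d` comes from rounding `n z`, the other from the correction in Fekete's lemma. -/
lemma meanGain_le (n : ℕ) :
    meanGain ε z n ≤ 2 * d + n * ((∑ i, |z i|) - timeConstant d ε z) := by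
  have h1 := (abs_le.1 (abs_l1_floorPoint_sub_le z n)).2
  have h2 : (n : ℝ) * timeConstant d ε z ≤ meanTime d ε 0 (floorPoint z n) + d := by
    rcases eq_or_ne n 0 with rfl | hn
    · have := meanTime_nonneg d ε 0 (floorPoint z 0)
      simp only [Nat.cast_zero, zero_mul]
      positivity
    · have := (tendsto_meanPassageTime d ε z).2 n hn
      rwa [le_div_iff₀' (by positivity)] at this
  rw [meanGain]
  linarith

/-- The gain read at the macroscopic time `t` in units `κ`, with a bounded shift `ρ`. -/
lemma tendsto_meanGain_floor_div {κ : ℝ} (hκ : 0 < κ) (ρ : ℝ) :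
    Tendsto (fun t : ℝ => meanGain ε z ⌊t / κ - ρ⌋₊ / t) atTop
      (𝓝 (((∑ i, |z i|) - timeConstant d ε z) / κ)) := by
  have h0 : Tendsto (fun t : ℝ => t / κ - ρ) atTop atTop :=
    tendsto_atTop_add_const_right _ _ (tendsto_id.atTop_div_const hκ)
  have h1 := (tendsto_meanGain_div ε z).comp (tendsto_nat_floor_atTop.comp h0)
  have h2 := (tendsto_nat_floor_div_atTop (R := ℝ)).comp h0
  have h3 : Tendsto (fun t : ℝ => (t / κ - ρ) / t) atTop (𝓝 (1 / κ)) := by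
    have : Tendsto (fun t : ℝ => 1 / κ - ρ / t) atTop (𝓝 (1 / κ - 0)) :=
      tendsto_const_nhds.sub (tendsto_const_nhds.div_atTop tendsto_id)
    rw [sub_zero] at this
    refine this.congr' ?_
    filter_upwards [eventually_gt_atTop 0] with t ht
    field_simp
  have h4 := (h1.mul h2).mul h3
  rw [mul_one, mul_one_div] at h4
  refine h4.congr' ?_
  filter_upwards [eventually_gt_atTop 0, h0.eventually_ge_atTop 1] with t ht ht1
  have h5 : (0 : ℝ) < ⌊t / κ - ρ⌋₊ := Nat.cast_pos.2 (Nat.floor_pos.2 ht1)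
  have h6 : t / κ - ρ ≠ 0 := by linarith
  simp only [Function.comp]
  rw [div_mul_div_cancel₀ h5.ne', div_mul_div_cancel₀ h6]

end MeanGain

/-! ### The expected gain and the score of a Poisson process -/

section Comparison

variable {d d₁ d₂ : ℕ} {f : Frame d d₁ d₂} {z : Fin d → ℝ}

/-- The anisotropic mesh adapted to the direction `z`. -/
def Frame.mesh (f : Frame d d₁ d₂) (z : Fin d → ℝ) (ε : unitInterval) (a : Fin d₁) : ℝ :=
  meshSize d₁ ε * geomMean z / |z (f.e (.inl a))|

/-- The normalized saving in direction `z`. -/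
def normalizedGain {d : ℕ} (d₁ : ℕ) (z : Fin d → ℝ) (ε : unitInterval) : ℝ :=
  ((∑ i, |z i|) - timeConstant d ε z) / (meshSize d₁ ε * geomMean z)

namespace Frame.Adapted

lemma scale_pos (hf : f.Adapted z) {ε : unitInterval} (h0 : (0 : ℝ) < ε) (h1 : (ε : ℝ) < 1) :
    0 < meshSize d₁ ε * geomMean z :=
  mul_pos (meshSize_pos d₁ h0 h1) hf.geomMean_pos

lemma mesh_pos (hf : f.Adapted z) {ε : unitInterval} (h0 : (0 : ℝ) < ε) (h1 : (ε : ℝ) < 1)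
    (a : Fin d₁) : 0 < f.mesh z ε a :=
  div_pos (hf.scale_pos h0 h1) (abs_pos.2 (hf.ne_zero a))

/-- This identity is where the geometric mean enters: its `d₁`-th power cancels the product of the
`|z_a|`. -/
lemma exp_neg_prod_mesh (hf : f.Adapted z) (hd : 1 ≤ d₁) {ε : unitInterval} (h0 : (0 : ℝ) < ε)
    (h1 : (ε : ℝ) < 1) : Real.exp (-∏ a, f.mesh z ε a) = 1 - ε := by
  have h : ∏ a, f.mesh z ε a = -Real.log (1 - ε) := by
    simp only [mesh, Finset.prod_div_distrib, Finset.prod_const, Finset.card_univ,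
      Fintype.card_fin]
    rw [mul_pow, hf.geomMean_pow hd, meshSize_pow hd h0 h1, mul_div_cancel_right₀]
    exact Finset.prod_ne_zero_iff.2 fun a _ => abs_ne_zero.2 (hf.ne_zero a)
  rw [h, neg_neg, Real.exp_log (by linarith)]

lemma tendsto_mesh (hd : 1 ≤ d₁) (a : Fin d₁) :
    Tendsto (fun ε => f.mesh z ε a) (𝓝[>] 0) (𝓝 0) := by
  have h := ((tendsto_meshSize hd).mul_const (geomMean z)).div_const |z (f.e (.inl a))|
  rwa [zero_mul, zero_div] at h

lemma tendsto_scale (hd : 1 ≤ d₁) :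
    Tendsto (fun ε => meshSize d₁ ε * geomMean z) (𝓝[>] 0) (𝓝 0) := by
  have h := (tendsto_meshSize hd).mul_const (geomMean z)
  rwa [zero_mul] at h

lemma mesh_mul_coord_le (hf : f.Adapted z) {ε : unitInterval} (h0 : (0 : ℝ) < ε)
    (h1 : (ε : ℝ) < 1) (n : ℕ) (a : Fin d₁) :
    f.mesh z ε a * (f.coord (floorPoint z n)).1 a
      ≤ meshSize d₁ ε * geomMean z * (n + ∑ b, 1 / |z (f.e (.inl b))|) := by
  have hr : 0 < |z (f.e (.inl a))| := abs_pos.2 (hf.ne_zero a)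
  have h2 := (abs_le.1 (hf.abs_coord_floorPoint_sub_le n a)).2
  have h3 : 1 / |z (f.e (.inl a))| ≤ ∑ b, 1 / |z (f.e (.inl b))| :=
    Finset.single_le_sum (f := fun b => 1 / |z (f.e (.inl b))|) (fun b _ => by positivity)
      (Finset.mem_univ a)
  calc f.mesh z ε a * (f.coord (floorPoint z n)).1 a
      ≤ f.mesh z ε a * (n * |z (f.e (.inl a))| + 1) :=
        mul_le_mul_of_nonneg_left (by linarith) (hf.mesh_pos h0 h1 a).le
    _ = meshSize d₁ ε * geomMean z * (n + 1 / |z (f.e (.inl a))|) := by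
        rw [mesh]; field_simp
    _ ≤ _ := mul_le_mul_of_nonneg_left (by linarith) (hf.scale_pos h0 h1).le

lemma eventually_coord_pos (hf : f.Adapted z) :
    ∀ᶠ n : ℕ in atTop, ∀ a, 0 < (f.coord (floorPoint z n)).1 a := by
  rw [eventually_all]
  intro a
  have hr : 0 < |z (f.e (.inl a))| := abs_pos.2 (hf.ne_zero a)
  filter_upwards [(tendsto_natCast_atTop_atTop.atTop_mul_const hr).eventually_gt_atTop 1] with n hn
  have h2 := (abs_le.1 (hf.abs_coord_floorPoint_sub_le n a)).1
  have h3 : (0 : ℝ) < (f.coord (floorPoint z n)).1 a := by linarith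
  exact_mod_cast h3

end Frame.Adapted

variable {Ω : Type*} [MeasurableSpace Ω] {P : Measure Ω} [IsProbabilityMeasure P]
  {ξ : Ω → Set (SemiSpace d₁ d₂)}

/-- The upper bound for the gain, at the macroscopic time `t`. -/
lemma eventually_meanGain_le (hd : 1 ≤ d₁) : ∃ A : ℝ, 0 < A ∧
    ∀ (θ : ℝ) (M : ℕ), 0 < θ → 1 ≤ M → θ ≤ M → ∃ D : ℝ, 0 ≤ D ∧
      ∀ {d : ℕ} {f : Frame d d₁ d₂} {z : Fin d → ℝ}, f.Adapted z →
      ∀ {Ω : Type*} [MeasurableSpace Ω] {P : Measure Ω} [IsProbabilityMeasure P]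
        {ξ : Ω → Set (SemiSpace d₁ d₂)}, IsPoissonPointProcess ξ (semiIntensity d₁ d₂) P →
      ∀ᶠ ε : unitInterval in 𝓝[>] 0, ∃ ρ : ℝ, ∀ᶠ t : ℝ in atTop,
        ENNReal.ofReal (meanGain ε z ⌊t / (meshSize d₁ ε * geomMean z) - ρ⌋₊)
            ≤ (∫⁻ ω, score (ξ ω) (fun _ => t) ∂P) + ENNReal.ofReal ((A * t + D) / θ) ∧
          ENNReal.ofReal (meanGain ε z ⌊t / (meshSize d₁ ε * geomMean z) - ρ⌋₊)
            ≤ ENNReal.ofReal (M * ((A * t + D) / θ)) := by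
  obtain ⟨A, hA, h⟩ := exists_upper_bound d₁ d₂ hd
  refine ⟨A, hA, fun θ M hθ hM hθM => ?_⟩
  obtain ⟨h₀, hh₀, D, hD, h⟩ := h θ M hθ hM hθM
  refine ⟨D, hD, fun {d f z} hf {Ω _ P _ ξ} hξ => ?_⟩
  have hmesh : ∀ᶠ ε : unitInterval in 𝓝[>] 0, ∀ a, f.mesh z ε a < h₀ :=
    eventually_all.2 fun a => (Frame.Adapted.tendsto_mesh hd a).eventually_lt_const hh₀
  filter_upwards [hmesh, eventually_coe_mem_Ioo] with ε hε ⟨h0, h1⟩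
  have hκ := hf.scale_pos h0 h1
  set κ := meshSize d₁ ε * geomMean z with hκdef
  -- This shift covers the rounding error of each coordinate, measured in units of `n`, so that the
  -- rescaled endpoint stays below `t`.
  refine ⟨∑ b, 1 / |z (f.e (.inl b))|, ?_⟩
  have hlim : Tendsto (fun t : ℝ => t / κ - ∑ b, 1 / |z (f.e (.inl b))|) atTop atTop :=
    tendsto_atTop_add_const_right _ _ (tendsto_id.atTop_div_const hκ)
  filter_upwards [eventually_ge_atTop 0, hlim.eventually_ge_atTop 0,
    (tendsto_nat_floor_atTop.comp hlim).eventually hf.eventually_coord_pos] with t ht ht1 hpos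
  refine h d f P ξ hξ (f.mesh z ε) ε _ t (fun a => ⟨hf.mesh_pos h0 h1 a, (hε a).le⟩)
    (hf.exp_neg_prod_mesh hd h0 h1) hpos (hf.coord_floorPoint_snd _) ht fun a => ?_
  refine (hf.mesh_mul_coord_le h0 h1 _ a).trans ?_
  have h2 := Nat.floor_le ht1
  calc κ * (_ + ∑ b, 1 / |z (f.e (.inl b))|) ≤ κ * (t / κ) :=
        mul_le_mul_of_nonneg_left (by linarith) hκ.le
    _ = t := mul_div_cancel₀ _ hκ.ne'

lemma normalizedGain_nonneg (hf : f.Adapted z) :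
    ∀ᶠ ε : unitInterval in 𝓝[>] 0, 0 ≤ normalizedGain d₁ z ε := by
  filter_upwards [eventually_coe_mem_Ioo] with ε ⟨h0, h1⟩
  exact div_nonneg (sub_nonneg.2 (timeConstant_le_sum_abs ε z)) (hf.scale_pos h0 h1).le

lemma tendsto_linear_div (A D θ : ℝ) :
    Tendsto (fun t : ℝ => (A * t + D) / θ / t) atTop (𝓝 (A / θ)) := by
  have h : Tendsto (fun t : ℝ => A / θ + (D / θ) / t) atTop (𝓝 (A / θ + 0)) :=
    tendsto_const_nhds.add (tendsto_const_nhds.div_atTop tendsto_id)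
  rw [add_zero] at h
  refine h.congr' ?_
  filter_upwards [eventually_gt_atTop 0] with t ht
  field_simp

/-- The score-free bound with `θ = M = 1` already suffices. -/
lemma exists_normalizedGain_le (hd : 1 ≤ d₁) (hf : f.Adapted z)
    (hξ : IsPoissonPointProcess ξ (semiIntensity d₁ d₂) P) :
    ∃ A : ℝ, ∀ᶠ ε : unitInterval in 𝓝[>] 0, normalizedGain d₁ z ε ∈ Set.Icc 0 A := by
  obtain ⟨A, hA, h⟩ := eventually_meanGain_le (d₂ := d₂) hd
  obtain ⟨D, hD, h⟩ := h 1 1 one_pos le_rfl (by norm_num)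
  refine ⟨A, ?_⟩
  filter_upwards [h hf hξ, eventually_coe_mem_Ioo, normalizedGain_nonneg hf]
    with ε ⟨ρ, hρ⟩ ⟨h0, h1⟩ hnn
  refine ⟨hnn, ?_⟩
  have h2 := tendsto_linear_div A D 1
  rw [div_one] at h2
  refine le_of_tendsto_of_tendsto (tendsto_meanGain_floor_div ε z (hf.scale_pos h0 h1) ρ) h2 ?_
  filter_upwards [hρ, eventually_gt_atTop 0] with t ht ht0
  refine div_le_div_of_nonneg_right ?_ ht0.le
  have h3 := (ENNReal.ofReal_le_ofReal_iff (by positivity)).1 ht.2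
  simpa using h3

lemma eventually_normalizedGain_le (hd : 1 ≤ d₁) (hf : f.Adapted z)
    (hξ : IsPoissonPointProcess ξ (semiIntensity d₁ d₂) P)
    (hfin : ∀ t : ℝ, 0 < t → ∫⁻ ω, score (ξ ω) (fun _ => t) ∂P ≠ ⊤) {η : ℝ} (hη : 0 < η) :
    ∀ᶠ ε : unitInterval in 𝓝[>] 0, ∀ᶠ t : ℝ in atTop,
      normalizedGain d₁ z ε ≤ (∫⁻ ω, score (ξ ω) (fun _ => t) ∂P).toReal / t + η := by
  obtain ⟨A, hA, h⟩ := eventually_meanGain_le (d₂ := d₂) hd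
  -- With `θ = 3 * A / η` the error per unit time tends to `A / θ = η / 3`, leaving room for the two
  -- limits in `t`.
  have hθ : 0 < 3 * A / η := by positivity
  obtain ⟨D, hD, h⟩ := h (3 * A / η) (⌈3 * A / η⌉₊) hθ (Nat.ceil_pos.2 hθ) (Nat.le_ceil _)
  filter_upwards [h hf hξ, eventually_coe_mem_Ioo] with ε ⟨ρ, hρ⟩ ⟨h0, h1⟩
  have hA3 : A / (3 * A / η) = η / 3 := by field_simp
  have h2 := tendsto_linear_div A D (3 * A / η)
  rw [hA3] at h2
  have h3 := tendsto_meanGain_floor_div ε z (hf.scale_pos h0 h1) ρ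
  filter_upwards [hρ, eventually_gt_atTop 0,
    h2.eventually_lt_const (show η / 3 < 2 * η / 3 by linarith),
    h3.eventually_const_lt
      (show normalizedGain d₁ z ε - η / 3 < normalizedGain d₁ z ε by linarith)] with t ht ht0 ht2 ht3
  have h4 : meanGain ε z ⌊t / (meshSize d₁ ε * geomMean z) - ρ⌋₊
      ≤ (∫⁻ ω, score (ξ ω) (fun _ => t) ∂P).toReal + (A * t + D) / (3 * A / η) := by
    have h5 := ht.1
    rw [← ENNReal.ofReal_toReal (hfin t ht0), ← ENNReal.ofReal_add ENNReal.toReal_nonneg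
      (by positivity)] at h5
    exact (ENNReal.ofReal_le_ofReal_iff (by positivity)).1 h5
  have h6 := div_le_div_of_nonneg_right h4 ht0.le
  rw [add_div] at h6
  linarith

/-- The score up to `L` is compared with the gain at `n = ⌈L / κ⌉`; rounding up costs one more `κ`
beside `L`. A bound holding merely frequently is enough, since Fatou is applied along a sequence
extracted from the filter. -/
lemma lintegral_score_le_of_frequently (hd : 1 ≤ d₁) (hf : f.Adapted z)
    (hξ : IsPoissonPointProcess ξ (semiIntensity d₁ d₂) P) {L c : ℝ} (hL : 0 < L)
    (hc : ∃ᶠ ε : unitInterval in 𝓝[>] 0,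
      2 * d + (L + meshSize d₁ ε * geomMean z) * normalizedGain d₁ z ε ≤ c) :
    ∫⁻ ω, score (ξ ω) (fun _ => L) ∂P ≤ ENNReal.ofReal c := by
  obtain ⟨ε, hε, hεc⟩ := exists_seq_forall_of_frequently (hc.and_eventually eventually_coe_mem_Ioo)
  have hκ := fun i => hf.scale_pos (hεc i).2.1 (hεc i).2.2
  refine (lintegral_score_le_liminf f hξ hd (h := fun i => f.mesh z (ε i))
    (fun i => hf.mesh_pos (hεc i).2.1 (hεc i).2.2)
    (fun a => (Frame.Adapted.tendsto_mesh hd a).comp hε)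
    (fun i => hf.exp_neg_prod_mesh hd (hεc i).2.1 (hεc i).2.2) hL
    (y := fun i => floorPoint z ⌈L / (meshSize d₁ (ε i) * geomMean z)⌉₊)
    (fun i a => ?_) (fun i => hf.coord_floorPoint_snd _)).trans ?_
  · have hr : 0 < |z (f.e (.inl a))| := abs_pos.2 (hf.ne_zero a)
    have h2 := (abs_le.1 (hf.abs_coord_floorPoint_sub_le
      ⌈L / (meshSize d₁ (ε i) * geomMean z)⌉₊ a)).1
    have h3 := mul_le_mul_of_nonneg_right (Nat.le_ceil (L / (meshSize d₁ (ε i) * geomMean z))) hr.le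
    have h4 : L / f.mesh z (ε i) a
        = L / (meshSize d₁ (ε i) * geomMean z) * |z (f.e (.inl a))| := by
      rw [Frame.mesh, div_div_eq_mul_div, div_mul_eq_mul_div]
    rw [h4]
    linarith
  · refine liminf_le_of_frequently_le' (Frequently.of_forall fun i => ?_)
    refine ENNReal.ofReal_le_ofReal (le_trans (meanGain_le (ε i) z _) (le_trans ?_ (hεc i).1))
    have h5 := (Nat.ceil_lt_add_one (div_nonneg hL.le (hκ i).le)).le
    have h6 : 0 ≤ (∑ j, |z j|) - timeConstant d (ε i) z :=
      sub_nonneg.2 (timeConstant_le_sum_abs _ z)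
    have h7 := mul_le_mul_of_nonneg_right h5 h6
    have h8 : (L + meshSize d₁ (ε i) * geomMean z) * normalizedGain d₁ z (ε i)
        = (L / (meshSize d₁ (ε i) * geomMean z) + 1)
          * ((∑ j, |z j|) - timeConstant d (ε i) z) := by
      have := (hκ i).ne'
      rw [normalizedGain]
      generalize meshSize d₁ (ε i) * geomMean z = κ at this
      field_simp
    linarith

/-- Finiteness is inherited from the lattice, where the normalized gain stays bounded. -/
lemma lintegral_score_ne_top (hd : 1 ≤ d₁) (hf : f.Adapted z)
    (hξ : IsPoissonPointProcess ξ (semiIntensity d₁ d₂) P) {L : ℝ} (hL : 0 < L) :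
    ∫⁻ ω, score (ξ ω) (fun _ => L) ∂P ≠ ⊤ := by
  obtain ⟨A, hA⟩ := exists_normalizedGain_le hd hf hξ
  refine ne_top_of_le_ne_top ENNReal.ofReal_ne_top (lintegral_score_le_of_frequently hd hf hξ hL
    (c := 2 * d + (L + 1) * A) (Eventually.frequently ?_))
  filter_upwards [hA, eventually_coe_mem_Ioo,
    (Frame.Adapted.tendsto_scale (z := z) hd).eventually_lt_const one_pos] with ε h1 h2 h3
  have h4 := hf.scale_pos h2.1 h2.2
  have h5 := mul_le_mul (show L + meshSize d₁ ε * geomMean z ≤ L + 1 by linarith) h1.2 h1.1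
    (by linarith)
  linarith

lemma eventually_score_le (hd : 1 ≤ d₁) (hf : f.Adapted z)
    (hξ : IsPoissonPointProcess ξ (semiIntensity d₁ d₂) P) {L η : ℝ} (hL : 0 < L) (hη : 0 < η) :
    ∀ᶠ ε : unitInterval in 𝓝[>] 0, (∫⁻ ω, score (ξ ω) (fun _ => L) ∂P).toReal
      ≤ 2 * d + L * (normalizedGain d₁ z ε + η) := by
  obtain ⟨A, hA⟩ := exists_normalizedGain_le hd hf hξ
  by_contra hcon
  rw [not_eventually] at hcon
  set F := (∫⁻ ω, score (ξ ω) (fun _ => L) ∂P).toReal with hF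
  have hsmall : ∀ᶠ ε : unitInterval in 𝓝[>] 0, meshSize d₁ ε * geomMean z * A < L * η / 2 := by
    have h := (Frame.Adapted.tendsto_scale (d₁ := d₁) (z := z) hd).mul_const A
    rw [zero_mul] at h
    exact h.eventually_lt_const (by positivity)
  -- If the claim failed frequently, `F` would be bounded by `F - L * η / 2`. The sign condition is
  -- recorded so that the contradiction survives `ENNReal.ofReal`.
  have hfreq : ∃ᶠ ε : unitInterval in 𝓝[>] 0,
      0 ≤ F - L * η / 2 ∧
        2 * d + (L + meshSize d₁ ε * geomMean z) * normalizedGain d₁ z ε ≤ F - L * η / 2 := by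
    refine (hcon.and_eventually (hA.and (hsmall.and eventually_coe_mem_Ioo))).mono ?_
    rintro ε ⟨h1, ⟨h2, h3⟩, h4, h5, h6⟩
    have h7 := hf.scale_pos h5 h6
    have h8 := mul_le_mul_of_nonneg_left h3 h7.le
    have h9 := mul_nonneg hL.le h2
    have h10 : (0 : ℝ) ≤ d := d.cast_nonneg
    have h11 := mul_pos hL hη
    push Not at h1
    constructor <;> linarith
  obtain ⟨ε, hε, -⟩ := hfreq.exists
  have h := lintegral_score_le_of_frequently hd hf hξ hL (hfreq.mono fun _ h => h.2)
  rw [← ENNReal.ofReal_toReal (lintegral_score_ne_top hd hf hξ hL),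
    ENNReal.ofReal_le_ofReal_iff hε] at h
  have := mul_pos hL hη
  linarith

/-- The mean score and the normalized saving have the same limit. -/
theorem exists_tendsto_score_normalizedGain (hd : 1 ≤ d₁) (hf : f.Adapted z)
    (hξ : IsPoissonPointProcess ξ (semiIntensity d₁ d₂) P) :
    ∃ C : ℝ, 0 < C ∧ HasDirectionalScore P ξ (fun _ => 1) (ENNReal.ofReal C) ∧
      Tendsto (normalizedGain d₁ z) (𝓝[>] 0) (𝓝 C) := by
  have hfin := fun t (ht : 0 < t) => lintegral_score_ne_top hd hf hξ ht
  obtain ⟨A, hA⟩ := exists_normalizedGain_le hd hf hξ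
  obtain ⟨C, hC1, hC2⟩ := exists_tendsto_of_comparison (by positivity : (0 : ℝ) ≤ 2 * d) hA
    (fun η hη => eventually_normalizedGain_le hd hf hξ hfin hη)
    (fun L hL η hη => eventually_score_le hd hf hξ hL hη)
  refine ⟨C, ?_, ?_, hC2⟩
  · have he : 0 < 1 - Real.exp (-1) := by
      have := Real.exp_lt_one_iff.2 (show (-1 : ℝ) < 0 by norm_num)
      linarith
    have h1 := (tendsto_nat_floor_div_atTop (R := ℝ)).mul_const (1 - Real.exp (-1))
    rw [one_mul] at h1
    refine he.trans_le (le_of_tendsto_of_tendsto h1 hC1 ?_)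
    filter_upwards [eventually_ge_atTop 1] with t ht
    have ht0 : 0 < t := by linarith
    have h2 := le_lintegral_score hξ ⌊t⌋₊ (Nat.floor_pos.2 ht) (Nat.floor_le ht0.le)
    rw [← ENNReal.ofReal_toReal (hfin t ht0),
      ENNReal.ofReal_le_ofReal_iff ENNReal.toReal_nonneg] at h2
    rw [div_mul_eq_mul_div]
    exact div_le_div_of_nonneg_right h2 ht0.le
  · refine (ENNReal.tendsto_ofReal hC1).congr' ?_
    filter_upwards [eventually_gt_atTop 0] with t ht
    have h3 : t • (fun _ : Fin d₁ => (1 : ℝ)) = fun _ => t := by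
      funext a
      simp
    rw [h3, ENNReal.ofReal_div_of_pos ht, ENNReal.ofReal_toReal (hfin t ht)]

end Comparison

/-! ### Frames for all directions -/

/-- The standard frame of `ℤ^{d₁ + d₂}`. -/
def Frame.standard (d₁ d₂ : ℕ) : Frame (d₁ + d₂) d₁ d₂ where
  e := finSumFinEquiv
  σ _ := 1
  σ_sq _ := one_mul 1

lemma Frame.standard_adapted (d₁ d₂ : ℕ) :
    (Frame.standard d₁ d₂).Adapted (Fin.append (fun _ => 1) (fun _ => 0)) where
  pos a := by simp [Frame.standard]
  zero b := by simp [Frame.standard]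

lemma exists_adapted {d : ℕ} (z : Fin d → ℝ) :
    ∃ f : Frame d (numNonzero z) (numZero z), f.Adapted z := by
  let e₁ : Fin (numNonzero z) ≃ {i // z i ≠ 0} :=
    (Fintype.equivFinOfCardEq (by rw [Fintype.card_subtype]; rfl)).symm
  let e₂ : Fin (numZero z) ≃ {i // ¬ z i ≠ 0} :=
    (Fintype.equivFinOfCardEq (by simp only [not_not]; rw [Fintype.card_subtype]; rfl)).symm
  let e := (Equiv.sumCongr e₁ e₂).trans (Equiv.sumCompl fun i => z i ≠ 0)
  refine ⟨⟨e, fun a => if 0 < z (e (.inl a)) then 1 else -1, fun a => ?_⟩, fun a => ?_, fun b => ?_⟩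
  · split_ifs <;> norm_num
  · have h : z (e (.inl a)) ≠ 0 := (e₁ a).2
    rcases h.lt_or_gt with h | h
    · simp [h.not_gt, h]
    · simp [h]
  · exact not_not.1 (e₂ b).2

lemma numNonzero_pos {d : ℕ} {z : Fin d → ℝ} (hz : z ≠ 0) : 1 ≤ numNonzero z := by
  obtain ⟨i, hi⟩ := Function.ne_iff.1 hz
  exact Finset.card_pos.2 ⟨i, by simpa using hi⟩

/-- The first order expansion of the time constant from the convergence of the normalized saving. -/
lemma isLittleO_timeConstant_sub {d d₁ : ℕ} {z : Fin d → ℝ} {C : ℝ} (hγ : geomMean z ≠ 0)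
    (h : Tendsto (normalizedGain d₁ z) (𝓝[>] 0) (𝓝 C)) :
    (fun ε : unitInterval => timeConstant d ε z
        - ((∑ i, |z i|) - C * geomMean z * (ε : ℝ) ^ (1 / (d₁ : ℝ))))
      =o[𝓝[>] (0 : unitInterval)] fun ε : unitInterval => (ε : ℝ) ^ (1 / (d₁ : ℝ)) := by
  refine isLittleO_of_tendsto' ?_ ?_
  · filter_upwards [eventually_coe_mem_Ioo] with ε hε h0
    exact absurd h0 (Real.rpow_pos_of_pos hε.1 _).ne'
  -- The quotient equals `(C - normalizedGain * (meshSize / ε^{1/d₁})) * geomMean z`, and the two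
  -- factors inside tend to `C` and `1`.
  · have h1 := ((tendsto_const_nhds (x := C)).sub (h.mul (tendsto_meshSize_div d₁))).mul_const
      (geomMean z)
    rw [mul_one, sub_self, zero_mul] at h1
    refine h1.congr' ?_
    filter_upwards [eventually_coe_mem_Ioo] with ε hε
    have h2 := (Real.rpow_pos_of_pos hε.1 (1 / (d₁ : ℝ))).ne'
    have h3 := (meshSize_pos d₁ hε.1 hε.2).ne'
    rw [normalizedGain]
    generalize (ε : ℝ) ^ (1 / (d₁ : ℝ)) = x at h2
    field_simp
    ring

/-- There is a constant governing the score and the time constants in all directions. -/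
lemma exists_constant {d₁ : ℕ} (d₂ : ℕ) (hd : 1 ≤ d₁) : ∃ C : ℝ, 0 < C ∧
    (∀ (Ω : Type*) (_ : MeasurableSpace Ω) (P : Measure Ω) (_ : IsProbabilityMeasure P)
      (ξ : Ω → Set (SemiSpace d₁ d₂)), IsPoissonPointProcess ξ (semiIntensity d₁ d₂) P →
      HasDirectionalScore P ξ (fun _ => 1) (ENNReal.ofReal C)) ∧
    ∀ (d : ℕ) (f : Frame d d₁ d₂) (z : Fin d → ℝ), f.Adapted z →
      Tendsto (normalizedGain d₁ z) (𝓝[>] 0) (𝓝 C) := by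
  obtain ⟨Ω₀, _, P₀, _, ξ₀, hξ₀⟩ := exists_isPoissonPointProcess (d₂ := d₂) hd
  obtain ⟨C, hC, hs, hg⟩ :=
    exists_tendsto_score_normalizedGain hd (Frame.standard_adapted d₁ d₂) hξ₀
  refine ⟨C, hC, fun Ω _ P _ ξ hξ => ?_, fun d f z hf => ?_⟩
  -- For another Poisson process, the normalized gain of the standard direction pins the constant.
  · obtain ⟨C', -, hs', hg'⟩ :=
      exists_tendsto_score_normalizedGain hd (Frame.standard_adapted d₁ d₂) hξ
    rwa [tendsto_nhds_unique hg hg']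
  -- For another direction, the score of the reference process pins it.
  · obtain ⟨C', hC', hs', hg'⟩ := exists_tendsto_score_normalizedGain hd hf hξ₀
    have := tendsto_nhds_unique hs hs'
    rw [ENNReal.ofReal_eq_ofReal_iff hC.le hC'.le] at this
    rwa [this]

end

/-! ### The main theorem -/

theorem theorem2 :
    ∃ C : ℕ → ℕ → ℝ,
      (∀ d₁ d₂ : ℕ, 1 ≤ d₁ →
        0 < C d₁ d₂ ∧
        (∃ (Ω : Type) (_ : MeasurableSpace Ω) (P : Measure Ω) (_ : IsProbabilityMeasure P)
          (ξ : Ω → Set (SemiSpace d₁ d₂)),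
          IsPoissonPointProcess ξ (semiIntensity d₁ d₂) P) ∧
        (∀ (Ω : Type*) (_ : MeasurableSpace Ω) (P : Measure Ω) (_ : IsProbabilityMeasure P)
          (ξ : Ω → Set (SemiSpace d₁ d₂)),
          IsPoissonPointProcess ξ (semiIntensity d₁ d₂) P →
          HasDirectionalScore P ξ (fun _ => 1) (ENNReal.ofReal (C d₁ d₂)))) ∧
      (∀ (d : ℕ), 2 ≤ d → ∀ z : Fin d → ℝ, z ≠ 0 →
        (∀ ε : unitInterval,
          Tendsto (meanPassageTime d ε z) atTop (𝓝 (timeConstant d ε z))) ∧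
        (fun ε : unitInterval =>
            timeConstant d ε z
              - ((∑ i, |z i|)
                - C (numNonzero z) (numZero z) * geomMean z
                    * (ε : ℝ) ^ (1 / (numNonzero z : ℝ))))
          =o[𝓝[>] (0 : unitInterval)]
            (fun ε : unitInterval => (ε : ℝ) ^ (1 / (numNonzero z : ℝ)))) := by
  choose C hC using fun (d₁ d₂ : ℕ) (hd : 1 ≤ d₁) => exists_constant d₂ hd
  -- The default `0` at `d₁ = 0` is never used, since `z ≠ 0` has a nonzero coordinate.
  refine ⟨fun d₁ d₂ => if hd : 1 ≤ d₁ then C d₁ d₂ hd else 0, fun d₁ d₂ hd => ?_,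
    fun d _ z hz => ⟨fun ε => (tendsto_meanPassageTime d ε z).1, ?_⟩⟩
  · simp only [hd, dite_true]
    exact ⟨(hC d₁ d₂ hd).1, exists_isPoissonPointProcess hd, (hC d₁ d₂ hd).2.1⟩
  · obtain ⟨f, hf⟩ := exists_adapted z
    simp only [numNonzero_pos hz, dite_true]
    exact isLittleO_timeConstant_sub hf.geomMean_pos.ne'
      ((hC _ _ (numNonzero_pos hz)).2.2 d f z hf)
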